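/- Let $\mathbb K$ be a field of characteristic zero, with the discrete topology. A vector space is profinite if it is an inverse limit of finite-dimensional (discrete) vector spaces; $V\hat\otimes U$ is the inverse limit of the spaces $V/W_1\otimes U/W_2$ over the open subspaces $W_1\subset V$, $W_2\subset U$, and $\widehat T(V)=\prod_{n\ge 0}V^{\hat\otimes n}$. For a profinite Lie algebra $\mathfrak g$, the completed universal enveloping algebra $\widehat U(\mathfrak g)$ is the quotient of $\widehat T(\mathfrak g)$ by the closure of the two-sided ideal generated by the elements $x\otimes y-y\otimes x-[x,y]$. Its comultiplication and counit are the unique continuous linear maps that extend those of the tensor algebra $T(\mathfrak g)$, for which the elements of $\mathfrak g$ are primitive. **Graphs.** A graph $\Gamma$ is a finite set of half-edges with a partition into pairs (the edges), a partition into nonempty blocks (the vertices) and a set of one-element vertices (the external vertices). An edge is internal if it meets no external vertex. The empty graph $\mathbf 1$ is a graph, but it is not connected. A subgraph $\gamma\subset\Gamma$ is a set of internal edges; it is nontrivial if it is neither empty nor the set of all internal edges. $\Gamma/\gamma$ is obtained by contracting the edges of $\gamma$. A subgraph $\gamma$ also denotes the graph whose internal vertices are the vertices of $\Gamma$ that meet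 $\gamma$, whose internal edges are those of $\gamma$, and in which every other half-edge on these vertices is completed, by a new half-edge forming an external vertex, to an external edge. **The bialgebra.** Let $\mathcal H$ be the vector space with basis the isomorphism classes of graphs, with the commutative product $\mu$ given by disjoint union, and let $\nabla:\mathcal H\to\mathcal H\otimes\mathcal H$ be the algebra homomorphism given on connected graphs by $$\nabla(\Gamma)=\mathbf 1\otimes\Gamma+\Gamma\otimes\mathbf 1+\sum_{\gamma}\gamma\otimes\Gamma/\gamma ,$$ the sum over the nontrivial subgraphs of $\Gamma$. Let $\widehat{\mathcal H}$ be the space of formal infinite linear combinations of isomorphism classes of graphs, with the product topology, and let $I:\widehat{\mathcal H}\cong\mathcal H^*$ be given by $\Gamma\mapsto|\mathrm{Aut}(\Gamma)|\langle\Gamma,-\rangle$, where $\langle\Gamma,\Gamma'\rangle$ is $1$ if $\Gamma\cong\Gamma'$ and $0$ otherwise. The product $\star$ and the comultiplication $\Delta$ of $\widehat{\mathcal H}$ are defined by $I\circ\star=\nabla^*\circ(I\hat\otimes I)$ and $(I\hat\otimes I)\circ\Delta=\mu^*\circ I$. Let $\widehat{\mathcal H}_c^+\subset\widehat{\mathcal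 H}$ be the space of formal sums of connected graphs with at least one internal edge, and $\widehat{\mathcal H}^+\subset\widehat{\mathcal H}$ the space of formal sums of disjoint unions (the empty one included) of such graphs. **Theorem.** $\widehat{\mathcal H}^+$ contains $\mathbf 1$, is closed under $\star$, and is under $\star$ an associative algebra with unit $\mathbf 1$ and with continuous product; $\Delta$ restricts to a continuous map $\widehat{\mathcal H}^+\to\widehat{\mathcal H}^+\hat\otimes\widehat{\mathcal H}^+$. The space of primitive elements of $\widehat{\mathcal H}^+$ is $\widehat{\mathcal H}_c^+$, which is a Lie algebra under $[x,y]=x\star y-y\star x$. The comultiplication and the counit of $\widehat U(\widehat{\mathcal H}_c^+)$ exist and are unique. There is an isomorphism of topological vector spaces $$\Phi:\widehat U(\widehat{\mathcal H}_c^+)\;\cong\;\widehat{\mathcal H}^+,\qquad \Gamma_1\hat\otimes\cdots\hat\otimes\Gamma_n\mapsto\Gamma_1\star\cdots\star\Gamma_n\quad(n\ge 0,\ \Gamma_i\in\widehat{\mathcal H}_c^+),$$ which is the only continuous linear map given by this formula, and it is an isomorphism of bialgebras: it respects the units, the products, the comultiplications, and the counits, the counit of $\widehat{\mathcal H}^+$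 being the coefficient of $\mathbf 1$. -/

import Mathlib

open scoped TensorProduct

universe u v w

/-! ## Completed tensor products of profinite vector spaces

The ground field is discrete.  A profinite vector space `V` is the inverse limit of its
finite-dimensional quotients `V ⧸ W`, where `W` runs over the open subspaces of `V`. -/

namespace Profinite

section Tensor

variable (K : Type u) [Field K]

/-- The open linear subspaces of a topological vector space. -/
abbrev OpenSub (V : Type v) [AddCommGroup V] [Module K V] [TopologicalSpace V] : Type v :=
  {W : Submodule K V // IsOpen (W : Set V)}

variable (V : Type v) [AddCommGroup V] [Module K V] [TopologicalSpace V]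
variable (U : Type w) [AddCommGroup U] [Module K U] [TopologicalSpace U]

/-- The inverse limit of the spaces `V ⧸ W₁ ⊗ U ⧸ W₂`, over the open subspaces `W₁` of `V` and `W₂`
of `U`, as a space of compatible families. -/
def tensorLimit :
    Submodule K ((p : OpenSub K V × OpenSub K U) → (V ⧸ p.1.1) ⊗[K] (U ⧸ p.2.1)) where
  carrier := {x | ∀ (p q : OpenSub K V × OpenSub K U) (h₁ : p.1.1 ≤ q.1.1) (h₂ : p.2.1 ≤ q.2.1),
    TensorProduct.map (Submodule.factor h₁) (Submodule.factor h₂) (x p) = x q}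
  add_mem' := by
    intro x y hx hy p q h₁ h₂
    simp only [Pi.add_apply, map_add, hx p q h₁ h₂, hy p q h₁ h₂]
  zero_mem' := by
    intro p q h₁ h₂
    simp only [Pi.zero_apply, map_zero]
  smul_mem' := by
    intro c x hx p q h₁ h₂
    simp only [Pi.smul_apply, map_smul, hx p q h₁ h₂]

/-- The completed tensor product of two profinite vector spaces. -/
def CompletedTensor : Type (max v w) := tensorLimit K V U

namespace CompletedTensor

noncomputable instance : AddCommGroup (CompletedTensor K V U) :=
  inferInstanceAs (AddCommGroup (tensorLimit K V U))

noncomputable instance : Module K (CompletedTensor K V U) :=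
  inferInstanceAs (Module K (tensorLimit K V U))

/-- The inverse limit topology, the factors of the product being discrete. -/
instance : TopologicalSpace (CompletedTensor K V U) :=
  TopologicalSpace.induced (fun x => x.1) (@Pi.topologicalSpace _ _ fun _ => ⊥)

/-- The canonical map from the tensor product to the completed tensor product. -/
noncomputable def ofTensor : V ⊗[K] U →ₗ[K] CompletedTensor K V U where
  toFun t := ⟨fun p => TensorProduct.map p.1.1.mkQ p.2.1.mkQ t, by
    intro p q h₁ h₂
    rw [← LinearMap.comp_apply, ← TensorProduct.map_comp, Submodule.factor_comp_mk,
      Submodule.factor_comp_mk]⟩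
  map_add' s t := Subtype.ext (funext fun p => map_add _ s t)
  map_smul' c t := Subtype.ext (funext fun p => map_smul _ c t)

variable {K V U}

section Map

variable {V' : Type*} [AddCommGroup V'] [Module K V'] [TopologicalSpace V']
variable {U' : Type*} [AddCommGroup U'] [Module K U'] [TopologicalSpace U']

/-- The preimage of an open subspace under a continuous linear map. -/
abbrev _root_.Profinite.OpenSub.comap (f : V →L[K] V') (W : OpenSub K V') : OpenSub K V :=
  ⟨W.1.comap (f : V →ₗ[K] V'), W.2.preimage f.continuous⟩

/-- The completed tensor product `f ⊗̂ g` of two continuous linear maps. -/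
noncomputable def map (f : V →L[K] V') (g : U →L[K] U') :
    CompletedTensor K V U →ₗ[K] CompletedTensor K V' U' where
  toFun x := ⟨fun p => TensorProduct.map
      (Submodule.mapQ (p.1.comap f).1 p.1.1 (f : V →ₗ[K] V') le_rfl)
      (Submodule.mapQ (p.2.comap g).1 p.2.1 (g : U →ₗ[K] U') le_rfl)
      (x.1 (p.1.comap f, p.2.comap g)), by
    intro p q h₁ h₂
    dsimp only
    have hx := x.2 (p.1.comap f, p.2.comap g) (q.1.comap f, q.2.comap g)
      (Submodule.comap_mono h₁) (Submodule.comap_mono h₂)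
    rw [← hx, ← LinearMap.comp_apply, ← LinearMap.comp_apply, ← TensorProduct.map_comp,
      ← TensorProduct.map_comp]
    congr 2
    · ext; rfl
    · ext; rfl⟩
  map_add' x y := Subtype.ext (funext fun p => map_add _ _ _)
  map_smul' c x := Subtype.ext (funext fun p => map_smul _ c _)

end Map

end CompletedTensor

end Tensor

/-! ## The completed tensor algebra and the completed universal enveloping algebra -/

section TensorAlg

variable (K : Type u) [Field K]

/-- `TruncRel K M N` kills the products of at least `N` vectors. -/
def TruncRel (M : Type v) [AddCommGroup M] [Module K M] (N : ℕ) (a b : TensorAlgebra K M) : Prop :=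
  (∃ n, N ≤ n ∧ ∃ x : Fin n → M, a = TensorAlgebra.tprod K M n x) ∧ b = 0

/-- The truncated tensor algebra `⨁_{n < N} M^{⊗ n}`, as the quotient algebra of `T(M)` by the ideal
of tensors of order at least `N`. -/
abbrev TruncTensor (M : Type v) [AddCommGroup M] [Module K M] (N : ℕ) : Type (max u v) :=
  RingQuot (TruncRel K M N)

variable {K} in
/-- The map of tensor algebras induced by a linear map. -/
noncomputable def tensorAlgebraMap {M : Type v} [AddCommGroup M] [Module K M]
    {M' : Type w} [AddCommGroup M'] [Module K M'] (f : M →ₗ[K] M') :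
    TensorAlgebra K M →ₐ[K] TensorAlgebra K M' :=
  TensorAlgebra.lift K (TensorAlgebra.ι K ∘ₗ f)

variable {K} in
/-- The map of truncated tensor algebras induced by a linear map `f : M → M'`, for `N' ≤ N`. -/
noncomputable def TruncTensor.map {M : Type v} [AddCommGroup M] [Module K M]
    {M' : Type w} [AddCommGroup M'] [Module K M'] (f : M →ₗ[K] M') {N N' : ℕ} (h : N' ≤ N) :
    TruncTensor K M N →ₐ[K] TruncTensor K M' N' :=
  RingQuot.liftAlgHom K ⟨(RingQuot.mkAlgHom K (TruncRel K M' N')).comp (tensorAlgebraMap f), by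
    rintro a b ⟨⟨n, hn, x, rfl⟩, rfl⟩
    have hx : tensorAlgebraMap f (TensorAlgebra.tprod K M n x)
        = TensorAlgebra.tprod K M' n (fun i => f (x i)) := by
      simp [tensorAlgebraMap, TensorAlgebra.tprod_apply, map_list_prod, List.map_ofFn, Function.comp_def]
    rw [AlgHom.comp_apply, AlgHom.comp_apply, hx, map_zero]
    exact RingQuot.mkAlgHom_rel K ⟨⟨n, h.trans hn, _, rfl⟩, rfl⟩⟩

variable (V : Type v) [AddCommGroup V] [Module K V] [TopologicalSpace V]

/-- The compatible families in the algebras `⨁_{n < N} (V ⧸ W)^{⊗ n}`, for `W` an open subspace of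
`V` and `N` a natural number. -/
def tensorAlgebraLimit :
    Subalgebra K ((p : OpenSub K V × ℕ) → TruncTensor K (V ⧸ p.1.1) p.2) where
  carrier := {x | ∀ (p q : OpenSub K V × ℕ) (h₁ : p.1.1 ≤ q.1.1) (h₂ : q.2 ≤ p.2),
    TruncTensor.map (Submodule.factor h₁) h₂ (x p) = x q}
  add_mem' := by
    intro x y hx hy p q h₁ h₂
    simp only [Pi.add_apply, map_add, hx p q h₁ h₂, hy p q h₁ h₂]
  mul_mem' := by
    intro x y hx hy p q h₁ h₂
    simp only [Pi.mul_apply, map_mul, hx p q h₁ h₂, hy p q h₁ h₂]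
  algebraMap_mem' := by
    intro c p q h₁ h₂
    simp only [Pi.algebraMap_apply, AlgHom.commutes]

/-- The completed tensor algebra `∏ₙ V^{⊗̂ n}` of a profinite vector space `V`, with
`V^{⊗̂ n} = lim_W (V ⧸ W)^{⊗ n}`: the inverse limit of the algebras `⨁_{n < N} (V ⧸ W)^{⊗ n}`
over the open subspaces `W` of `V` and the natural numbers `N`. -/
def CompletedTensorAlgebra : Type (max u v) := tensorAlgebraLimit K V

namespace CompletedTensorAlgebra

noncomputable instance : Ring (CompletedTensorAlgebra K V) :=
  inferInstanceAs (Ring (tensorAlgebraLimit K V))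

noncomputable instance : Algebra K (CompletedTensorAlgebra K V) :=
  inferInstanceAs (Algebra K (tensorAlgebraLimit K V))

/-- The inverse limit topology, the factors of the product being discrete. -/
instance : TopologicalSpace (CompletedTensorAlgebra K V) :=
  TopologicalSpace.induced (fun x => x.1) (@Pi.topologicalSpace _ _ fun _ => ⊥)

instance : IsTopologicalRing (CompletedTensorAlgebra K V) := by
  let (p : OpenSub K V × ℕ) : TopologicalSpace (TruncTensor K (V ⧸ p.1.1) p.2) := ⊥
  have (p : OpenSub K V × ℕ) : DiscreteTopology (TruncTensor K (V ⧸ p.1.1) p.2) := ⟨rfl⟩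
  exact inferInstanceAs (IsTopologicalRing (tensorAlgebraLimit K V).toSubring)

/-- The canonical map `T(V) → T̂(V)`. -/
noncomputable def ofTensorAlgebra : TensorAlgebra K V →ₐ[K] CompletedTensorAlgebra K V :=
  (AlgHom.pi fun p : OpenSub K V × ℕ =>
    (RingQuot.mkAlgHom K (TruncRel K (V ⧸ p.1.1) p.2)).comp
      (tensorAlgebraMap p.1.1.mkQ)).codRestrict (tensorAlgebraLimit K V) (by
    intro t p q h₁ h₂
    simp only [AlgHom.pi_apply, AlgHom.comp_apply, TruncTensor.map,
      RingQuot.liftAlgHom_mkAlgHom_apply]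
    congr 1
    rw [← AlgHom.comp_apply]
    refine DFunLike.congr_fun (TensorAlgebra.hom_ext (LinearMap.ext fun v => ?_)) t
    simp [tensorAlgebraMap])

/-- The canonical inclusion of `V` into its completed tensor algebra. -/
noncomputable def ι : V →ₗ[K] CompletedTensorAlgebra K V :=
  (ofTensorAlgebra K V).toLinearMap ∘ₗ TensorAlgebra.ι K

end CompletedTensorAlgebra

variable {V}

/-- The closure of the two-sided ideal of `T̂(V)` generated by the elements
`x ⊗ y - y ⊗ x - [x, y]`. -/
noncomputable def lieIdeal (br : V → V → V) : Ideal (CompletedTensorAlgebra K V) :=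
  (TwoSidedIdeal.span {r | ∃ x y : V, r =
    CompletedTensorAlgebra.ι K V x * CompletedTensorAlgebra.ι K V y
      - CompletedTensorAlgebra.ι K V y * CompletedTensorAlgebra.ι K V x
      - CompletedTensorAlgebra.ι K V (br x y)}).asIdeal.closure

instance (br : V → V → V) : (lieIdeal K br).IsTwoSided where
  mul_mem_of_left {a} b ha := by
    have h := map_mem_closure (f := fun x => x * b) (continuous_mul_const b)
      (show a ∈ closure _ from ha) (fun r hr => Ideal.mul_mem_right b _ hr)
    exact h

/-- The completed universal enveloping algebra of a profinite Lie algebra `V` with Lie bracket `br`: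
the quotient of the completed tensor algebra of `V` by the closed ideal above. -/
def CompletedEnveloping (br : V → V → V) : Type (max u v) :=
  CompletedTensorAlgebra K V ⧸ lieIdeal K br

namespace CompletedEnveloping

variable (br : V → V → V)

noncomputable instance : Ring (CompletedEnveloping K br) :=
  inferInstanceAs (Ring (CompletedTensorAlgebra K V ⧸ lieIdeal K br))

noncomputable instance : Algebra K (CompletedEnveloping K br) :=
  inferInstanceAs (Algebra K (CompletedTensorAlgebra K V ⧸ lieIdeal K br))

/-- The projection from the completed tensor algebra. -/
noncomputable def mk : CompletedTensorAlgebra K V →ₐ[K] CompletedEnveloping K br :=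
  Ideal.Quotient.mkₐ K (lieIdeal K br)

/-- The quotient topology. -/
noncomputable instance : TopologicalSpace (CompletedEnveloping K br) :=
  TopologicalSpace.coinduced (mk K br) inferInstance

/-- The canonical map from `V` to its completed universal enveloping algebra. -/
noncomputable def ι : V →ₗ[K] CompletedEnveloping K br :=
  (mk K br).toLinearMap ∘ₗ CompletedTensorAlgebra.ι K V

/-- The canonical map from the tensor algebra `T(V)`; its image is dense. -/
noncomputable def ofTensorAlgebra : TensorAlgebra K V →ₐ[K] CompletedEnveloping K br :=
  (mk K br).comp (CompletedTensorAlgebra.ofTensorAlgebra K V)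

variable (V) in
/-- The usual comultiplication of the tensor algebra, for which the vectors are primitive. -/
noncomputable def tensorComul : TensorAlgebra K V →ₐ[K] TensorAlgebra K V ⊗[K] TensorAlgebra K V :=
  TensorAlgebra.lift K
    ((TensorProduct.mk K _ _).flip 1 ∘ₗ TensorAlgebra.ι K
      + TensorProduct.mk K _ _ 1 ∘ₗ TensorAlgebra.ι K)

variable {K br}

/-- `D` is the comultiplication of the completed universal enveloping algebra: the continuous
linear map through which the comultiplication of the tensor algebra descends. -/
def IsComul (D : CompletedEnveloping K br →ₗ[K]
    CompletedTensor K (CompletedEnveloping K br) (CompletedEnveloping K br)) : Prop :=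
  Continuous D ∧ ∀ t : TensorAlgebra K V, D (ofTensorAlgebra K br t) =
    CompletedTensor.ofTensor K _ _ (TensorProduct.map (ofTensorAlgebra K br).toLinearMap
      (ofTensorAlgebra K br).toLinearMap (tensorComul K V t))

/-- `E` is the counit of the completed universal enveloping algebra: the linear form, continuous
for the discrete topology of `K`, through which the augmentation of the tensor algebra descends. -/
def IsCounit (E : CompletedEnveloping K br →ₗ[K] K) : Prop :=
  @Continuous _ _ inferInstance ⊥ E ∧
    ∀ t : TensorAlgebra K V, E (ofTensorAlgebra K br t) = TensorAlgebra.algebraMapInv t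

end CompletedEnveloping

end TensorAlg

/-! ## Formal sums -/

section Formal

variable (K : Type u) [Field K] (α : Type v) (β : Type w)

/-- The formal (infinite) linear combinations `∑ f(a) a` of elements of `α`. -/
def FormalSum : Type (max u v) := α → K

namespace FormalSum

noncomputable instance : AddCommGroup (FormalSum K α) := inferInstanceAs (AddCommGroup (α → K))

noncomputable instance : Module K (FormalSum K α) := inferInstanceAs (Module K (α → K))

/-- The product topology, for the discrete topology of `K`. -/
instance : TopologicalSpace (FormalSum K α) := @Pi.topologicalSpace α (fun _ => K) fun _ => ⊥

variable {α β}

open Classical in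
/-- The formal sum `1 · a`. -/
noncomputable def single (a : α) : FormalSum K α := fun b => if b = a then 1 else 0

theorem finite_single_notMem (W : OpenSub K (FormalSum K α)) :
    {a : α | single K a ∉ W.1}.Finite := by
  let : TopologicalSpace K := ⊥
  have : DiscreteTopology K := ⟨rfl⟩
  let S : Set (α → K) := (W.1 : Set (FormalSum K α))
  have h0 : S ∈ nhds (0 : α → K) := IsOpen.mem_nhds W.2 W.1.zero_mem
  rw [nhds_pi, Filter.mem_pi] at h0
  obtain ⟨I, hI, t, ht, hs⟩ := h0
  refine hI.subset fun a ha => ?_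
  by_contra haI
  refine ha (hs fun i hi => ?_)
  have : single K a i = 0 := if_neg fun h : i = a => haI (h ▸ hi)
  change single K a i ∈ t i
  rw [this]
  exact mem_of_mem_nhds (ht i)

variable {K}

/-- The element `∑ f(a, b) a ⊗ b` of the completed tensor product of two spaces of formal sums.  In
each of the quotients by open subspaces, all but finitely many terms vanish. -/
noncomputable def tensor (f : α → β → K) :
    CompletedTensor K (FormalSum K α) (FormalSum K β) :=
  ⟨fun p => ∑ᶠ c : α × β, f c.1 c.2 •
      (p.1.1.mkQ (single K c.1) ⊗ₜ[K] p.2.1.mkQ (single K c.2)), by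
    intro p q h₁ h₂
    dsimp only
    rw [map_finsum]
    · refine finsum_congr fun c => ?_
      simp only [map_smul, TensorProduct.map_tmul]
      rfl
    · refine ((finite_single_notMem K p.1).prod (finite_single_notMem K p.2)).subset ?_
      rintro ⟨a, b⟩ hab
      refine ⟨fun ha => hab ?_, fun hb => hab ?_⟩
      · have : p.1.1.mkQ (single K a) = 0 := (Submodule.Quotient.mk_eq_zero _).2 ha
        simp [this]
      · have : p.2.1.mkQ (single K b) = 0 := (Submodule.Quotient.mk_eq_zero _).2 hb
        simp [this]⟩

end FormalSum

end Formal

end Profinite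

/-! ## Graphs -/

namespace CK

/-- A (finite) graph: a finite set of half-edges, a partition of it into pairs (the edges), given by
the fixed point free involution that exchanges the two half-edges of every edge, a partition
of it (the vertices), given by an equivalence relation, and a set of univalent vertices (the
external vertices), given by their half-edges. -/
structure Graph where
  /-- the half-edges -/
  H : Type
  finite : Finite H
  /-- the other half of an edge -/
  edge : H → H
  edge_edge : ∀ h, edge (edge h) = h
  edge_ne : ∀ h, edge h ≠ h
  /-- lying on the same vertex -/
  vert : Setoid H
  /-- the half-edges that lie on external vertices -/
  ext : Set H
  univalent : ∀ h ∈ ext, ∀ h', vert h h' → h' = h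

namespace Graph

attribute [instance] Graph.finite

/-- An isomorphism of graphs: a bijection of the half-edges that preserves the edges, the vertices
and the external vertices. -/
structure Iso (Γ Γ' : Graph) where
  toEquiv : Γ.H ≃ Γ'.H
  map_edge : ∀ h, toEquiv (Γ.edge h) = Γ'.edge (toEquiv h)
  map_vert : ∀ h₁ h₂, Γ.vert h₁ h₂ ↔ Γ'.vert (toEquiv h₁) (toEquiv h₂)
  map_ext : ∀ h, h ∈ Γ.ext ↔ toEquiv h ∈ Γ'.ext

/-- The identity. -/
def Iso.refl (Γ : Graph) : Iso Γ Γ :=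
  ⟨Equiv.refl _, fun _ => rfl, fun _ _ => Iff.rfl, fun _ => Iff.rfl⟩

/-- The inverse of an isomorphism. -/
def Iso.symm {Γ Γ' : Graph} (f : Iso Γ Γ') : Iso Γ' Γ where
  toEquiv := f.toEquiv.symm
  map_edge h := by rw [Equiv.symm_apply_eq, f.map_edge, Equiv.apply_symm_apply]
  map_vert h₁ h₂ := by rw [f.map_vert, Equiv.apply_symm_apply, Equiv.apply_symm_apply]
  map_ext h := by rw [f.map_ext, Equiv.apply_symm_apply]

/-- The composition of two isomorphisms. -/
def Iso.trans {Γ Γ' Γ'' : Graph} (f : Iso Γ Γ') (g : Iso Γ' Γ'') : Iso Γ Γ'' where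
  toEquiv := f.toEquiv.trans g.toEquiv
  map_edge h := by simp [f.map_edge, g.map_edge]
  map_vert h₁ h₂ := by rw [f.map_vert, g.map_vert]; rfl
  map_ext h := by rw [f.map_ext, g.map_ext]; rfl

/-- The number of automorphisms of a graph. -/
noncomputable def autCard (Γ : Graph) : ℕ := Nat.card (Iso Γ Γ)

/-- Two graphs are identified if they are isomorphic. -/
instance isoSetoid : Setoid Graph where
  r Γ Γ' := Nonempty (Iso Γ Γ')
  iseqv := ⟨fun Γ => ⟨Iso.refl Γ⟩, fun ⟨f⟩ => ⟨f.symm⟩, fun ⟨f⟩ ⟨g⟩ => ⟨f.trans g⟩⟩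

/-- The disjoint union of two equivalence relations. -/
def sumSetoid {A B : Type} (r : Setoid A) (s : Setoid B) : Setoid (A ⊕ B) where
  r := Sum.LiftRel r s
  iseqv := by
    refine ⟨?_, ?_, ?_⟩
    · rintro (a | b)
      · exact .inl (r.refl a)
      · exact .inr (s.refl b)
    · rintro _ _ (h | h)
      · exact .inl (r.symm h)
      · exact .inr (s.symm h)
    · rintro _ _ _ (h | h) (h' | h')
      · exact .inl (r.trans h h')
      · exact .inr (s.trans h h')

theorem sumSetoid_assoc {A B C : Type} (r : Setoid A) (s : Setoid B) (t : Setoid C)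
    (h h' : (A ⊕ B) ⊕ C) : sumSetoid (sumSetoid r s) t h h' ↔
      sumSetoid r (sumSetoid s t) (Equiv.sumAssoc A B C h) (Equiv.sumAssoc A B C h') := by
  change Sum.LiftRel (Sum.LiftRel r s) t h h' ↔
    Sum.LiftRel r (Sum.LiftRel s t) (Equiv.sumAssoc A B C h) (Equiv.sumAssoc A B C h')
  rcases h with (h | h) | h <;> rcases h' with (h' | h') | h' <;> simp

theorem sumSetoid_comm {A B : Type} (r : Setoid A) (s : Setoid B) (h h' : A ⊕ B) :
    sumSetoid r s h h' ↔ sumSetoid s r (Equiv.sumComm A B h) (Equiv.sumComm A B h') := by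
  change Sum.LiftRel r s h h' ↔ Sum.LiftRel s r (Equiv.sumComm A B h) (Equiv.sumComm A B h')
  rcases h with h | h <;> rcases h' with h' | h' <;> simp

/-- The empty graph. -/
def empty : Graph where
  H := Empty
  finite := inferInstance
  edge := id
  edge_edge h := h.elim
  edge_ne h := h.elim
  vert := ⊥
  ext := ∅
  univalent h := h.elim

/-- The disjoint union of two graphs. -/
def union (Γ Γ' : Graph) : Graph where
  H := Γ.H ⊕ Γ'.H
  finite := inferInstance
  edge := Sum.map Γ.edge Γ'.edge
  edge_edge := by rintro (h | h) <;> simp [Γ.edge_edge, Γ'.edge_edge]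
  edge_ne := by rintro (h | h) <;> simp [Γ.edge_ne, Γ'.edge_ne]
  vert := sumSetoid Γ.vert Γ'.vert
  ext := Sum.elim Γ.ext Γ'.ext
  univalent := by
    rintro (h | h) hh _ (h' | h')
    · exact congrArg Sum.inl (Γ.univalent h hh _ h')
    · exact congrArg Sum.inr (Γ'.univalent h hh _ h')

/-- Lying in the same connected component. -/
def conn (Γ : Graph) : Setoid Γ.H :=
  Relation.EqvGen.setoid fun a b => Γ.vert a b ∨ b = Γ.edge a

/-- The connected components of a graph. -/
abbrev Components (Γ : Graph) : Type := Quotient Γ.conn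

/-- A graph is connected if it has exactly one connected component. -/
def Connected (Γ : Graph) : Prop := Nonempty Γ.H ∧ ∀ a b, Γ.conn a b

/-- A half-edge is internal if it belongs to an internal edge, that is to say an edge that is not
connected to any external vertex. -/
def IsInternal (Γ : Graph) (h : Γ.H) : Prop := h ∉ Γ.ext ∧ Γ.edge h ∉ Γ.ext

/-- Every connected component has at least one internal edge. -/
def IsPlus (Γ : Graph) : Prop := ∀ a, ∃ h, Γ.conn a h ∧ Γ.IsInternal h

/-- The graph is connected, with at least one internal edge. -/
def IsConnPlus (Γ : Graph) : Prop := Γ.Connected ∧ ∃ h, Γ.IsInternal h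

theorem conn_edge (Γ : Graph) (h : Γ.H) : Γ.conn h (Γ.edge h) :=
  Relation.EqvGen.rel _ _ (Or.inr rfl)

/-- A connected component, as a graph. -/
def component (Γ : Graph) (c : Γ.Components) : Graph where
  H := {h : Γ.H // Quotient.mk Γ.conn h = c}
  finite := inferInstance
  edge h := ⟨Γ.edge h.1, (Quotient.sound (Γ.conn.symm (Γ.conn_edge h.1))).trans h.2⟩
  edge_edge h := Subtype.ext (Γ.edge_edge h.1)
  edge_ne h := fun e => Γ.edge_ne h.1 (congrArg Subtype.val e)
  vert := Γ.vert.comap Subtype.val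
  ext := {h | h.1 ∈ Γ.ext}
  univalent h hh h' e := Subtype.ext (Γ.univalent h.1 hh h'.1 e)

/-- A subgraph: a set of internal edges, given by the set of their half-edges. -/
structure Subgraph (Γ : Graph) where
  S : Set Γ.H
  edge_mem : ∀ h ∈ S, Γ.edge h ∈ S
  internal : ∀ h ∈ S, Γ.IsInternal h

/-- A subgraph is nontrivial if it contains some, but not all, of the internal edges. -/
def Subgraph.Nontrivial {Γ : Graph} (γ : Γ.Subgraph) : Prop :=
  γ.S.Nonempty ∧ ∃ h, Γ.IsInternal h ∧ h ∉ γ.S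

theorem Subgraph.edge_notMem {Γ : Graph} (γ : Γ.Subgraph) {h : Γ.H} (hh : h ∉ γ.S) :
    Γ.edge h ∉ γ.S := fun h' => hh (Γ.edge_edge h ▸ γ.edge_mem _ h')

/-- The relation that the half-edges `a` and `b` lie on vertices that become equal when the edges of
`γ` are contracted. -/
def Subgraph.contractVert {Γ : Graph} (γ : Γ.Subgraph) : Setoid Γ.H :=
  Relation.EqvGen.setoid fun a b => Γ.vert a b ∨ (a ∈ γ.S ∧ b = Γ.edge a)

theorem Subgraph.contractVert_ext {Γ : Graph} (γ : Γ.Subgraph) {a b : Γ.H}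
    (h : γ.contractVert a b) : a = b ∨ (a ∉ Γ.ext ∧ b ∉ Γ.ext) := by
  induction h with
  | rel x y h =>
    rcases h with h | ⟨hx, rfl⟩
    · by_cases hx : x ∈ Γ.ext
      · exact Or.inl (Γ.univalent x hx y h).symm
      · by_cases hy : y ∈ Γ.ext
        · exact Or.inl (Γ.univalent y hy x (Γ.vert.symm h))
        · exact Or.inr ⟨hx, hy⟩
    · exact Or.inr (γ.internal x hx)
  | refl x => exact Or.inl rfl
  | symm x y _ ih => exact ih.imp Eq.symm And.symm
  | trans x y z _ _ ih₁ ih₂ =>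
    rcases ih₁ with rfl | ih₁
    · exact ih₂
    · rcases ih₂ with rfl | ih₂
      · exact Or.inr ih₁
      · exact Or.inr ⟨ih₁.1, ih₂.2⟩

/-- The graph `Γ / γ` with all the edges of `γ` contracted. -/
def Subgraph.contract {Γ : Graph} (γ : Γ.Subgraph) : Graph where
  H := {h : Γ.H // h ∉ γ.S}
  finite := inferInstance
  edge h := ⟨Γ.edge h.1, γ.edge_notMem h.2⟩
  edge_edge h := Subtype.ext (Γ.edge_edge h.1)
  edge_ne h := fun e => Γ.edge_ne h.1 (congrArg Subtype.val e)
  vert := γ.contractVert.comap Subtype.val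
  ext := {h | h.1 ∈ Γ.ext}
  univalent h hh h' e := by
    rcases γ.contractVert_ext e with e | e
    · exact Subtype.ext e.symm
    · exact absurd hh e.1

/-- The half-edges that lie on the vertices that the edges of `γ` meet. -/
def Subgraph.support {Γ : Graph} (γ : Γ.Subgraph) : Set Γ.H := {h | ∃ k ∈ γ.S, Γ.vert h k}

theorem Subgraph.mem_support {Γ : Graph} (γ : Γ.Subgraph) {h : Γ.H} (hh : h ∈ γ.S) :
    h ∈ γ.support := ⟨h, hh, Γ.vert.refl h⟩

open Classical in
/-- The graph associated to a subgraph `γ`.  Its internal edges are the edges of `γ`, its internal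
vertices are the vertices that meet `γ`, and every half-edge `h` on these vertices that does
not belong to `γ` is completed, by a new half-edge `h'`, to an external edge `{h, h'}`. -/
noncomputable def Subgraph.toGraph {Γ : Graph} (γ : Γ.Subgraph) : Graph where
  H := {h : Γ.H // h ∈ γ.support} ⊕ {h : Γ.H // h ∈ γ.support ∧ h ∉ γ.S}
  finite := inferInstance
  edge := Sum.elim
    (fun h => if hh : h.1 ∈ γ.S then .inl ⟨Γ.edge h.1, γ.mem_support (γ.edge_mem h.1 hh)⟩
      else .inr ⟨h.1, h.2, hh⟩)
    (fun h => .inl ⟨h.1, h.2.1⟩)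
  edge_edge := by
    rintro (⟨h, hh⟩ | ⟨h, hh, hS⟩)
    · by_cases hS : h ∈ γ.S
      · simp [hS, γ.edge_mem h hS, Γ.edge_edge]
      · simp [hS]
    · simp [hS]
  edge_ne := by
    rintro (⟨h, hh⟩ | ⟨h, hh, hS⟩)
    · by_cases hS : h ∈ γ.S
      · simp [hS, Γ.edge_ne]
      · simp [hS]
    · simp
  vert := sumSetoid (Γ.vert.comap Subtype.val) ⊥
  ext := Set.range Sum.inr
  univalent := by
    rintro _ ⟨h, rfl⟩ _ (h' | h')
    rename_i k
    have h'' : h = k := h'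
    rw [h'']

end Graph

/-- The isomorphism classes of graphs. -/
def GraphClass : Type 1 := Quotient Graph.isoSetoid

namespace GraphClass

/-- The isomorphism class of a graph. -/
def mk (Γ : Graph) : GraphClass := Quotient.mk _ Γ

/-- A graph in the isomorphism class. -/
noncomputable def rep (c : GraphClass) : Graph := Quotient.out c

/-- The isomorphism classes of graphs form a commutative monoid under disjoint union. -/
instance : CommMonoid GraphClass where
  mul := Quotient.map₂ Graph.union (by
    rintro Γ₁ Γ₂ ⟨f⟩ Γ₁' Γ₂' ⟨g⟩
    refine ⟨⟨Equiv.sumCongr f.toEquiv g.toEquiv, ?_, ?_, ?_⟩⟩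
    · rintro (h | h)
      · exact congrArg Sum.inl (f.map_edge h)
      · exact congrArg Sum.inr (g.map_edge h)
    · rintro (h | h) (h' | h')
      · exact Sum.liftRel_inl_inl.trans ((f.map_vert h h').trans Sum.liftRel_inl_inl.symm)
      · exact iff_of_false Sum.not_liftRel_inl_inr Sum.not_liftRel_inl_inr
      · exact iff_of_false Sum.not_liftRel_inr_inl Sum.not_liftRel_inr_inl
      · exact Sum.liftRel_inr_inr.trans ((g.map_vert h h').trans Sum.liftRel_inr_inr.symm)
    · rintro (h | h)
      · exact f.map_ext h
      · exact g.map_ext h)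
  one := mk Graph.empty
  mul_assoc := by
    rintro ⟨a⟩ ⟨b⟩ ⟨c⟩
    refine Quotient.sound ⟨⟨Equiv.sumAssoc _ _ _, ?_, ?_, ?_⟩⟩
    · rintro ((h | h) | h) <;> rfl
    · intro h h'
      exact Graph.sumSetoid_assoc a.vert b.vert c.vert h h'
    · rintro ((h | h) | h) <;> rfl
  one_mul := by
    rintro ⟨a⟩
    refine Quotient.sound ⟨⟨Equiv.emptySum Empty _, ?_, ?_, ?_⟩⟩
    · rintro (h | h)
      · exact h.elim
      · rfl
    · rintro (h | h) (h' | h')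
      · exact h.elim
      · exact h.elim
      · exact h'.elim
      · exact Sum.liftRel_inr_inr
    · rintro (h | h)
      · exact h.elim
      · rfl
  mul_one := by
    rintro ⟨a⟩
    refine Quotient.sound ⟨⟨Equiv.sumEmpty _ Empty, ?_, ?_, ?_⟩⟩
    · rintro (h | h)
      · rfl
      · exact h.elim
    · rintro (h | h) (h' | h')
      · exact Sum.liftRel_inl_inl
      · exact h'.elim
      · exact h.elim
      · exact h.elim
    · rintro (h | h)
      · rfl
      · exact h.elim
  mul_comm := by
    rintro ⟨a⟩ ⟨b⟩
    refine Quotient.sound ⟨⟨Equiv.sumComm _ _, ?_, ?_, ?_⟩⟩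
    · rintro (h | h) <;> rfl
    · intro h h'
      exact Graph.sumSetoid_comm a.vert b.vert h h'
    · rintro (h | h) <;> rfl

end GraphClass

/-! ## The Connes-Kreimer Hopf algebra and its dual -/

section Hopf

open Profinite

variable (K : Type u) [Field K]

/-- The vector space freely generated by the isomorphism classes of graphs.  Its multiplication
is given by disjoint union. -/
abbrev HAlg : Type (max 1 u) := MonoidAlgebra K GraphClass

variable {K} in
/-- A class of graphs, as a basis vector. -/
noncomputable abbrev gen (c : GraphClass) : HAlg K := MonoidAlgebra.single c 1

/-- The coproduct of a connected graph `Γ`, that is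
`1 ⊗ Γ + Γ ⊗ 1 + ∑ γ ⊗ Γ / γ`, the sum over the nontrivial subgraphs `γ` of `Γ`. -/
noncomputable def nablaConn (Γ : Graph) : HAlg K ⊗[K] HAlg K :=
  1 ⊗ₜ gen (GraphClass.mk Γ) + gen (GraphClass.mk Γ) ⊗ₜ 1
    + ∑ᶠ γ : {γ : Γ.Subgraph // γ.Nontrivial},
        gen (GraphClass.mk γ.1.toGraph) ⊗ₜ gen (GraphClass.mk γ.1.contract)

/-- The Connes-Kreimer coproduct: it is multiplicative for disjoint unions, so that its value on a
graph is the product of its values on the connected components. -/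
noncomputable def nabla : HAlg K →ₗ[K] HAlg K ⊗[K] HAlg K :=
  Finsupp.linearCombination K
      (fun c : GraphClass => ∏ᶠ i : c.rep.Components, nablaConn K (c.rep.component i))
    ∘ₗ (MonoidAlgebra.coeffLinearEquiv K).toLinearMap

/-- The formal infinite linear combinations of isomorphism classes of graphs. -/
abbrev HHat : Type (max 1 u) := FormalSum K GraphClass

variable {K}

/-- The number of automorphisms of a graph, as a scalar. -/
noncomputable def autScalar (c : GraphClass) : K := (c.rep.autCard : K)

/-- The isomorphism `I` of the formal sums with the linear dual of `HAlg K`, given by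
`I(Γ) = |Aut Γ| ⟨Γ, -⟩`. -/
noncomputable def toDual (x : HHat K) : HAlg K →ₗ[K] K :=
  Finsupp.linearCombination K (fun c : GraphClass => autScalar c * x c)
    ∘ₗ (MonoidAlgebra.coeffLinearEquiv K).toLinearMap

/-- The product on `HHat K`: the form `I(x ⋆ y)` is the composite of `I(x) ⊗ I(y)` with the
Connes-Kreimer coproduct. -/
noncomputable def starProd (x y : HHat K) : HHat K := fun c =>
  (autScalar c)⁻¹ * LinearMap.mul' K K (TensorProduct.map (toDual x) (toDual y) (nabla K (gen c)))

/-- The unit of `⋆`, the empty graph. -/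
noncomputable def oneHat : HHat K := FormalSum.single K (1 : GraphClass)

/-- The comultiplication on `HHat K`: `(I ⊗ I)(Δ x)` is the composite of `I(x)` with the
multiplication of `HAlg K`. -/
noncomputable def coprod (x : HHat K) : CompletedTensor K (HHat K) (HHat K) :=
  FormalSum.tensor fun c d =>
    (autScalar c)⁻¹ * (autScalar d)⁻¹ * toDual x (gen c * gen d)

variable (K)

/-- The formal sums of disjoint unions of connected graphs with at least one internal edge. -/
def HPlus : Submodule K (HHat K) where
  carrier := {x | ∀ Γ : Graph, x (GraphClass.mk Γ) ≠ 0 → Γ.IsPlus}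
  add_mem' := by
    intro x y hx hy Γ h
    by_cases h0 : x (GraphClass.mk Γ) = 0
    · refine hy Γ fun h1 => h ?_
      exact (congrArg₂ (· + ·) h0 h1).trans (add_zero 0)
    · exact hx Γ h0
  zero_mem' := fun Γ h => absurd rfl h
  smul_mem' := by
    intro a x hx Γ h
    refine hx Γ fun h0 => h ?_
    exact (congrArg (a * ·) h0).trans (mul_zero a)

/-- The formal sums of connected graphs with at least one internal edge. -/
def HcPlus : Submodule K (HHat K) where
  carrier := {x | ∀ Γ : Graph, x (GraphClass.mk Γ) ≠ 0 → Γ.IsConnPlus}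
  add_mem' := by
    intro x y hx hy Γ h
    by_cases h0 : x (GraphClass.mk Γ) = 0
    · refine hy Γ fun h1 => h ?_
      exact (congrArg₂ (· + ·) h0 h1).trans (add_zero 0)
    · exact hx Γ h0
  zero_mem' := fun Γ h => absurd rfl h
  smul_mem' := by
    intro a x hx Γ h
    refine hx Γ fun h0 => h ?_
    exact (congrArg (a * ·) h0).trans (mul_zero a)

variable {K}

open Classical in
/-- The bracket `x ⋆ y - y ⋆ x` on the formal sums of connected graphs with at least one internal
edge.  To have its values there, one drops the coefficients of all other graphs (these
coefficients vanish in any case). -/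
noncomputable def bracket (x y : HcPlus K) : HcPlus K :=
  ⟨fun c => if ∀ Γ : Graph, GraphClass.mk Γ = c → Γ.IsConnPlus then
      (starProd x.1 y.1 - starProd y.1 x.1) c else 0, by
    intro Γ h
    by_contra hΓ
    exact h (if_neg fun h' => hΓ (h' Γ rfl))⟩

end Hopf

end CK

open Profinite CK

/-! The theorem is a dual form of the Cartier-Milnor-Moore theorem. Let `P` be the commutative
monoid of classes of graphs all of whose components have an internal edge (`PlusClass`). On it the
Connes-Kreimer coproduct has natural coefficients and is graded by the number of internal
half-edges, with only the empty graph in degree zero. Multiplying the coefficient of every graph by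
the order of its automorphism group (`plusEquiv`) turns `⋆` into convolution of functions on `P`,
and `Δ` into `x ↦ ((a, b) ↦ x (a * b))`. What has to be shown is then a statement about any such
monoid (`CombBialgebra`): the convolution algebra of all functions on `P` is the completed
enveloping algebra of its primitive elements, which are the functions supported on the
indecomposable elements (`isPrim_iff`). A degree may contain infinitely many classes; the finiteness
that is needed comes from `exists_finite_closed`.

The core is a Poincaré-Birkhoff-Witt argument by triangularity. A primitive element convolves from
the left as a derivation does (`IsPrim.conv_mul`). Hence a product of `n` indecomposable basis
elements vanishes on the monomials with more than `n` factors, and on a monomial with exactly `n`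
factors it is a natural number, nonzero precisely if the factors are the letters of the product
(`wordProd_apply_of_length_eq`). So the pairing of monomials with words, one word for each multiset
of letters, is triangular for the number of factors. In characteristic zero its diagonal is
invertible, and homogeneity bounds the length of the words, so that the pairing is bijective on
finite linear combinations (`pairingMap_injective`, `pairingMap_surjective`).

The inclusion of the primitive elements extends to a continuous homomorphism `completedHom` on the
completed tensor algebra. Inverting the pairing gives every function a preimage that is an infinite
combination of these words, and it depends continuously on the function (`completedHom_sectionMap`,
`continuous_sectionMap`). The kernel is the closed ideal of commutator relations
(`mem_lieIdeal_of_completedHom_eq_zero`): a continuous form that kills the relations agrees on the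
chosen words with a finite combination of coefficients of `completedHom`, by surjectivity of the
pairing, and hence agrees with it everywhere, because modulo the relations words can be reordered at
the cost of shorter ones. Therefore it vanishes on the kernel. The comultiplications are compared on
the dense image of the tensor algebra (`tensorHom_apply_mul`).

For graphs, everything is expressed by the subquotients `γ / δ` of a graph with legs, for edge sets
`δ ≤ γ`. A subquotient of a subquotient is a subquotient (`Emb.cvert_sub_iff`, `plusCop_subquot`),
so coassociativity is an exchange of sums over chains of edge sets. A graph all of whose components
have internal edges is recovered from its internal edges and its legs (`Graph.IsPlus.iso`), which
identifies this coproduct with the given one (`nablaConn_of_isPlus`). A component without internal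
edges is primitive, so that `⋆` does not lead out of the subspace (`starProd_apply_of_notMem`). -/

set_option linter.unusedSectionVars false

/-! ## Combinatorial bialgebras

A commutative monoid with a coproduct whose values are formal sums, with natural coefficients, of
pairs of elements of the monoid. -/

/-- A graded connected commutative bialgebra with structure constants in `ℕ`, given by its monoid
of basis elements. -/
class CombBialgebra (P : Type v) [CommMonoid P] where
  /-- the coproduct -/
  cop : P → Multiset (P × P)
  /-- the degree -/
  deg : P → ℕ
  coassoc : ∀ c, ((cop c).bind fun p => (cop p.1).map fun q => (q.1, q.2, p.2))
    = (cop c).bind fun p => (cop p.2).map fun q => (p.1, q.1, q.2)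
  cop_mul : ∀ a b, cop (a * b) = (cop a ×ˢ cop b).map fun p => (p.1.1 * p.2.1, p.1.2 * p.2.2)
  counit_left : ∀ c, ∃ s, cop c = (1, c) ::ₘ s ∧ ∀ p ∈ s, p.1 ≠ 1
  counit_right : ∀ c, ∃ s, cop c = (c, 1) ::ₘ s ∧ ∀ p ∈ s, p.2 ≠ 1
  deg_cop : ∀ c, ∀ p ∈ cop c, deg p.1 + deg p.2 = deg c
  deg_mul : ∀ a b, deg (a * b) = deg a + deg b
  eq_one_of_deg : ∀ c, deg c = 0 → c = 1

namespace CombBialgebra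

variable {P : Type v} [CommMonoid P] [CombBialgebra P]

theorem deg_one : deg (1 : P) = 0 := by
  have h := deg_mul (1 : P) 1
  rw [one_mul] at h
  omega

theorem deg_pos {c : P} (h : c ≠ 1) : 0 < deg c :=
  Nat.pos_of_ne_zero fun h0 => h (eq_one_of_deg c h0)

theorem mul_eq_one {a b : P} : a * b = 1 ↔ a = 1 ∧ b = 1 := by
  refine ⟨fun h => ?_, fun h => by rw [h.1, h.2, one_mul]⟩
  have := deg_mul a b
  rw [h, deg_one] at this
  exact ⟨eq_one_of_deg a (by omega), eq_one_of_deg b (by omega)⟩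

theorem cop_one : cop (1 : P) = {(1, 1)} := by
  obtain ⟨s, hs, h⟩ := counit_left (1 : P)
  rw [hs, Multiset.eq_zero_of_forall_notMem (s := s)]
  · rfl
  · intro p hp
    have := deg_cop (1 : P) p (hs ▸ Multiset.mem_cons_of_mem hp)
    rw [deg_one] at this
    exact h p hp (eq_one_of_deg _ (by omega))

variable (P) in
/-- The indecomposable basis elements. -/
def IsConn (c : P) : Prop := c ≠ 1 ∧ ∀ a b, c = a * b → a = 1 ∨ b = 1

variable (P) in
/-- The type of the indecomposable basis elements. -/
abbrev Conn : Type v := {c : P // IsConn P c}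

/-- The product of a multiset of indecomposable elements. -/
def prodConn (m : Multiset (Conn P)) : P := (m.map Subtype.val).prod

omit [CombBialgebra P] in
theorem prodConn_zero : prodConn (0 : Multiset (Conn P)) = 1 := by simp [prodConn]

omit [CombBialgebra P] in
theorem prodConn_cons (c : Conn P) (m : Multiset (Conn P)) :
    prodConn (c ::ₘ m) = c.1 * prodConn m := by simp [prodConn]

omit [CombBialgebra P] in
theorem prodConn_add (m n : Multiset (Conn P)) :
    prodConn (m + n) = prodConn m * prodConn n := by simp [prodConn]

/-- Induction on the degree, since both factors of a proper decomposition have smaller degree. Only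
existence of a factorization is needed; uniqueness is a consequence of the triangular pairing and is
never assumed. -/
theorem exists_prodConn (c : P) : ∃ m : Multiset (Conn P), prodConn m = c := by
  induction hn : deg c using Nat.strong_induction_on generalizing c with
  | _ n ih =>
    by_cases h1 : c = 1
    · exact ⟨0, by simp [prodConn, h1]⟩
    by_cases hc : IsConn P c
    · exact ⟨{⟨c, hc⟩}, by simp [prodConn]⟩
    have : ∃ a b, c = a * b ∧ a ≠ 1 ∧ b ≠ 1 := by
      by_contra! h
      refine hc ⟨h1, fun a b hab => ?_⟩
      by_cases ha : a = 1
      · exact Or.inl ha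
      · exact Or.inr (h a b hab ha)
    obtain ⟨a, b, rfl, ha, hb⟩ := this
    have h := deg_mul a b
    have ha' := deg_pos ha
    have hb' := deg_pos hb
    obtain ⟨m, rfl⟩ := ih (deg a) (by omega) a rfl
    obtain ⟨m', rfl⟩ := ih (deg b) (by omega) b rfl
    exact ⟨m + m', prodConn_add m m'⟩

theorem card_le_deg_prodConn (m : Multiset (Conn P)) : m.card ≤ deg (prodConn m) := by
  induction m using Multiset.induction with
  | empty => simp
  | cons c m ih =>
    have := deg_pos c.2.1
    rw [prodConn_cons, deg_mul, Multiset.card_cons]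
    omega

/-- The other factor has degree zero, hence is the unit, and the counit axiom leaves a single such
term. -/
theorem eq_of_deg_left {c : P} {p : P × P} (hp : p ∈ cop c) (h : deg p.1 = deg c) :
    p = (c, 1) := by
  have h2 := deg_cop c p hp
  obtain ⟨s, hs, hs'⟩ := counit_right c
  rw [hs, Multiset.mem_cons] at hp
  rcases hp with hp | hp
  · exact hp
  · exact absurd (eq_one_of_deg _ (by omega)) (hs' p hp)

theorem eq_of_deg_right {c : P} {p : P × P} (hp : p ∈ cop c) (h : deg p.2 = deg c) :
    p = (1, c) := by
  have h2 := deg_cop c p hp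
  obtain ⟨s, hs, hs'⟩ := counit_left c
  rw [hs, Multiset.mem_cons] at hp
  rcases hp with hp | hp
  · exact hp
  · exact absurd (eq_one_of_deg _ (by omega)) (hs' p hp)

/-- Every basis element lies in a finite set that is closed under the coproduct. -/
theorem exists_finite_closed (c : P) : ∃ X : Set P, X.Finite ∧ c ∈ X ∧ 1 ∈ X ∧
    ∀ d ∈ X, ∀ p ∈ cop d, p.1 ∈ X ∧ p.2 ∈ X := by
  induction hn : deg c using Nat.strong_induction_on generalizing c with
  | _ n ih =>
    -- The empty set serves as default for the elements whose degree is not smaller, so that the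
    -- closed sets can be chosen for all elements at once.
    have key : ∀ d : P, ∃ X : Set P, X.Finite ∧ (deg d < n → d ∈ X) ∧
        ∀ d ∈ X, ∀ p ∈ cop d, p.1 ∈ X ∧ p.2 ∈ X := by
      intro d
      by_cases hd : deg d < n
      · obtain ⟨X, h1, h2, -, h4⟩ := ih _ hd d rfl
        exact ⟨X, h1, fun _ => h2, h4⟩
      · exact ⟨∅, Set.finite_empty, fun h => absurd h hd, by simp⟩
    choose X hX hXm hXc using key
    classical
    -- A factor of a term of `cop c` has smaller degree and so lies in its own closed set, except in
    -- the terms `(c, 1)` and `(1, c)`; this is why adding `c` and `1` suffices.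
    let Y : Set P := ⋃ p ∈ (cop c).toFinset, (X p.1 ∪ X p.2)
    refine ⟨{c, 1} ∪ Y, ?_, by simp, by simp, ?_⟩
    · refine (Set.toFinite _).union (Set.Finite.biUnion (Finset.finite_toSet _) fun p _ => ?_)
      exact (hX _).union (hX _)
    · rintro d ((rfl | hd) | hd) p hp
      · have h := deg_cop d p hp
        have hY : ∀ e, e ∈ X p.1 ∪ X p.2 → e ∈ Y := fun e he =>
          Set.mem_biUnion (x := p) (by simpa using hp) he
        constructor
        · by_cases hlt : deg p.1 < n
          · exact Or.inr (hY _ (Or.inl (hXm _ hlt)))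
          · rw [eq_of_deg_left hp (by omega)]; simp
        · by_cases hlt : deg p.2 < n
          · exact Or.inr (hY _ (Or.inr (hXm _ hlt)))
          · rw [eq_of_deg_right hp (by omega)]; simp
      · rw [Set.mem_singleton_iff.1 hd, cop_one, Multiset.mem_singleton] at hp
        simp [hp]
      · obtain ⟨q, hq, hd⟩ := Set.mem_iUnion₂.1 hd
        have hY : ∀ e, e ∈ X q.1 ∪ X q.2 → e ∈ {c, 1} ∪ Y := fun e he =>
          Or.inr (Set.mem_biUnion hq he)
        rcases hd with hd | hd
        · exact ⟨hY _ (Or.inl (hXc _ d hd p hp).1), hY _ (Or.inl (hXc _ d hd p hp).2)⟩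
        · exact ⟨hY _ (Or.inr (hXc _ d hd p hp).1), hY _ (Or.inr (hXc _ d hd p hp).2)⟩

/-! ### The convolution algebra of formal sums -/

variable {K : Type u} [Field K]

/-- The value of the convolution of two functions. -/
def conv (f g : P → K) (c : P) : K := ((cop c).map fun p => f p.1 * g p.2).sum

theorem conv_mul_apply (f g : P → K) (a b : P) : conv f g (a * b) =
    ((cop a).map fun p => ((cop b).map fun q => f (p.1 * q.1) * g (p.2 * q.2)).sum).sum := by
  rw [conv, cop_mul, Multiset.map_map]
  simp only [SProd.sprod, Multiset.product, Multiset.map_bind, Multiset.sum_bind,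
    Multiset.map_map, Function.comp_def]

theorem one_conv {e : P → K} (he1 : e 1 = 1) (he : ∀ c ≠ 1, e c = 0) (g : P → K) (c : P) :
    conv e g c = g c := by
  obtain ⟨s, hs, h⟩ := counit_left c
  rw [conv, hs, Multiset.map_cons, Multiset.sum_cons, he1, one_mul, Multiset.sum_eq_zero, add_zero]
  intro x hx
  obtain ⟨p, hp, rfl⟩ := Multiset.mem_map.1 hx
  rw [he _ (h p hp), zero_mul]

theorem conv_one {e : P → K} (he1 : e 1 = 1) (he : ∀ c ≠ 1, e c = 0) (g : P → K) (c : P) :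
    conv g e c = g c := by
  obtain ⟨s, hs, h⟩ := counit_right c
  rw [conv, hs, Multiset.map_cons, Multiset.sum_cons, he1, mul_one, Multiset.sum_eq_zero, add_zero]
  intro x hx
  obtain ⟨p, hp, rfl⟩ := Multiset.mem_map.1 hx
  rw [he _ (h p hp), mul_zero]

theorem conv_assoc (f g h : P → K) (c : P) : conv (conv f g) h c = conv f (conv g h) c := by
  have := congrArg (fun s : Multiset (P × P × P) =>
    (s.map fun t => f t.1 * g t.2.1 * h t.2.2).sum) (coassoc c)
  simp only [Multiset.map_bind, Multiset.sum_bind, Multiset.map_map, Function.comp_def] at this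
  simp only [conv, ← Multiset.sum_map_mul_right, ← Multiset.sum_map_mul_left]
  rw [this]
  simp only [mul_assoc]

end CombBialgebra

open CombBialgebra

namespace Profinite.FormalSum

variable {P : Type v} [CommMonoid P] [CombBialgebra P] {K : Type u} [Field K]

theorem add_apply {α : Type v} (f g : FormalSum K α) (c : α) : (f + g) c = f c + g c := rfl
theorem sub_apply {α : Type v} (f g : FormalSum K α) (c : α) : (f - g) c = f c - g c := rfl
theorem zero_apply {α : Type v} (c : α) : (0 : FormalSum K α) c = 0 := rfl
theorem smul_apply {α : Type v} (k : K) (f : FormalSum K α) (c : α) : (k • f) c = k * f c := rfl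

theorem single_self {α : Type v} (a : α) : single K a a = 1 := if_pos rfl
theorem single_of_ne {α : Type v} {a b : α} (h : b ≠ a) : single K a b = 0 := if_neg h

variable (K) in
/-- A coefficient, as a linear form. -/
def ev {α : Type v} (a : α) : FormalSum K α →ₗ[K] K where
  toFun f := f a
  map_add' _ _ := rfl
  map_smul' _ _ := rfl

theorem ev_apply {α : Type v} (a : α) (f : FormalSum K α) : ev K a f = f a := rfl

/-- The linear map whose coefficients are given linear forms. -/
def pi {α : Type v} {M : Type w} [AddCommGroup M] [Module K M] (f : α → M →ₗ[K] K) :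
    M →ₗ[K] FormalSum K α where
  toFun x a := f a x
  map_add' x y := funext fun a => map_add (f a) x y
  map_smul' k x := funext fun a => map_smul (f a) k x

theorem pi_apply {α : Type v} {M : Type w} [AddCommGroup M] [Module K M] (f : α → M →ₗ[K] K)
    (x : M) (a : α) : pi f x a = f a x := rfl

noncomputable instance : One (FormalSum K P) := ⟨single K 1⟩
instance : Mul (FormalSum K P) := ⟨conv⟩

theorem mul_apply (f g : FormalSum K P) (c : P) :
    (f * g) c = ((cop c).map fun p => f p.1 * g p.2).sum := rfl

omit [CombBialgebra P] in
theorem one_apply_one : (1 : FormalSum K P) 1 = 1 := single_self 1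

omit [CombBialgebra P] in
theorem one_apply_of_ne {c : P} (h : c ≠ 1) : (1 : FormalSum K P) c = 0 := single_of_ne h

/-- The convolution ring. -/
noncomputable instance : Ring (FormalSum K P) where
  __ := (inferInstance : AddCommGroup (FormalSum K P))
  mul := (· * ·)
  one := 1
  left_distrib f g h := by
    funext c; simp only [mul_apply, add_apply, mul_add, Multiset.sum_map_add]
  right_distrib f g h := by
    funext c; simp only [mul_apply, add_apply, add_mul, Multiset.sum_map_add]
  zero_mul f := by funext c; simp [mul_apply, zero_apply]
  mul_zero f := by funext c; simp [mul_apply, zero_apply]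
  mul_assoc f g h := funext (conv_assoc f g h)
  one_mul f := funext (one_conv one_apply_one (fun _ h => one_apply_of_ne h) f)
  mul_one f := funext (conv_one one_apply_one (fun _ h => one_apply_of_ne h) f)

noncomputable instance : Algebra K (FormalSum K P) := Algebra.ofModule
  (fun r f g => by
    funext c
    simp only [mul_apply, smul_apply, mul_assoc, Multiset.sum_map_mul_left])
  (fun r f g => by
    funext c
    simp only [mul_apply, smul_apply, mul_left_comm, Multiset.sum_map_mul_left])

theorem mul_apply_one (f g : FormalSum K P) : (f * g) 1 = f 1 * g 1 := by
  simp [mul_apply, cop_one]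

/-- The coefficients of a product of `n` elements without constant term vanish in degrees less
than `n`. -/
theorem list_prod_apply_eq_zero (l : List (FormalSum K P)) (hl : ∀ f ∈ l, f 1 = 0) {c : P}
    (hc : deg c < l.length) : l.prod c = 0 := by
  induction l generalizing c with
  | nil => simp at hc
  | cons f l ih =>
    rw [List.prod_cons, mul_apply, Multiset.sum_eq_zero]
    intro x hx
    obtain ⟨p, hp, rfl⟩ := Multiset.mem_map.1 hx
    by_cases h1 : p.1 = 1
    · rw [h1, hl f (by simp), zero_mul]
    · have := deg_pos h1
      have := deg_cop c p hp
      rw [List.length_cons] at hc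
      rw [ih (fun g hg => hl g (by simp [hg])) (by omega), mul_zero]

/-! ### Topology -/

omit [Field K] in
theorem continuous_iff {X : Type w} [TopologicalSpace X] {α : Type v} {f : X → FormalSum K α} :
    Continuous f ↔ ∀ c, @Continuous _ _ _ ⊥ fun x => f x c :=
  let _ : TopologicalSpace K := ⊥
  continuous_pi_iff

omit [Field K] in
theorem continuous_apply {α : Type v} (c : α) :
    @Continuous _ _ _ ⊥ fun f : FormalSum K α => f c := continuous_iff.1 continuous_id c

instance {α : Type v} : T2Space (FormalSum K α) := by
  let _ : TopologicalSpace K := ⊥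
  have : DiscreteTopology K := ⟨rfl⟩
  exact inferInstanceAs (T2Space (α → K))

/-- Every coefficient of a product is a polynomial in finitely many coefficients of the factors,
because `cop c` is finite. -/
instance : ContinuousMul (FormalSum K P) := by
  let _ : TopologicalSpace K := ⊥
  have : DiscreteTopology K := ⟨rfl⟩
  refine ⟨continuous_iff.2 fun c => ?_⟩
  simp only [mul_apply]
  exact continuous_multiset_sum _ fun p _ =>
    ((continuous_apply p.1).comp continuous_fst).mul ((continuous_apply p.2).comp continuous_snd)

end Profinite.FormalSum

/-! ### Primitive elements and products of primitive elements -/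

namespace CombBialgebra

variable {P : Type v} [CommMonoid P] [CombBialgebra P] {K : Type u} [Field K]

variable (K) in
open Classical in
/-- The function `P → K` that is `1` at `a` and vanishes elsewhere. -/
noncomputable def delta (a : P) : P → K := fun b => if b = a then 1 else 0

omit [CommMonoid P] [CombBialgebra P] in
theorem delta_self (a : P) : delta K a a = 1 := if_pos rfl

omit [CommMonoid P] [CombBialgebra P] in
theorem delta_of_ne {a b : P} (h : b ≠ a) : delta K a b = 0 := if_neg h

theorem conv_delta_one (g : P → K) : conv g (delta K 1) = g :=
  funext (conv_one (delta_self 1) (fun _ h => delta_of_ne h) g)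

/-- `x`, as a linear form on the commutative algebra, is a derivation with values in the base
field. -/
def IsPrim (x : P → K) : Prop :=
  ∀ a b, x (a * b) = x a * delta K 1 b + delta K 1 a * x b

omit [CombBialgebra P] in
theorem IsPrim.apply_one {x : P → K} (hx : IsPrim x) : x 1 = 0 := by
  have h := hx 1 1
  rw [delta_self, mul_one, mul_one, one_mul] at h
  simpa using h

omit [CombBialgebra P] in
-- Both terms of the Leibniz rule vanish on a product of two elements different from `1`; if one of
-- the factors is `1`, the rule only says `x 1 = 0`.
theorem isPrim_iff {x : P → K} : IsPrim x ↔ ∀ c, x c ≠ 0 → IsConn P c := by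
  refine ⟨fun hx c hc => ⟨?_, fun a b hab => ?_⟩, fun hx a b => ?_⟩
  · rintro rfl
    exact hc hx.apply_one
  · by_contra! h
    refine hc ?_
    rw [hab, hx, delta_of_ne h.1, delta_of_ne h.2, mul_zero, zero_mul, add_zero]
  · have h1 : x 1 = 0 := by
      by_contra h
      exact (hx 1 h).1 rfl
    by_cases ha : a = 1
    · subst ha
      by_cases hb : b = 1
      · subst hb; simp [h1]
      · rw [one_mul, delta_self, h1, one_mul, zero_mul, zero_add]
    · by_cases hb : b = 1
      · subst hb
        rw [mul_one, delta_self, h1, mul_one, mul_zero, add_zero]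
      · rw [delta_of_ne ha, delta_of_ne hb, mul_zero, zero_mul, add_zero]
        by_contra h
        rcases (hx _ h).2 a b rfl with h | h
        · exact ha h
        · exact hb h

omit [CombBialgebra P] in
theorem isPrim_delta (c : Conn P) : IsPrim (delta K c.1) := by
  refine isPrim_iff.2 fun d hd => ?_
  by_cases h : d = c.1
  · exact h ▸ c.2
  · exact absurd (delta_of_ne h) hd

/-- By `cop_mul` the value is a double sum over the terms of `cop a` and `cop b`. The Leibniz rule
for `x` puts the counit on one of the two first factors, and this collapses the corresponding
coproduct to its single term with left factor `1`. -/
theorem IsPrim.conv_mul {x : P → K} (hx : IsPrim x) (y : P → K) (a b : P) :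
    conv x y (a * b) = conv x (fun c => y (c * b)) a + conv x (fun c => y (a * c)) b := by
  rw [conv_mul_apply]
  simp only [hx _ _, add_mul, Multiset.sum_map_add]
  congr 1
  · refine congrArg Multiset.sum (Multiset.map_congr rfl fun p _ => ?_)
    simp only [mul_assoc, Multiset.sum_map_mul_left]
    congr 1
    exact one_conv (delta_self 1) (fun _ h => delta_of_ne h) (fun c => y (p.2 * c)) b
  · rw [Multiset.sum_map_sum_map]
    refine congrArg Multiset.sum (Multiset.map_congr rfl fun q _ => ?_)
    simp only [mul_assoc, mul_left_comm _ (x q.1), Multiset.sum_map_mul_left]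
    congr 1
    exact one_conv (delta_self 1) (fun _ h => delta_of_ne h) (fun c => y (c * q.2)) a

theorem IsPrim.conv_one {x : P → K} (hx : IsPrim x) (y : P → K) : conv x y 1 = 0 := by
  simp [conv, cop_one, hx.apply_one]

/-- The form `x` is a derivation of the convolution algebra twisted by a factor. -/
theorem IsPrim.conv_mul' {x : P → K} (hx : IsPrim x) (y : P → K) (a a' b : P) :
    conv x (fun c => y (c * b)) (a * a') =
      conv x (fun c => y (c * (a' * b))) a + conv x (fun c => y (c * (a * b))) a' := by
  rw [hx.conv_mul]
  simp only [mul_assoc, mul_left_comm]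

/-- `y` vanishes on the products of more than `n` elements of the augmentation ideal. -/
def OrderLE (y : P → K) (n : ℕ) : Prop :=
  ∀ s : Multiset P, (∀ d ∈ s, d ≠ 1) → n < s.card → y s.prod = 0

/-- The derivation `x` acts on one factor at a time; `t` collects the factors that it has already
passed. The factor it acts on may be used up, but all others survive, so at most one factor is lost
and more than `n` remain for `y`. -/
theorem OrderLE.conv_aux {x : P → K} (hx : IsPrim x) {y : P → K} {n : ℕ}
    (hy : OrderLE y n) (s t : Multiset P) (hs : ∀ d ∈ s, d ≠ 1) (ht : ∀ d ∈ t, d ≠ 1)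
    (h : n + 1 < s.card + t.card) : conv x (fun c => y (c * t.prod)) s.prod = 0 := by
  induction s using Multiset.induction generalizing t with
  | empty => rw [Multiset.prod_zero, hx.conv_one]
  | cons d s ih =>
    rw [Multiset.card_cons] at h
    have hs' : ∀ d ∈ s, d ≠ 1 := fun e he => hs e (Multiset.mem_cons_of_mem he)
    have hst : ∀ d ∈ s + t, d ≠ 1 := fun e he =>
      (Multiset.mem_add.1 he).elim (hs' e) (ht e)
    rw [Multiset.prod_cons, hx.conv_mul', ← Multiset.prod_cons d t, ih (d ::ₘ t) hs', add_zero,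
      ← Multiset.prod_add]
    · rw [CombBialgebra.conv, Multiset.sum_eq_zero]
      intro z hz
      obtain ⟨p, hp, rfl⟩ := Multiset.mem_map.1 hz
      by_cases h1 : p.2 = 1
      · simp only [h1, one_mul]
        rw [hy (s + t) hst (by rw [Multiset.card_add]; omega), mul_zero]
      · rw [← Multiset.prod_cons, hy (p.2 ::ₘ (s + t)), mul_zero]
        · exact Multiset.forall_mem_cons.2 ⟨h1, hst⟩
        · rw [Multiset.card_cons, Multiset.card_add]; omega
    · exact Multiset.forall_mem_cons.2 ⟨hs d (Multiset.mem_cons_self _ _), ht⟩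
    · rw [Multiset.card_cons]; omega

theorem OrderLE.conv {x : P → K} (hx : IsPrim x) {y : P → K} {n : ℕ}
    (hy : OrderLE y n) : OrderLE (conv x y) (n + 1) := by
  intro s hs h
  have := OrderLE.conv_aux hx hy s 0 hs (by simp) (by simpa using h)
  simpa using this

variable (K) in
/-- The product of the basis elements that are the letters of a word. -/
noncomputable def wordProd : List (Conn P) → P → K
  | [] => delta K 1
  | c :: w => conv (delta K c.1) (wordProd w)

theorem wordProd_cons (c : Conn P) (w : List (Conn P)) :
    wordProd K (c :: w) = conv (delta K c.1) (wordProd K w) := rfl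

theorem orderLE_wordProd (w : List (Conn P)) : OrderLE (wordProd K w) w.length := by
  induction w with
  | nil =>
    intro s hs h
    refine delta_of_ne fun h1 => ?_
    obtain ⟨d, hd⟩ := Multiset.card_pos_iff_exists_mem.1 h
    obtain ⟨s, rfl⟩ := Multiset.exists_cons_of_mem hd
    rw [Multiset.prod_cons, mul_eq_one] at h1
    exact hs d hd h1.1
  | cons c w ih =>
    rw [wordProd_cons]
    exact OrderLE.conv (isPrim_delta c) ih

/-- The vanishing half of the triangularity. -/
theorem wordProd_apply_eq_zero {w : List (Conn P)} {m : Multiset (Conn P)}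
    (h : w.length < m.card) : (wordProd K w) (prodConn m) = 0 := by
  refine orderLE_wordProd w _ ?_ (by simpa using h)
  intro d hd
  obtain ⟨c, -, rfl⟩ := Multiset.mem_map.1 hd
  exact c.2.1

/-- The derivation for the letter `c` runs through the factors in `s`, those in `t` being already
passed. If it acts on `d` without using it up, too many factors remain for `w` and the order bound
kills the term. So `d` contributes only if `d = c`, and then the pairing of `w` with the remaining
factors. All contributions are natural numbers, hence nothing cancels. -/
theorem conv_single_aux {w : List (Conn P)} (hw : ∀ m : Multiset (Conn P), m.card = w.length →
      ∃ k : ℕ, (wordProd K w) (prodConn m) = k ∧ (k ≠ 0 ↔ (w : Multiset (Conn P)) = m))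
    (c : Conn P) (s t : Multiset (Conn P)) (h : s.card + t.card = w.length + 1) :
    ∃ k : ℕ, conv (delta K c.1) (fun d => wordProd K w (d * prodConn t)) (prodConn s) = k ∧
      (k ≠ 0 ↔ c ∈ s ∧ c ::ₘ (w : Multiset (Conn P)) = s + t) := by
  induction s using Multiset.induction generalizing t with
  | empty => exact ⟨0, by rw [prodConn_zero, (isPrim_delta c).conv_one, Nat.cast_zero], by simp⟩
  | cons d s ih =>
    rw [Multiset.card_cons] at h
    obtain ⟨k, hk, hk'⟩ := ih (d ::ₘ t) (by rw [Multiset.card_cons]; omega)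
    obtain ⟨l, hl, hl'⟩ := hw (s + t) (by rw [Multiset.card_add]; omega)
    -- Only the term `(d, 1)` of `cop d` survives: in every other term the second factor is a
    -- further non-unit for `w` to be evaluated on.
    have hfirst : conv (delta K c.1) (fun e => wordProd K w (e * (prodConn s * prodConn t))) d.1
        = delta K c.1 d.1 * l := by
      obtain ⟨z, hz, hz'⟩ := counit_right d.1
      rw [CombBialgebra.conv, hz, Multiset.map_cons, Multiset.sum_cons, one_mul, ← prodConn_add, hl,
        Multiset.sum_eq_zero, add_zero]
      intro y hy
      obtain ⟨p, hp, rfl⟩ := Multiset.mem_map.1 hy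
      have := orderLE_wordProd (K := K) w (p.2 ::ₘ (s + t).map Subtype.val) (by
        refine Multiset.forall_mem_cons.2 ⟨hz' p hp, fun d hd => ?_⟩
        obtain ⟨c, -, rfl⟩ := Multiset.mem_map.1 hd
        exact c.2.1) (by rw [Multiset.card_cons, Multiset.card_map, Multiset.card_add]; omega)
      rw [Multiset.prod_cons] at this
      exact mul_eq_zero_of_right _ this
    rw [prodConn_cons, (isPrim_delta c).conv_mul', hfirst, ← prodConn_cons, hk]
    rw [Multiset.add_cons] at hk'
    by_cases hcd : d = c
    · subst hcd
      refine ⟨l + k, by rw [delta_self, one_mul, Nat.cast_add], ?_⟩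
      rw [ne_eq, Nat.add_eq_zero_iff, not_and_or, ← ne_eq, ← ne_eq, hl', hk', Multiset.cons_add,
        Multiset.cons_inj_right]
      simp only [Multiset.mem_cons, true_or, true_and]
      exact ⟨fun h => h.elim id And.right, Or.inl⟩
    · refine ⟨k, by rw [delta_of_ne (fun h => hcd (Subtype.ext h)), zero_mul, zero_add], ?_⟩
      rw [hk', Multiset.mem_cons, Multiset.cons_add, or_iff_right (Ne.symm hcd)]

/-- The number is the product of the factorials of the multiplicities. It suffices to know that it
is natural and when it vanishes; characteristic zero then makes the diagonal of the pairing
invertible. -/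
theorem wordProd_apply_of_length_eq (w : List (Conn P)) (m : Multiset (Conn P))
    (h : m.card = w.length) :
    ∃ k : ℕ, (wordProd K w) (prodConn m) = k ∧ (k ≠ 0 ↔ (w : Multiset (Conn P)) = m) := by
  induction w generalizing m with
  | nil =>
    rw [List.length_nil, Multiset.card_eq_zero] at h
    subst h
    exact ⟨1, by simpa [prodConn, wordProd] using delta_self 1, by simp⟩
  | cons c w ih =>
    obtain ⟨k, hk, hk'⟩ := conv_single_aux ih c m 0 (by simpa using h)
    refine ⟨k, ?_, ?_⟩
    · rw [← hk, wordProd_cons]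
      simp only [prodConn, Multiset.map_zero, Multiset.prod_zero, mul_one]
    · rw [hk', add_zero, ← Multiset.cons_coe]
      exact ⟨And.right, fun h => ⟨h ▸ Multiset.mem_cons_self _ _, h⟩⟩

theorem wordProd_apply_toList_ne_zero [CharZero K] (m : Multiset (Conn P)) :
    (wordProd K m.toList) (prodConn m) ≠ 0 := by
  obtain ⟨k, hk, hk'⟩ := wordProd_apply_of_length_eq (K := K) m.toList m (by simp)
  rw [hk, Nat.cast_ne_zero, hk', Multiset.coe_toList]

theorem wordProd_apply_toList_eq_zero {m m' : Multiset (Conn P)} (h : m.card = m'.card)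
    (hne : m ≠ m') : (wordProd K m.toList) (prodConn m') = 0 := by
  obtain ⟨k, hk, hk'⟩ := wordProd_apply_of_length_eq (K := K) m.toList m' (by simp [h])
  rw [Multiset.coe_toList] at hk'
  rw [hk, not_not.1 (fun h => hne (hk'.1 h)), Nat.cast_zero]

/-- A product of basis elements is homogeneous. -/
theorem deg_eq_of_wordProd_ne_zero {w : List (Conn P)} {c : P} (h : wordProd K w c ≠ 0) :
    deg c = deg (prodConn (w : Multiset (Conn P))) := by
  induction w generalizing c with
  | nil =>
    by_cases hc : c = 1
    · simp [hc, prodConn]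
    · exact absurd (delta_of_ne hc) h
  | cons d w ih =>
    rw [wordProd_cons, CombBialgebra.conv] at h
    obtain ⟨p, hp, hp0⟩ : ∃ p ∈ cop c, delta K d.1 p.1 * wordProd K w p.2 ≠ 0 := by
      by_contra! h0
      refine h (Multiset.sum_eq_zero fun x hx => ?_)
      obtain ⟨p, hp, rfl⟩ := Multiset.mem_map.1 hx
      exact h0 p hp
    have h1 : p.1 = d.1 := by
      by_contra hne
      exact left_ne_zero_of_mul hp0 (delta_of_ne hne)
    rw [← deg_cop c p hp, ih (right_ne_zero_of_mul hp0), h1, ← Multiset.cons_coe, prodConn_cons,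
      deg_mul]

/-- The defect of the convolution from being primitive is `x a * y b + y a * x b`. It is symmetric
in `x` and `y` and therefore disappears from the commutator. -/
theorem IsPrim.conv_apply_mul {x y : P → K} (hx : IsPrim x) (hy : IsPrim y) (a b : P) :
    conv x y (a * b) = conv x y a * delta K 1 b + x a * y b + y a * x b
      + delta K 1 a * conv x y b := by
  have h2 : conv x (fun c => y (c * b)) a = conv x y a * delta K 1 b + x a * y b := by
    simp only [CombBialgebra.conv, hy _ b, mul_add, Multiset.sum_map_add]
    simp only [← mul_assoc, Multiset.sum_map_mul_right]
    congr 2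
    exact congrFun (conv_delta_one x) a
  have h3 : conv x (fun c => y (a * c)) b = y a * x b + delta K 1 a * conv x y b := by
    simp only [CombBialgebra.conv, hy a, mul_add, Multiset.sum_map_add]
    simp only [mul_left_comm _ (y a), mul_left_comm _ (delta K 1 a), Multiset.sum_map_mul_left]
    congr 2
    exact congrFun (conv_delta_one x) b
  rw [hx.conv_mul y a b, h2, h3]
  ring

theorem IsPrim.commutator {x y : P → K} (hx : IsPrim x) (hy : IsPrim y) :
    IsPrim (fun c => conv x y c - conv y x c) := by
  intro a b
  simp only [hx.conv_apply_mul hy, hy.conv_apply_mul hx]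
  ring

theorem _root_.Profinite.FormalSum.list_prod_single (w : List (Conn P)) :
    (w.map fun c => FormalSum.single K c.1).prod = wordProd K w := by
  induction w with
  | nil => rfl
  | cons c w ih =>
    rw [List.map_cons, List.prod_cons, ih]
    rfl

end CombBialgebra

/-! ### The triangular pairing of monomials and ordered words -/

theorem _root_.List.finite_forall_mem_length_lt {α : Type v} {S : Set α} (hS : S.Finite) (N : ℕ) :
    {w : List α | (∀ a ∈ w, a ∈ S) ∧ w.length < N}.Finite := by
  have := hS.to_subtype
  refine ((List.finite_length_lt S N).image (List.map Subtype.val)).subset ?_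
  rintro w ⟨hw, hN⟩
  refine ⟨w.attach.map fun a => ⟨a.1, hw a.1 a.2⟩, by simpa using hN, ?_⟩
  simp [List.map_map, Function.comp_def]

namespace CombBialgebra

variable {P : Type v} [CommMonoid P] [CombBialgebra P] {K : Type u} [Field K]

/-- If a word does not vanish at `d`, its letters are tensor factors of an iterated coproduct of
`d`, and those stay in `X`. -/
theorem mem_of_wordProd_ne_zero {X : Set P} (hX : ∀ d ∈ X, ∀ p ∈ cop d, p.1 ∈ X ∧ p.2 ∈ X)
    {w : List (Conn P)} {d : P} (hd : d ∈ X) (h : wordProd K w d ≠ 0) : ∀ a ∈ w, a.1 ∈ X := by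
  induction w generalizing d with
  | nil => simp
  | cons a w ih =>
    rw [wordProd_cons, conv] at h
    obtain ⟨p, hp, hp0⟩ : ∃ p ∈ cop d, delta K a.1 p.1 * wordProd K w p.2 ≠ 0 := by
      by_contra! h0
      refine h (Multiset.sum_eq_zero fun x hx => ?_)
      obtain ⟨p, hp, rfl⟩ := Multiset.mem_map.1 hx
      exact h0 p hp
    have h1 : p.1 = a.1 := by
      by_contra hne
      exact left_ne_zero_of_mul hp0 (delta_of_ne hne)
    exact List.forall_mem_cons.2
      ⟨h1 ▸ (hX d hd p hp).1, ih (hX d hd p hp).2 (right_ne_zero_of_mul hp0)⟩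

theorem length_le_of_wordProd_ne_zero {w : List (Conn P)} {d : P} (h : wordProd K w d ≠ 0) :
    w.length ≤ deg d := by
  rw [deg_eq_of_wordProd_ne_zero h, ← Multiset.coe_card]
  exact card_le_deg_prodConn _

variable (K) in
-- The letters lie in a finite set closed under the coproduct, and the degree of `c` bounds the
-- length. This is what replaces finite-dimensional graded pieces.
theorem finite_wordProd_ne_zero (c : P) : {w : List (Conn P) | wordProd K w c ≠ 0}.Finite := by
  obtain ⟨X, hX, hc, -, hXc⟩ := exists_finite_closed c
  refine (List.finite_forall_mem_length_lt
    (hX.preimage (Subtype.val_injective (p := IsConn P)).injOn) (deg c + 1)).subset ?_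
  intro w hw
  exact ⟨mem_of_wordProd_ne_zero hXc hc hw, Nat.lt_succ_of_le (length_le_of_wordProd_ne_zero hw)⟩

variable (K) in
/-- The pairing of the monomial `m` with the words that represent multisets. -/
noncomputable def pairing (m : Multiset (Conn P)) : Multiset (Conn P) →₀ K :=
  Finsupp.ofSupportFinite (fun w => wordProd K w.toList (prodConn m)) <| by
    refine Set.Finite.of_finite_image (f := Multiset.toList)
      ((finite_wordProd_ne_zero K (prodConn m)).subset ?_) ?_
    · rintro _ ⟨w, hw, rfl⟩
      exact hw
    · intro w _ w' _ h
      rw [← Multiset.coe_toList w, ← Multiset.coe_toList w', h]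

theorem pairing_apply (m w : Multiset (Conn P)) :
    pairing K m w = wordProd K w.toList (prodConn m) := rfl

variable (K P) in
/-- The linear map given by the pairing. -/
noncomputable def pairingMap : (Multiset (Conn P) →₀ K) →ₗ[K] (Multiset (Conn P) →₀ K) :=
  Finsupp.linearCombination K (pairing K)

/-- Evaluate at a monomial `m` of the support with the fewest factors. By triangularity the other
monomials of the support contribute nothing there, and the diagonal entry is nonzero. -/
theorem pairingMap_injective [CharZero K] : Function.Injective (pairingMap P K) := by
  rw [injective_iff_map_eq_zero]
  intro a ha
  by_contra h0
  obtain ⟨m, hm, hmin⟩ := Finset.exists_min_image a.support Multiset.card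
    (Finsupp.support_nonempty_iff.2 h0)
  have h := DFunLike.congr_fun ha m
  rw [pairingMap, Finsupp.linearCombination_apply, Finsupp.sum, Finsupp.finsetSum_apply,
    Finset.sum_eq_single_of_mem m hm] at h
  · rw [Finsupp.smul_apply, pairing_apply, smul_eq_mul, Finsupp.zero_apply, mul_eq_zero] at h
    exact h.elim (Finsupp.mem_support_iff.1 hm) (wordProd_apply_toList_ne_zero m)
  · intro m' hm' hne
    rw [Finsupp.smul_apply, pairing_apply, smul_eq_mul]
    refine mul_eq_zero_of_right _ ?_
    rcases (hmin m' hm').lt_or_eq with hlt | heq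
    · exact wordProd_apply_eq_zero (by simpa using hlt)
    · exact wordProd_apply_toList_eq_zero heq hne.symm

/-- Apart from `m` itself, only words longer than `m` pair nontrivially with `m`. They have the same
degree as `m`, which bounds their length, so the difference of degree and length decreases and the
triangular system can be solved by induction. -/
theorem pairingMap_surjective [CharZero K] : Function.Surjective (pairingMap P K) := by
  classical
  rw [← LinearMap.range_eq_top, eq_top_iff]
  have key : ∀ m : Multiset (Conn P), Finsupp.single m 1 ∈ (pairingMap P K).range := by
    intro m
    induction hn : deg (prodConn m) - m.card using Nat.strong_induction_on generalizing m with
    | _ n ih =>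
      have h1 : pairing K m ∈ (pairingMap P K).range :=
        ⟨Finsupp.single m 1, by simp [pairingMap]⟩
      have h2 : (pairing K m).erase m ∈ (pairingMap P K).range := by
        rw [← Finsupp.sum_single ((pairing K m).erase m)]
        refine Submodule.sum_mem _ fun w hw => ?_
        rw [Finsupp.support_erase, Finset.mem_erase, Finsupp.mem_support_iff, pairing_apply] at hw
        have h3 : m.card < w.card := by
          rcases lt_trichotomy m.card w.card with h | h | h
          · exact h
          · exact absurd (wordProd_apply_toList_eq_zero h.symm hw.1) hw.2
          · exact absurd (wordProd_apply_eq_zero (by simpa using h)) hw.2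
        have h4 := deg_eq_of_wordProd_ne_zero hw.2
        rw [Multiset.coe_toList] at h4
        have h5 := card_le_deg_prodConn w
        have := Submodule.smul_mem _ (((pairing K m).erase m) w) (ih _ (by omega) w rfl)
        rwa [Finsupp.smul_single, smul_eq_mul, mul_one] at this
      have h3 : Finsupp.single m (pairing K m m) ∈ (pairingMap P K).range := by
        rw [← Finsupp.single_add_erase m (pairing K m)] at h1
        exact (Submodule.add_mem_iff_left _ h2).1 h1
      have := Submodule.smul_mem _ (pairing K m m)⁻¹ h3
      rwa [Finsupp.smul_single, smul_eq_mul,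
        inv_mul_cancel₀ (wordProd_apply_toList_ne_zero m)] at this
  intro a _
  rw [← Finsupp.sum_single a]
  refine Submodule.sum_mem _ fun m _ => ?_
  have := Submodule.smul_mem _ (a m) (key m)
  rwa [Finsupp.smul_single, smul_eq_mul, mul_one] at this

variable (K P) in
/-- The linear isomorphism given by the pairing. -/
noncomputable def pairingEquiv [CharZero K] :
    (Multiset (Conn P) →₀ K) ≃ₗ[K] (Multiset (Conn P) →₀ K) :=
  LinearEquiv.ofBijective (pairingMap P K) ⟨pairingMap_injective, pairingMap_surjective⟩

theorem pairingEquiv_single [CharZero K] (m : Multiset (Conn P)) :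
    pairingEquiv P K (Finsupp.single m 1) = pairing K m := by
  change pairingMap P K _ = _
  simp [pairingMap]

theorem pairingEquiv_apply [CharZero K] (a : Multiset (Conn P) →₀ K) :
    pairingEquiv P K a = a.sum fun m k => k • pairing K m := rfl

end CombBialgebra

/-! ### Topology of completed tensor products and completed tensor algebras -/

namespace Profinite

/-- Every function on a discrete space is continuous. -/
theorem continuous_discrete_comp {X Y Z : Type*} [TopologicalSpace X] [TopologicalSpace Z]
    (g : Y → Z) {f : X → Y} (hf : @Continuous _ _ _ ⊥ f) : Continuous (g ∘ f) :=
  let _ : TopologicalSpace Y := ⊥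
  continuous_bot.comp hf

section General

variable {K : Type u} [Field K]
variable {V : Type v} [AddCommGroup V] [Module K V] [TopologicalSpace V]
variable {U : Type w} [AddCommGroup U] [Module K U] [TopologicalSpace U]

namespace CompletedTensor

theorem continuous_iff {X : Type*} [TopologicalSpace X] {f : X → CompletedTensor K V U} :
    Continuous f ↔ ∀ p, @Continuous _ _ _ ⊥ fun x => (f x).1 p :=
  let (p : OpenSub K V × OpenSub K U) : TopologicalSpace ((V ⧸ p.1.1) ⊗[K] (U ⧸ p.2.1)) := ⊥
  continuous_induced_rng.trans continuous_pi_iff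

theorem continuous_apply (p : OpenSub K V × OpenSub K U) :
    @Continuous _ _ _ ⊥ fun z : CompletedTensor K V U => z.1 p :=
  continuous_iff.1 continuous_id p

instance : T2Space (CompletedTensor K V U) := by
  let (p : OpenSub K V × OpenSub K U) : TopologicalSpace ((V ⧸ p.1.1) ⊗[K] (U ⧸ p.2.1)) := ⊥
  have (p : OpenSub K V × OpenSub K U) : DiscreteTopology ((V ⧸ p.1.1) ⊗[K] (U ⧸ p.2.1)) := ⟨rfl⟩
  exact T2Space.of_injective_continuous (f := fun x : CompletedTensor K V U => x.1)
    Subtype.val_injective continuous_induced_dom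

section Map

variable {V' : Type*} [AddCommGroup V'] [Module K V'] [TopologicalSpace V']
variable {U' : Type*} [AddCommGroup U'] [Module K U'] [TopologicalSpace U']
variable {V'' : Type*} [AddCommGroup V''] [Module K V''] [TopologicalSpace V'']
variable {U'' : Type*} [AddCommGroup U''] [Module K U''] [TopologicalSpace U'']

theorem continuous_map (f : V →L[K] V') (g : U →L[K] U') : Continuous (map f g) := by
  refine continuous_iff.2 fun p => ?_
  exact @continuous_discrete_comp _ _ _ _ ⊥ _ _ (continuous_apply (p.1.comap f, p.2.comap g))

omit [TopologicalSpace V] [TopologicalSpace U] [TopologicalSpace V'] [TopologicalSpace U']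
  [TopologicalSpace V''] [TopologicalSpace U''] in
theorem map_mapQ_map_mapQ {A : Submodule K V} {A' : Submodule K V'} {A'' : Submodule K V''}
    {B : Submodule K U} {B' : Submodule K U'} {B'' : Submodule K U''}
    {f : V →ₗ[K] V'} {g : U →ₗ[K] U'} {f' : V' →ₗ[K] V''} {g' : U' →ₗ[K] U''}
    (hf : A ≤ A'.comap f) (hg : B ≤ B'.comap g) (hf' : A' ≤ A''.comap f') (hg' : B' ≤ B''.comap g')
    (h : A ≤ A''.comap (f' ∘ₗ f)) (h' : B ≤ B''.comap (g' ∘ₗ g)) (z : (V ⧸ A) ⊗[K] (U ⧸ B)) :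
    TensorProduct.map (A'.mapQ A'' f' hf') (B'.mapQ B'' g' hg')
      (TensorProduct.map (A.mapQ A' f hf) (B.mapQ B' g hg) z)
      = TensorProduct.map (A.mapQ A'' (f' ∘ₗ f) h) (B.mapQ B'' (g' ∘ₗ g) h') z := by
  rw [← LinearMap.comp_apply, ← TensorProduct.map_comp, ← Submodule.mapQ_comp,
    ← Submodule.mapQ_comp]

theorem map_map (f : V →L[K] V') (g : U →L[K] U') (f' : V' →L[K] V'') (g' : U' →L[K] U'')
    (z : CompletedTensor K V U) : map f' g' (map f g z) = map (f'.comp f) (g'.comp g) z :=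
  Subtype.ext (funext fun _ => map_mapQ_map_mapQ _ _ _ _ _ _ _)

theorem map_id (z : CompletedTensor K V U) :
    map (ContinuousLinearMap.id K V) (ContinuousLinearMap.id K U) z = z := by
  refine Subtype.ext (funext fun p => ?_)
  have h : TensorProduct.map (p.1.1.mapQ p.1.1 LinearMap.id le_rfl)
      (p.2.1.mapQ p.2.1 LinearMap.id le_rfl) (z.1 p) = z.1 p := by
    rw [Submodule.mapQ_id, Submodule.mapQ_id, TensorProduct.map_id, LinearMap.id_apply]
  exact h

theorem map_ofTensor (f : V →L[K] V') (g : U →L[K] U') (z : V ⊗[K] U) :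
    map f g (ofTensor K V U z)
      = ofTensor K V' U' (TensorProduct.map (f : V →ₗ[K] V') (g : U →ₗ[K] U') z) := by
  refine Subtype.ext (funext fun p => ?_)
  change TensorProduct.map _ _ (TensorProduct.map _ _ z)
    = TensorProduct.map _ _ (TensorProduct.map _ _ z)
  rw [← LinearMap.comp_apply, ← TensorProduct.map_comp, ← LinearMap.comp_apply,
    ← TensorProduct.map_comp]
  congr 2

end Map

end CompletedTensor

namespace CompletedTensorAlgebra

variable (K V) in
/-- The projection to the truncated tensor algebra of a quotient. -/
noncomputable def proj (p : OpenSub K V × ℕ) :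
    CompletedTensorAlgebra K V →ₐ[K] TruncTensor K (V ⧸ p.1.1) p.2 :=
  (Pi.evalAlgHom K (fun p : OpenSub K V × ℕ => TruncTensor K (V ⧸ p.1.1) p.2) p).comp
    (tensorAlgebraLimit K V).val

theorem map_proj {p q : OpenSub K V × ℕ} (h₁ : p.1.1 ≤ q.1.1) (h₂ : q.2 ≤ p.2)
    (t : CompletedTensorAlgebra K V) :
    TruncTensor.map (Submodule.factor h₁) h₂ (proj K V p t) = proj K V q t := t.2 p q h₁ h₂

theorem proj_comp_ofTensorAlgebra_surjective (p : OpenSub K V × ℕ) :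
    Function.Surjective fun t : TensorAlgebra K V => proj K V p (ofTensorAlgebra K V t) := by
  refine (RingQuot.mkAlgHom_surjective K _).comp
    (show Function.Surjective (tensorAlgebraMap p.1.1.mkQ) from ?_)
  rw [← AlgHom.range_eq_top, eq_top_iff, ← TensorAlgebra.adjoin_range_ι, Algebra.adjoin_le_iff]
  rintro _ ⟨x, rfl⟩
  obtain ⟨v, rfl⟩ := Submodule.mkQ_surjective _ x
  exact ⟨TensorAlgebra.ι K v, by simp [tensorAlgebraMap]⟩

theorem continuous_iff {X : Type*} [TopologicalSpace X] {f : X → CompletedTensorAlgebra K V} :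
    Continuous f ↔ ∀ p, @Continuous _ _ _ ⊥ fun x => proj K V p (f x) :=
  let (p : OpenSub K V × ℕ) : TopologicalSpace (TruncTensor K (V ⧸ p.1.1) p.2) := ⊥
  continuous_induced_rng.trans continuous_pi_iff

theorem continuous_proj (p : OpenSub K V × ℕ) : @Continuous _ _ _ ⊥ (proj K V p) :=
  continuous_iff.1 continuous_id p

theorem exists_common_level {I : Set (OpenSub K V × ℕ)} (hI : I.Finite) :
    ∃ p : OpenSub K V × ℕ, ∀ q ∈ I, p.1.1 ≤ q.1.1 ∧ q.2 ≤ p.2 := by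
  induction I, hI using Set.Finite.induction_on with
  | empty => exact ⟨(⟨⊤, isOpen_univ⟩, 0), by simp⟩
  | @insert q I _ _ ih =>
    obtain ⟨p, hp⟩ := ih
    refine ⟨(⟨p.1.1 ⊓ q.1.1, p.1.2.inter q.1.2⟩, max p.2 q.2), ?_⟩
    rintro r (rfl | hr)
    · exact ⟨inf_le_right, le_max_right _ _⟩
    · exact ⟨inf_le_left.trans (hp r hr).1, (hp r hr).2.trans (le_max_left _ _)⟩

/-- The sets of elements with a given projection form a basis of neighbourhoods. -/
theorem exists_proj_of_mem_nhds {t : CompletedTensorAlgebra K V}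
    {O : Set (CompletedTensorAlgebra K V)} (hO : O ∈ nhds t) :
    ∃ p, ∀ s, proj K V p s = proj K V p t → s ∈ O := by
  let (p : OpenSub K V × ℕ) : TopologicalSpace (TruncTensor K (V ⧸ p.1.1) p.2) := ⊥
  rw [nhds_induced, Filter.mem_comap] at hO
  obtain ⟨S, hS, hSO⟩ := hO
  rw [nhds_pi, Filter.mem_pi] at hS
  obtain ⟨I, hI, Y, hY, hYS⟩ := hS
  obtain ⟨p, hp⟩ := exists_common_level hI
  refine ⟨p, fun s hs => hSO (hYS fun q hq => ?_)⟩
  have : proj K V q s = proj K V q t := by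
    rw [← map_proj (hp q hq).1 (hp q hq).2, hs, map_proj]
  change proj K V q s ∈ Y q
  rw [this]
  exact mem_of_mem_nhds (hY q)

variable (K V) in
-- A neighbourhood contains everything that agrees with its centre at a single level, and the tensor
-- algebra maps onto each level.
theorem denseRange_ofTensorAlgebra : DenseRange (ofTensorAlgebra K V) := by
  intro t
  rw [mem_closure_iff_nhds]
  intro O hO
  obtain ⟨p, hp⟩ := exists_proj_of_mem_nhds hO
  obtain ⟨s, hs⟩ := proj_comp_ofTensorAlgebra_surjective p (proj K V p t)
  exact ⟨_, hp _ hs, s, rfl⟩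

/-- A linear map to a discrete space is continuous iff it factors through a projection. -/
theorem exists_proj_of_continuous {f : CompletedTensorAlgebra K V →ₗ[K] K}
    (hf : @Continuous _ _ _ ⊥ f) : ∃ p, ∀ s, proj K V p s = 0 → f s = 0 := by
  let _ : TopologicalSpace K := ⊥
  have : DiscreteTopology K := ⟨rfl⟩
  obtain ⟨p, hp⟩ := exists_proj_of_mem_nhds (t := (0 : CompletedTensorAlgebra K V))
    ((isOpen_discrete ({0} : Set K)).preimage hf |>.mem_nhds (by simp))
  exact ⟨p, fun s hs => hp s (by rw [hs, map_zero])⟩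

end CompletedTensorAlgebra

namespace CompletedEnveloping

variable (br : V → V → V)

theorem mk_surjective : Function.Surjective (mk K br) := Ideal.Quotient.mkₐ_surjective K _

theorem continuous_mk : Continuous (mk K br) := continuous_coinduced_rng

theorem continuous_iff {X : Type*} [TopologicalSpace X] {f : CompletedEnveloping K br → X} :
    Continuous f ↔ Continuous (f ∘ mk K br) := continuous_coinduced_dom

theorem denseRange_ofTensorAlgebra : DenseRange (ofTensorAlgebra K br) := by
  have := (mk_surjective (K := K) br).denseRange.comp
    (CompletedTensorAlgebra.denseRange_ofTensorAlgebra K V) (continuous_mk br)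
  exact this

end CompletedEnveloping

end General

end Profinite

/-! ### The map from the completed tensor algebra to the convolution algebra -/

namespace CombBialgebra

variable {P : Type w} [CommMonoid P] [CombBialgebra P] {K : Type u} [Field K]
variable {V : Type v} [AddCommGroup V] [Module K V] [TopologicalSpace V]

open FormalSum

open Classical in
/-- A space of formal sums of indecomposable elements, in the space of all formal sums. -/
noncomputable def incl (κ : V ≃L[K] FormalSum K (Conn P)) : V →ₗ[K] FormalSum K P :=
  FormalSum.pi fun c => if h : IsConn P c then ev K (⟨c, h⟩ : Conn P) ∘ₗ (κ : V →ₗ[K] FormalSum K (Conn P)) else 0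

variable (κ : V ≃L[K] FormalSum K (Conn P))

theorem incl_apply_conn (v : V) (c : Conn P) : incl κ v c.1 = κ v c := by
  simp [incl, pi_apply, c.2, ev_apply]

theorem incl_apply_of_not {v : V} {c : P} (h : ¬ IsConn P c) : incl κ v c = 0 := by
  simp [incl, pi_apply, h]

theorem isPrim_incl (v : V) : IsPrim (incl κ v) := isPrim_iff.2 fun c h => by
  by_contra hc
  exact h (incl_apply_of_not κ hc)

theorem incl_injective : Function.Injective (incl κ) := by
  intro x y h
  refine κ.injective (funext fun c => ?_)
  rw [← incl_apply_conn, h, incl_apply_conn]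

theorem incl_single (c : Conn P) : incl κ (κ.symm (single K c)) = single K c.1 := by
  funext d
  by_cases hd : IsConn P d
  · rw [incl_apply_conn κ _ ⟨d, hd⟩, κ.apply_symm_apply]
    by_cases h : d = c.1
    · subst h; exact (single_self _).trans (single_self _).symm
    · rw [single_of_ne h, single_of_ne fun e => h (congrArg Subtype.val e)]
  · rw [incl_apply_of_not κ hd, single_of_ne]
    rintro rfl
    exact hd c.2

theorem continuous_incl : Continuous (incl κ) := by
  refine FormalSum.continuous_iff.2 fun c => ?_
  by_cases hc : IsConn P c
  · have : (fun v => incl κ v c) = fun v => κ v ⟨c, hc⟩ := funext fun v => incl_apply_conn κ v ⟨c, hc⟩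
    rw [this]
    exact @Continuous.comp _ _ _ _ _ ⊥ _ _ (FormalSum.continuous_apply _) κ.continuous
  · have : (fun v => incl κ v c) = fun _ => 0 := funext fun v => incl_apply_of_not κ hc
    rw [this]
    exact @continuous_const _ _ _ ⊥ _

/-- The map from the tensor algebra to the convolution algebra. -/
noncomputable def tensorHom : TensorAlgebra K V →ₐ[K] FormalSum K P :=
  TensorAlgebra.lift K (incl κ)

theorem tensorHom_ι (v : V) : tensorHom κ (TensorAlgebra.ι K v) = incl κ v :=
  TensorAlgebra.lift_ι_apply _ _

variable (K) in
/-- The formal sums that vanish on a set that is closed under the coproduct. -/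
def vanishingIdeal (X : Set P) (hX : ∀ d ∈ X, ∀ p ∈ cop d, p.1 ∈ X ∧ p.2 ∈ X) :
    Ideal (FormalSum K P) where
  carrier := {f | ∀ d ∈ X, f d = 0}
  add_mem' hf hg d hd := by rw [FormalSum.add_apply, hf d hd, hg d hd, add_zero]
  zero_mem' d _ := rfl
  smul_mem' g f hf d hd := by
    rw [smul_eq_mul, FormalSum.mul_apply, Multiset.sum_eq_zero]
    intro x hx
    obtain ⟨p, hp, rfl⟩ := Multiset.mem_map.1 hx
    rw [hf _ (hX d hd p hp).2, mul_zero]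

instance (X : Set P) (hX : ∀ d ∈ X, ∀ p ∈ cop d, p.1 ∈ X ∧ p.2 ∈ X) :
    (vanishingIdeal K X hX).IsTwoSided where
  mul_mem_of_left {f} g hf d hd := by
    rw [FormalSum.mul_apply, Multiset.sum_eq_zero]
    intro x hx
    obtain ⟨p, hp, rfl⟩ := Multiset.mem_map.1 hx
    rw [hf _ (hX d hd p hp).1, zero_mul]

/-- A coefficient of the image of a tensor depends only on a projection of the tensor to a
truncated tensor algebra. -/
theorem exists_level (c : P) : ∃ (p : OpenSub K V × ℕ) (β : TruncTensor K (V ⧸ p.1.1) p.2 →ₗ[K] K),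
    ∀ t : TensorAlgebra K V,
      β (CompletedTensorAlgebra.proj K V p (CompletedTensorAlgebra.ofTensorAlgebra K V t))
        = tensorHom κ t c := by
  obtain ⟨X, hXf, hcX, h1X, hX⟩ := exists_finite_closed c
  obtain ⟨N, hN⟩ : ∃ N, ∀ d ∈ X, deg d < N := by
    obtain ⟨N, hN⟩ := (hXf.image deg).bddAbove
    exact ⟨N + 1, fun d hd => Nat.lt_succ_of_le (hN ⟨d, hd, rfl⟩)⟩
  let I := vanishingIdeal K X hX
  -- The coefficient at `c` of a product depends only on the values of the factors on `X`. The
  -- condition of vanishing on `X` is open because `X` is finite.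
  let W : Submodule K V := (I.restrictScalars K).comap (incl κ)
  have hW : IsOpen (W : Set V) := by
    let _ : TopologicalSpace K := ⊥
    have : DiscreteTopology K := ⟨rfl⟩
    have : (W : Set V) = ⋂ d ∈ X, (fun v => incl κ v d) ⁻¹' {0} := by
      ext v
      simp only [Set.mem_iInter]
      rfl
    rw [this]
    exact hXf.isOpen_biInter fun d _ => (isOpen_discrete _).preimage
      ((FormalSum.continuous_apply d).comp (continuous_incl κ))
  let π : FormalSum K P →ₐ[K] FormalSum K P ⧸ I := Ideal.Quotient.mkₐ K I
  have hπ : ∀ f, π f = 0 ↔ f ∈ I := fun f => Ideal.Quotient.eq_zero_iff_mem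
  let g : V ⧸ W →ₗ[K] FormalSum K P ⧸ I := W.liftQ (π.toLinearMap ∘ₗ incl κ) (by
    intro v hv
    exact (hπ _).2 hv)
  have hg : ∀ v, g (W.mkQ v) = π (incl κ v) := fun v => rfl
  -- All degrees on `X` are less than `N`, so products of at least `N` primitive elements vanish on
  -- `X`; this is why the truncation at `N` is harmless.
  let γ : TruncTensor K (V ⧸ W) N →ₐ[K] FormalSum K P ⧸ I :=
    RingQuot.liftAlgHom K ⟨TensorAlgebra.lift K g, by
      rintro a b ⟨⟨n, hn, x, rfl⟩, rfl⟩
      obtain ⟨y, rfl⟩ : ∃ y : Fin n → V, x = fun i => W.mkQ (y i) :=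
        ⟨fun i => (Submodule.mkQ_surjective W (x i)).choose,
          funext fun i => (Submodule.mkQ_surjective W (x i)).choose_spec.symm⟩
      have : TensorAlgebra.lift K g (TensorAlgebra.tprod K _ n fun i => W.mkQ (y i))
          = π (List.ofFn fun i => incl κ (y i)).prod := by
        rw [TensorAlgebra.tprod_apply, map_list_prod, List.map_ofFn]
        refine Eq.trans ?_ (map_list_prod π _).symm
        rw [List.map_ofFn]
        congr 2
        funext i
        simp only [Function.comp_apply, TensorAlgebra.lift_ι_apply, hg]
      rw [this, map_zero, hπ]
      intro d hd
      refine list_prod_apply_eq_zero _ ?_ ?_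
      · intro f hf
        obtain ⟨i, rfl⟩ := List.mem_ofFn.1 hf
        exact (isPrim_incl κ _).apply_one
      · rw [List.length_ofFn]
        exact (hN d hd).trans_le hn⟩
  -- The coefficient at `c` descends to the quotient since `c` belongs to `X`.
  let ev' : FormalSum K P ⧸ I →ₗ[K] K :=
    ((I.restrictScalars K).liftQ (ev K c) fun f hf => hf c hcX) ∘ₗ
      (Submodule.Quotient.restrictScalarsEquiv K I).symm.toLinearMap
  refine ⟨(⟨W, hW⟩, N), ev' ∘ₗ γ.toLinearMap, fun t => ?_⟩
  have h : (γ.comp (RingQuot.mkAlgHom K (TruncRel K (V ⧸ W) N))).comp (tensorAlgebraMap W.mkQ)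
      = π.comp (tensorHom κ) := by
    refine TensorAlgebra.hom_ext (LinearMap.ext fun v => ?_)
    simp only [LinearMap.comp_apply, AlgHom.toLinearMap_apply, AlgHom.comp_apply, tensorHom_ι,
      tensorAlgebraMap, TensorAlgebra.lift_ι_apply, γ, RingQuot.liftAlgHom_mkAlgHom_apply, hg]
  change ev' (((γ.comp (RingQuot.mkAlgHom K (TruncRel K (V ⧸ W) N))).comp
    (tensorAlgebraMap W.mkQ)) t) = _
  rw [h]
  rfl

/-- The level on which a coefficient depends. -/
noncomputable def level (c : P) : OpenSub K V × ℕ := (exists_level κ c).choose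

/-- The coefficient, as a linear form on the truncated tensor algebra. -/
noncomputable def levelForm (c : P) : TruncTensor K (V ⧸ (level κ c).1.1) (level κ c).2 →ₗ[K] K :=
  (exists_level κ c).choose_spec.choose

/-- The continuous extension of `tensorHom`. -/
noncomputable def completedHomLin : CompletedTensorAlgebra K V →ₗ[K] FormalSum K P :=
  FormalSum.pi fun c =>
    levelForm κ c ∘ₗ (CompletedTensorAlgebra.proj K V (level κ c)).toLinearMap

theorem completedHomLin_ofTensorAlgebra (t : TensorAlgebra K V) :
    completedHomLin κ (CompletedTensorAlgebra.ofTensorAlgebra K V t) = tensorHom κ t :=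
  funext fun c => (exists_level κ c).choose_spec.choose_spec t

theorem continuous_completedHomLin : Continuous (completedHomLin κ) := by
  refine FormalSum.continuous_iff.2 fun c => ?_
  exact @continuous_discrete_comp _ _ _ _ ⊥ _ _
    (CompletedTensorAlgebra.continuous_proj (level κ c))

/-- The continuous extension of `tensorHom`, as a homomorphism of algebras. -/
noncomputable def completedHom : CompletedTensorAlgebra K V →ₐ[K] FormalSum K P :=
  AlgHom.ofLinearMap (completedHomLin κ)
    (by rw [← map_one (CompletedTensorAlgebra.ofTensorAlgebra K V),
      completedHomLin_ofTensorAlgebra, map_one])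
    (by
      have hd := CompletedTensorAlgebra.denseRange_ofTensorAlgebra K V
      have hc := continuous_completedHomLin κ
      -- Multiplicativity holds on the dense image of the tensor algebra, and both sides are jointly
      -- continuous with values in a Hausdorff space.
      have := DenseRange.equalizer (hd.prodMap hd)
        (g := fun s : CompletedTensorAlgebra K V × CompletedTensorAlgebra K V =>
          completedHomLin κ (s.1 * s.2))
        (h := fun s => completedHomLin κ s.1 * completedHomLin κ s.2)
        (hc.comp continuous_mul)
        ((hc.comp continuous_fst).mul (hc.comp continuous_snd)) (by
          funext ⟨s, t⟩
          simp only [Function.comp_apply, Prod.map_apply, ← map_mul,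
            completedHomLin_ofTensorAlgebra]
          exact map_mul _ _ _)
      exact fun s t => congrFun this (s, t))

theorem continuous_completedHom : Continuous (completedHom κ) := continuous_completedHomLin κ

theorem completedHom_ofTensorAlgebra (t : TensorAlgebra K V) :
    completedHom κ (CompletedTensorAlgebra.ofTensorAlgebra K V t) = tensorHom κ t :=
  completedHomLin_ofTensorAlgebra κ t

theorem completedHom_ι (v : V) :
    completedHom κ (CompletedTensorAlgebra.ι K V v) = incl κ v :=
  (completedHom_ofTensorAlgebra κ _).trans (tensorHom_ι κ v)

theorem completedHom_apply (t : CompletedTensorAlgebra K V) (c : P) :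
    completedHom κ t c = levelForm κ c (CompletedTensorAlgebra.proj K V (level κ c) t) := rfl

end CombBialgebra

/-! ### Approximation of formal sums by finite sums, and extensionality on tensor algebras -/

namespace Profinite

variable {K : Type u} [Field K]

/-- An open subspace of a space of formal sums contains the formal sums without terms in a finite
set. -/
theorem FormalSum.exists_finset_mem {α : Type v} (W : OpenSub K (FormalSum K α)) :
    ∃ I : Finset α, ∀ f : FormalSum K α, (∀ a ∈ I, f a = 0) → f ∈ W.1 := by
  let : TopologicalSpace K := ⊥
  have : DiscreteTopology K := ⟨rfl⟩
  let S : Set (α → K) := (W.1 : Set (FormalSum K α))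
  have h0 : S ∈ nhds (0 : α → K) := IsOpen.mem_nhds W.2 W.1.zero_mem
  rw [nhds_pi, Filter.mem_pi] at h0
  obtain ⟨I, hI, t, ht, hs⟩ := h0
  refine ⟨hI.toFinset, fun f hf => hs fun i hi => ?_⟩
  rw [hf i (hI.mem_toFinset.2 hi)]
  exact mem_of_mem_nhds (ht i)

theorem FormalSum.sum_apply {α : Type v} {ι : Type*} (s : Finset ι) (f : ι → FormalSum K α) (a : α) :
    (∑ i ∈ s, f i) a = ∑ i ∈ s, f i a := map_sum (ev K a) f s

/-- Modulo an open subspace, a formal sum is the finite sum of its terms that do not lie in the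
subspace. -/
theorem FormalSum.exists_finset_sub_mem {α : Type v} (W : OpenSub K (FormalSum K α)) :
    ∃ I : Finset α, (∀ a ∉ I, single K a ∈ W.1) ∧
      ∀ f : FormalSum K α, f - ∑ a ∈ I, f a • single K a ∈ W.1 := by
  obtain ⟨I, hI⟩ := exists_finset_mem W
  refine ⟨I, fun a ha => hI _ fun b hb => single_of_ne fun h => ha (h ▸ hb),
    fun f => hI _ fun b hb => ?_⟩
  rw [sub_apply, sum_apply, Finset.sum_eq_single_of_mem b hb, smul_apply, single_self, mul_one,
    sub_self]
  intro a _ hab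
  rw [smul_apply, single_of_ne hab.symm, mul_zero]

/-- A linear form that vanishes on an open subspace and on the basis vectors is zero. -/
theorem FormalSum.linearForm_eq_zero {α : Type v} {V : Type w} [AddCommGroup V] [Module K V]
    [TopologicalSpace V] (κ : V ≃L[K] FormalSum K α) (W : OpenSub K V) {f : V →ₗ[K] K}
    (hf : ∀ v ∈ W.1, f v = 0) (h : ∀ a, f (κ.symm (single K a)) = 0) (v : V) : f v = 0 := by
  obtain ⟨I, -, hI⟩ := exists_finset_sub_mem (W.comap (κ.symm : FormalSum K α →L[K] V))
  have h1 := hf _ (hI (κ v))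
  have h2 : (κ.symm : FormalSum K α →L[K] V) (κ v - ∑ a ∈ I, κ v a • single K a)
      = v - ∑ a ∈ I, κ v a • κ.symm (single K a) := by simp
  change f ((κ.symm : FormalSum K α →L[K] V) _) = 0 at h1
  rw [h2, map_sub, map_sum, Finset.sum_eq_zero, sub_zero] at h1
  · exact h1
  · intro a _
    rw [map_smul, h, smul_zero]

/-- Linear maps from a tensor algebra agree if they agree on products of vectors. -/
theorem tensorAlgebra_linearMap_ext {V : Type v} [AddCommGroup V] [Module K V] {M : Type w}
    [AddCommGroup M] [Module K M] {f g : TensorAlgebra K V →ₗ[K] M}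
    (h : ∀ l : List V, f (l.map (TensorAlgebra.ι K)).prod = g (l.map (TensorAlgebra.ι K)).prod) :
    f = g := by
  have htop : Submodule.span K
      (Submonoid.closure (Set.range (TensorAlgebra.ι K : V →ₗ[K] TensorAlgebra K V)) :
        Set (TensorAlgebra K V)) = ⊤ := by
    rw [← Algebra.adjoin_eq_span, TensorAlgebra.adjoin_range_ι]
    rfl
  refine LinearMap.ext_on htop fun t ht => ?_
  obtain ⟨l, hl, rfl⟩ := Submonoid.exists_list_of_mem_closure ht
  obtain ⟨l, rfl⟩ : ∃ l' : List V, l = l'.map (TensorAlgebra.ι K) := by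
    have : l ∈ Set.range (List.map (TensorAlgebra.ι K : V →ₗ[K] TensorAlgebra K V)) := by
      rw [Set.range_list_map]; exact hl
    exact ⟨this.choose, this.choose_spec.symm⟩
  exact h l

end Profinite

/-! ### Words, and the section of the map to the convolution algebra -/

namespace CombBialgebra

variable {P : Type w} [CommMonoid P] [CombBialgebra P] {K : Type u} [Field K]
variable {V : Type v} [AddCommGroup V] [Module K V] [TopologicalSpace V]
variable (κ : V ≃L[K] FormalSum K (Conn P))

open FormalSum CompletedTensorAlgebra

/-- A word in the basis vectors, as an element of the completed tensor algebra. -/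
noncomputable def word (w : List (Conn P)) : CompletedTensorAlgebra K V :=
  (w.map fun c => CompletedTensorAlgebra.ι K V (κ.symm (single K c))).prod

theorem word_append (w w' : List (Conn P)) : word κ (w ++ w') = word κ w * word κ w' := by
  simp [word]

theorem word_cons (c : Conn P) (w : List (Conn P)) :
    word κ (c :: w) = CompletedTensorAlgebra.ι K V (κ.symm (single K c)) * word κ w := by
  simp [word]

theorem completedHom_word (w : List (Conn P)) : completedHom κ (word κ w) = wordProd K w := by
  rw [← list_prod_single, word, map_list_prod, List.map_map]
  congr 2
  funext c
  rw [Function.comp_apply, completedHom_ι, incl_single]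

theorem proj_ι (p : OpenSub K V × ℕ) (v : V) : proj K V p (CompletedTensorAlgebra.ι K V v)
    = RingQuot.mkAlgHom K _ (TensorAlgebra.ι K (p.1.1.mkQ v)) := by
  change RingQuot.mkAlgHom K _ (tensorAlgebraMap p.1.1.mkQ (TensorAlgebra.ι K v)) = _
  rw [tensorAlgebraMap, TensorAlgebra.lift_ι_apply]
  rfl

theorem proj_ι_eq_zero {p : OpenSub K V × ℕ} {v : V} (hv : v ∈ p.1.1) :
    proj K V p (CompletedTensorAlgebra.ι K V v) = 0 := by
  rw [proj_ι, Submodule.mkQ_apply, (Submodule.Quotient.mk_eq_zero _).2 hv, map_zero, map_zero]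

theorem proj_prod_eq_zero {p : OpenSub K V × ℕ} {l : List V} (hl : p.2 ≤ l.length) :
    proj K V p (l.map (CompletedTensorAlgebra.ι K V)).prod = 0 := by
  have : proj K V p (l.map (CompletedTensorAlgebra.ι K V)).prod = RingQuot.mkAlgHom K
      (TruncRel K (V ⧸ p.1.1) p.2)
      (TensorAlgebra.tprod K _ l.length fun i => p.1.1.mkQ (l.get i)) := by
    rw [TensorAlgebra.tprod_apply, map_list_prod, map_list_prod, List.map_map, List.map_ofFn]
    congr 1
    conv_lhs => rw [← List.ofFn_get l, List.map_ofFn]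
    congr 1
    funext i
    exact proj_ι p _
  rw [this, ← map_zero (RingQuot.mkAlgHom K (TruncRel K (V ⧸ p.1.1) p.2))]
  exact RingQuot.mkAlgHom_rel K ⟨⟨_, hl, _, rfl⟩, rfl⟩

/-- The open subspace of the level contains all but finitely many basis vectors, and the truncation
bounds the length. Hence arbitrary infinite combinations of words converge. -/
theorem finite_proj_word_ne_zero (p : OpenSub K V × ℕ) :
    {w : List (Conn P) | proj K V p (word κ w) ≠ 0}.Finite := by
  have hS := finite_single_notMem K (p.1.comap (κ.symm : FormalSum K (Conn P) →L[K] V))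
  refine (List.finite_forall_mem_length_lt hS p.2).subset fun w hw => ⟨fun a ha => ?_, ?_⟩
  · intro hmem
    refine hw ?_
    rw [word, map_list_prod]
    refine List.prod_eq_zero ?_
    rw [List.map_map, List.mem_map]
    exact ⟨a, ha, proj_ι_eq_zero hmem⟩
  · by_contra! h
    refine hw ?_
    have := proj_prod_eq_zero (p := p) (l := w.map fun c => κ.symm (single K c)) (by simpa using h)
    rwa [List.map_map] at this

theorem finite_proj_toList_ne_zero (p : OpenSub K V × ℕ) :
    {m : Multiset (Conn P) | proj K V p (word κ m.toList) ≠ 0}.Finite := by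
  refine Set.Finite.of_finite_image (f := Multiset.toList)
    ((finite_proj_word_ne_zero κ p).subset ?_) ?_
  · rintro _ ⟨w, hw, rfl⟩
    exact hw
  · intro w _ w' _ h
    rw [← Multiset.coe_toList w, ← Multiset.coe_toList w', h]

/-- The infinite linear combination of the words that represent multisets. -/
noncomputable def wordSum (a : Multiset (Conn P) → K) : CompletedTensorAlgebra K V :=
  ⟨fun p => ∑ m ∈ (finite_proj_toList_ne_zero κ p).toFinset,
      a m • proj K V p (word κ m.toList), by
    intro p q h₁ h₂
    dsimp only
    rw [map_sum]
    simp only [map_smul, map_proj h₁ h₂]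
    -- The words that survive at the coarser level already survive at the finer one; the extra terms
    -- have image zero.
    refine (Finset.sum_subset ?_ fun m _ hm => ?_).symm
    · intro m
      simp only [Set.Finite.mem_toFinset, Set.mem_ofPred_eq]
      intro hm h0
      rw [← map_proj h₁ h₂, h0, map_zero] at hm
      exact hm rfl
    · rw [Set.Finite.mem_toFinset, Set.mem_ofPred_eq, not_not] at hm
      rw [hm, smul_zero]⟩

theorem proj_wordSum (a : Multiset (Conn P) → K) (p : OpenSub K V × ℕ) :
    proj K V p (wordSum κ a) = ∑ m ∈ (finite_proj_toList_ne_zero κ p).toFinset,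
      a m • proj K V p (word κ m.toList) := rfl

/-- The coefficient factors through one level, where the infinite sum is finite. The words that are
zero at this level also have zero pairing with the monomial, so the two finite index sets may be
exchanged. -/
theorem completedHom_wordSum_apply (a : Multiset (Conn P) → K) (m₀ : Multiset (Conn P)) :
    completedHom κ (wordSum κ a) (prodConn m₀) = (pairing K m₀).sum fun m k => k * a m := by
  rw [completedHom_apply, proj_wordSum, map_sum, Finsupp.sum]
  have h : ∀ m : Multiset (Conn P), levelForm κ (prodConn m₀)
      (proj K V (level κ (prodConn m₀)) (word κ m.toList)) = pairing K m₀ m := fun m => by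
    rw [← completedHom_apply, completedHom_word, pairing_apply]
  simp only [map_smul, h, smul_eq_mul]
  simp only [mul_comm]
  refine (Finset.sum_subset ?_ fun m _ hm => ?_).symm
  · intro m
    simp only [Set.Finite.mem_toFinset, Set.mem_ofPred_eq, Finsupp.mem_support_iff, ← h]
    intro hm h0
    rw [h0, map_zero] at hm
    exact hm rfl
  · rw [Finsupp.notMem_support_iff.1 hm, mul_zero]

variable [CharZero K]

/-- A formal sum, as a linear form on the finite sums of monomials. -/
noncomputable def evalMonomials (y : FormalSum K P) : (Multiset (Conn P) →₀ K) →ₗ[K] K :=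
  Finsupp.linearCombination K fun m => y (prodConn m)

/-- The coefficients of the preimage of `y`. -/
noncomputable def sectionCoeff (y : FormalSum K P) (m : Multiset (Conn P)) : K :=
  evalMonomials y ((pairingEquiv P K).symm (Finsupp.single m 1))

/-- A continuous right inverse of `completedHom κ`. -/
noncomputable def sectionMap (y : FormalSum K P) : CompletedTensorAlgebra K V :=
  wordSum κ (sectionCoeff y)

/-- The coefficients of the words have to solve one linear equation for each monomial, with the
pairing as matrix. Regarding `y` as a linear form on finite combinations of monomials, its composite
with the inverse of the pairing is the solution. -/
theorem completedHom_sectionMap (y : FormalSum K P) : completedHom κ (sectionMap κ y) = y := by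
  funext c
  obtain ⟨m, rfl⟩ := exists_prodConn c
  rw [sectionMap, completedHom_wordSum_apply]
  have h : ((pairing K m).sum fun m k => k * sectionCoeff y m)
      = evalMonomials y ((pairingEquiv P K).symm (pairing K m)) := by
    conv_rhs => rw [← Finsupp.sum_single (pairing K m), Finsupp.sum, map_sum, map_sum]
    refine Finset.sum_congr rfl fun m' _ => ?_
    change _ * evalMonomials y _ = _
    rw [← smul_eq_mul, ← map_smul, ← map_smul, Finsupp.smul_single, smul_eq_mul,
      mul_one]
  rw [h, ← pairingEquiv_single, LinearEquiv.symm_apply_apply, evalMonomials,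
    Finsupp.linearCombination_single, one_smul]

/-- At a given level only finitely many words matter, and the coefficient of each of them depends on
finitely many values of `y`. -/
theorem continuous_sectionMap : Continuous (sectionMap (V := V) κ) := by
  refine CompletedTensorAlgebra.continuous_iff.2 fun p => ?_
  let _ : TopologicalSpace K := ⊥
  let _ : TopologicalSpace (TruncTensor K (V ⧸ p.1.1) p.2) := ⊥
  have : DiscreteTopology K := ⟨rfl⟩
  have : DiscreteTopology (TruncTensor K (V ⧸ p.1.1) p.2) := ⟨rfl⟩
  refine continuous_finsetSum _ fun m _ => ?_
  refine (continuous_of_discreteTopology (f := fun k : K => k • proj K V p (word κ m.toList))).comp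
    (?_ : Continuous fun y : FormalSum K P => sectionCoeff y m)
  refine continuous_finsetSum _ fun m' _ => ?_
  exact (continuous_of_discreteTopology (f := fun k : K => ((pairingEquiv P K).symm (Finsupp.single m 1)) m' * k)).comp
    (FormalSum.continuous_apply (prodConn m'))

end CombBialgebra

/-! ### The kernel of the map to the convolution algebra, and the isomorphism -/

namespace CombBialgebra

variable {P : Type w} [CommMonoid P] [CombBialgebra P] {K : Type u} [Field K]
variable {V : Type v} [AddCommGroup V] [Module K V] [TopologicalSpace V]
variable (κ : V ≃L[K] FormalSum K (Conn P)) (br : V → V → V)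

open FormalSum CompletedTensorAlgebra

/-- A form that factors through the level `p` sees the vector in one tensor slot only modulo the
open subspace `p.1`, where every vector is a finite combination of basis vectors. -/
theorem slot_eq_zero {f : CompletedTensorAlgebra K V →ₗ[K] K} {p : OpenSub K V × ℕ}
    (hf : ∀ s, proj K V p s = 0 → f s = 0) (a b : CompletedTensorAlgebra K V)
    (h : ∀ c, f (a * CompletedTensorAlgebra.ι K V (κ.symm (single K c)) * b) = 0) (v : V) :
    f (a * CompletedTensorAlgebra.ι K V v * b) = 0 := by
  let g : V →ₗ[K] K :=
    f ∘ₗ LinearMap.mulLeft K a ∘ₗ LinearMap.mulRight K b ∘ₗ CompletedTensorAlgebra.ι K V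
  have hg : ∀ v, g v = f (a * CompletedTensorAlgebra.ι K V v * b) := fun v => by
    simp [g, mul_assoc]
  rw [← hg]
  refine linearForm_eq_zero κ p.1 (fun v hv => ?_) (fun c => ?_) v
  · rw [hg]
    exact hf _ (by rw [map_mul, map_mul, proj_ι_eq_zero hv, mul_zero, zero_mul])
  · rw [hg, h]

/-- A continuous linear form that vanishes on the words is zero. -/
theorem eq_zero_of_word {f : CompletedTensorAlgebra K V →ₗ[K] K} {p : OpenSub K V × ℕ}
    (hf : ∀ s, proj K V p s = 0 → f s = 0) (h : ∀ w, f (word κ w) = 0)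
    (t : CompletedTensorAlgebra K V) : f t = 0 := by
  -- The vectors of `l` are replaced by basis vectors one at a time, from the left; `w` is the part
  -- already replaced.
  have key : ∀ (l : List V) (w : List (Conn P)),
      f (word κ w * (l.map (CompletedTensorAlgebra.ι K V)).prod) = 0 := by
    intro l
    induction l with
    | nil => intro w; simpa using h w
    | cons v l ih =>
      intro w
      rw [List.map_cons, List.prod_cons, ← mul_assoc]
      refine slot_eq_zero κ hf _ _ (fun c => ?_) v
      have := ih (w ++ [c])
      rwa [word_append, word_cons, word, word, List.map_nil, List.prod_nil, mul_one] at this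
  obtain ⟨s, hs⟩ := proj_comp_ofTensorAlgebra_surjective p (proj K V p t)
  beta_reduce at hs
  have h0 : f ∘ₗ (ofTensorAlgebra K V).toLinearMap = 0 := by
    refine tensorAlgebra_linearMap_ext fun l => ?_
    have := key l []
    rw [word, List.map_nil, List.prod_nil, one_mul] at this
    rw [LinearMap.comp_apply, AlgHom.toLinearMap_apply, map_list_prod, List.map_map,
      LinearMap.zero_apply]
    exact this
  have h1 := hf (ofTensorAlgebra K V s - t) (by rw [map_sub, hs, sub_self])
  rw [map_sub, sub_eq_zero] at h1
  rw [← h1]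
  exact LinearMap.congr_fun h0 s

/-- A continuous linear form that vanishes on the ideal of the enveloping algebra and on the words
that represent multisets is zero. -/
theorem eq_zero_of_toList {f : CompletedTensorAlgebra K V →ₗ[K] K} {p : OpenSub K V × ℕ}
    (hf : ∀ s, proj K V p s = 0 → f s = 0)
    (hrel : ∀ a b x y, f (a * (CompletedTensorAlgebra.ι K V x * CompletedTensorAlgebra.ι K V y
      - CompletedTensorAlgebra.ι K V y * CompletedTensorAlgebra.ι K V x
      - CompletedTensorAlgebra.ι K V (br x y)) * b) = 0)
    (h : ∀ m : Multiset (Conn P), f (word κ m.toList) = 0) (t : CompletedTensorAlgebra K V) :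
    f t = 0 := by
  refine eq_zero_of_word κ hf (fun w => ?_) t
  induction hn : w.length using Nat.strong_induction_on generalizing w with
  | _ n ih =>
    -- The prefix `u` is left in place by the permutation; it is needed because the induction on
    -- permutations strips off common first letters.
    have key : ∀ {w₁ w₂ : List (Conn P)}, w₁.Perm w₂ → ∀ u : List (Conn P),
        u.length + w₁.length = n → f (word κ (u ++ w₁)) = f (word κ (u ++ w₂)) := by
      intro w₁ w₂ hp
      induction hp with
      | nil => exact fun _ _ => rfl
      | cons x _ ih' =>
        intro u hu
        have := ih' (u ++ [x]) (by simp at hu ⊢; omega)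
        simpa using this
      | @swap x y l =>
        intro u hu
        rw [← sub_eq_zero, ← map_sub]
        have h1 := hrel (word κ u) (word κ l) (κ.symm (single K y)) (κ.symm (single K x))
        -- The bracket is not a basis vector, but in its slot it may be tested on basis vectors,
        -- which gives words with one letter less.
        have h2 : f (word κ u * CompletedTensorAlgebra.ι K V
            (br (κ.symm (single K y)) (κ.symm (single K x))) * word κ l) = 0 := by
          refine slot_eq_zero κ hf _ _ (fun c => ?_) _
          have := ih (n - 1) (by simp at hu; omega) (u ++ c :: l) (by simp at hu ⊢; omega)
          rwa [word_append, word_cons, ← mul_assoc] at this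
        rw [mul_sub, sub_mul, map_sub, h2, sub_zero] at h1
        rw [← h1, word_append, word_append, word_cons, word_cons, word_cons, word_cons]
        congr 1
        noncomm_ring
      | trans h₁ _ ih₁ ih₂ =>
        intro u hu
        rw [ih₁ u hu, ih₂ u (by rw [← h₁.length_eq]; exact hu)]
    have hp : w.Perm (w : Multiset (Conn P)).toList :=
      Multiset.coe_eq_coe.1 (Multiset.coe_toList _).symm
    have := key hp [] (by simpa using hn)
    rw [List.nil_append, List.nil_append] at this
    rw [this, h]

variable {br} (hbr : ∀ x y, incl κ (br x y) = incl κ x * incl κ y - incl κ y * incl κ x)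

include hbr in
-- The kernel is a two-sided ideal that contains the relations, and it is closed because the target
-- is Hausdorff.
theorem completedHom_eq_zero_of_mem {t : CompletedTensorAlgebra K V} (ht : t ∈ lieIdeal K br) :
    completedHom κ t = 0 := by
  have hclosed : IsClosed {t | completedHom κ t = 0} :=
    isClosed_eq (continuous_completedHom κ) continuous_const
  refine closure_minimal (fun s hs => ?_) hclosed ht
  have hker : TwoSidedIdeal.span {r | ∃ x y : V, r =
      CompletedTensorAlgebra.ι K V x * CompletedTensorAlgebra.ι K V y
        - CompletedTensorAlgebra.ι K V y * CompletedTensorAlgebra.ι K V x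
        - CompletedTensorAlgebra.ι K V (br x y)} ≤ TwoSidedIdeal.ker (completedHom κ) := by
    rw [TwoSidedIdeal.span_le]
    rintro _ ⟨x, y, rfl⟩
    change _ ∈ TwoSidedIdeal.ker _
    rw [TwoSidedIdeal.mem_ker, map_sub, map_sub, map_mul, map_mul, completedHom_ι, completedHom_ι,
      completedHom_ι, hbr, sub_self]
  exact (TwoSidedIdeal.mem_ker _).1 (hker (TwoSidedIdeal.mem_asIdeal.1 hs))

include hbr in
-- Separate `t` from the closed ideal by a continuous form `f` that kills the ideal. On the words
-- that represent multisets `f` coincides with a finite combination `g` of coefficients of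
-- `completedHom`. Both kill the relations, so they coincide everywhere by `eq_zero_of_toList`; but
-- `g t = 0` and `f t ≠ 0`.
theorem mem_lieIdeal_of_completedHom_eq_zero [CharZero K] {t : CompletedTensorAlgebra K V}
    (ht : completedHom κ t = 0) : t ∈ lieIdeal K br := by
  by_contra hmem
  set J : TwoSidedIdeal (CompletedTensorAlgebra K V) := TwoSidedIdeal.span {r | ∃ x y : V, r =
      CompletedTensorAlgebra.ι K V x * CompletedTensorAlgebra.ι K V y
        - CompletedTensorAlgebra.ι K V y * CompletedTensorAlgebra.ι K V x
        - CompletedTensorAlgebra.ι K V (br x y)}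
  have hO : (lieIdeal K br : Set (CompletedTensorAlgebra K V))ᶜ ∈ nhds t := by
    refine IsOpen.mem_nhds ?_ hmem
    exact (isClosed_closure (s := (J.asIdeal : Set (CompletedTensorAlgebra K V)))).isOpen_compl
  obtain ⟨p, hp⟩ := exists_proj_of_mem_nhds hO
  -- The kernel of the projection is added to the ideal so that a form vanishing on `S` factors
  -- through a level and is therefore continuous.
  let S : Submodule K (CompletedTensorAlgebra K V) :=
    J.asIdeal.restrictScalars K ⊔ (proj K V p).toLinearMap.ker
  have htS : t ∉ S := by
    intro h
    obtain ⟨j, hj, k, hk, rfl⟩ := Submodule.mem_sup.1 h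
    refine hp j ?_ (subset_closure hj)
    have : proj K V p k = 0 := hk
    rw [map_add, this, add_zero]
  obtain ⟨f, hft, hfS⟩ := Submodule.exists_le_ker_of_notMem htS
  have hf : ∀ s, proj K V p s = 0 → f s = 0 := fun s hs =>
    hfS (Submodule.mem_sup_right (show s ∈ (proj K V p).toLinearMap.ker from hs))
  have hfJ : ∀ s ∈ J, f s = 0 := fun s hs =>
    hfS (Submodule.mem_sup_left (show s ∈ J.asIdeal.restrictScalars K from
      TwoSidedIdeal.mem_asIdeal.2 hs))
  -- Since `f` factors through the level `p`, only finitely many of these words have a nonzero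
  -- value; so `φ` lies in the space on which the pairing is surjective.
  let φ : Multiset (Conn P) →₀ K := Finsupp.ofSupportFinite (fun m => f (word κ m.toList))
    ((finite_proj_toList_ne_zero κ p).subset fun m hm h0 => hm (hf _ h0))
  let a := (pairingEquiv P K).symm φ
  let g : CompletedTensorAlgebra K V →ₗ[K] K :=
    (a.sum fun m k => k • ev K (prodConn m)) ∘ₗ (completedHom κ).toLinearMap
  have hga : ∀ s, g s = a.sum fun m k => k * completedHom κ s (prodConn m) := by
    intro s
    simp only [g, LinearMap.comp_apply, Finsupp.sum, LinearMap.sum_apply, LinearMap.smul_apply,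
      ev_apply, smul_eq_mul, AlgHom.toLinearMap_apply]
  have hgc : @Continuous _ _ _ ⊥ g := by
    let _ : TopologicalSpace K := ⊥
    have : DiscreteTopology K := ⟨rfl⟩
    have : (g : CompletedTensorAlgebra K V → K)
      = fun s => a.sum fun m k => k * completedHom κ s (prodConn m) := funext hga
    rw [this]
    exact continuous_finsetSum _ fun m _ => continuous_const.mul
      ((FormalSum.continuous_apply _).comp (continuous_completedHom κ))
  obtain ⟨q, hq⟩ := exists_proj_of_continuous hgc
  -- The forms `f` and `g` may depend on different levels; their difference depends on a common
  -- refinement.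
  obtain ⟨r, hr⟩ := exists_common_level (I := {p, q}) (Set.toFinite _)
  have hrp := hr p (by simp)
  have hrq := hr q (by simp)
  have hfin := eq_zero_of_toList κ br (f := f - g) (p := r) (fun s hs => ?_) (fun b c x y => ?_)
    (fun m => ?_) t
  · rw [LinearMap.sub_apply, hga, ht, sub_eq_zero] at hfin
    rw [hfin] at hft
    exact hft (Finset.sum_eq_zero fun m _ => mul_zero _)
  · rw [LinearMap.sub_apply, hf, hq, sub_zero]
    · rw [← map_proj hrq.1 hrq.2, hs, map_zero]
    · rw [← map_proj hrp.1 hrp.2, hs, map_zero]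
  · have hin : b * (CompletedTensorAlgebra.ι K V x * CompletedTensorAlgebra.ι K V y
        - CompletedTensorAlgebra.ι K V y * CompletedTensorAlgebra.ι K V x
        - CompletedTensorAlgebra.ι K V (br x y)) * c ∈ J :=
      J.mul_mem_right _ _ (J.mul_mem_left _ _ (TwoSidedIdeal.subset_span ⟨x, y, rfl⟩))
    rw [LinearMap.sub_apply, hfJ _ hin, zero_sub, neg_eq_zero]
    rw [hga, completedHom_eq_zero_of_mem κ hbr (subset_closure (TwoSidedIdeal.mem_asIdeal.2 hin))]
    exact Finset.sum_eq_zero fun m _ => mul_zero _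
  · rw [LinearMap.sub_apply, hga, completedHom_word, sub_eq_zero]
    have h1 : pairingEquiv P K a m = φ m := by rw [LinearEquiv.apply_symm_apply]
    rw [pairingEquiv_apply, Finsupp.sum, Finsupp.finsetSum_apply] at h1
    exact h1.symm

variable [CharZero K]

/-- The isomorphism of the completed enveloping algebra of the primitive elements with the
convolution algebra. -/
noncomputable def envelopingEquiv : CompletedEnveloping K br ≃L[K] FormalSum K P where
  toFun := Ideal.Quotient.liftₐ (lieIdeal K br) (completedHom κ)
    fun _ h => completedHom_eq_zero_of_mem κ hbr h
  map_add' := map_add _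
  map_smul' := map_smul _
  invFun y := CompletedEnveloping.mk K br (sectionMap κ y)
  left_inv u := by
    obtain ⟨t, rfl⟩ := CompletedEnveloping.mk_surjective br u
    refine Ideal.Quotient.eq.2 (mem_lieIdeal_of_completedHom_eq_zero κ hbr ?_)
    rw [map_sub, completedHom_sectionMap]
    exact sub_self _
  right_inv y := completedHom_sectionMap κ y
  continuous_toFun := (CompletedEnveloping.continuous_iff br).2 (continuous_completedHom κ)
  continuous_invFun := (CompletedEnveloping.continuous_mk br).comp (continuous_sectionMap κ)

theorem envelopingEquiv_mk (t : CompletedTensorAlgebra K V) :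
    envelopingEquiv κ hbr (CompletedEnveloping.mk K br t) = completedHom κ t := rfl

theorem envelopingEquiv_ofTensorAlgebra (t : TensorAlgebra K V) :
    envelopingEquiv κ hbr (CompletedEnveloping.ofTensorAlgebra K br t) = tensorHom κ t :=
  completedHom_ofTensorAlgebra κ t

theorem envelopingEquiv_mul (s t : CompletedEnveloping K br) :
    envelopingEquiv κ hbr (s * t) = envelopingEquiv κ hbr s * envelopingEquiv κ hbr t := by
  obtain ⟨s, rfl⟩ := CompletedEnveloping.mk_surjective br s
  obtain ⟨t, rfl⟩ := CompletedEnveloping.mk_surjective br t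
  rw [← map_mul, envelopingEquiv_mk, envelopingEquiv_mk, envelopingEquiv_mk, map_mul]

theorem envelopingEquiv_one : envelopingEquiv κ hbr 1 = 1 := by
  rw [← map_one (CompletedEnveloping.mk K br), envelopingEquiv_mk, map_one]

end CombBialgebra

/-! ### Completed tensor products of spaces of formal sums -/

namespace Profinite.FormalSum

variable {K : Type u} [Field K] {α : Type v} {β : Type w}

theorem tensor_apply (f : α → β → K) (p : OpenSub K (FormalSum K α) × OpenSub K (FormalSum K β)) :
    (tensor f).1 p = ∑ᶠ c : α × β, f c.1 c.2 •
      (p.1.1.mkQ (single K c.1) ⊗ₜ[K] p.2.1.mkQ (single K c.2)) := rfl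

theorem tensor_apply_eq_sum (f : α → β → K)
    {p : OpenSub K (FormalSum K α) × OpenSub K (FormalSum K β)} {I : Finset α} {J : Finset β}
    (hI : ∀ a ∉ I, single K a ∈ p.1.1) (hJ : ∀ b ∉ J, single K b ∈ p.2.1) :
    (tensor f).1 p = ∑ c ∈ I ×ˢ J, f c.1 c.2 •
      (p.1.1.mkQ (single K c.1) ⊗ₜ[K] p.2.1.mkQ (single K c.2)) := by
  rw [tensor_apply]
  refine finsum_eq_sum_of_support_subset _ ?_
  rintro ⟨a, b⟩ hab
  rw [Finset.coe_product, Set.mem_prod]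
  refine ⟨?_, ?_⟩
  · by_contra ha
    refine hab ?_
    have : p.1.1.mkQ (single K a) = 0 := (Submodule.Quotient.mk_eq_zero _).2 (hI a ha)
    simp [this]
  · by_contra hb
    refine hab ?_
    have : p.2.1.mkQ (single K b) = 0 := (Submodule.Quotient.mk_eq_zero _).2 (hJ b hb)
    simp [this]

theorem exists_tensor_apply_eq_sum (p : OpenSub K (FormalSum K α) × OpenSub K (FormalSum K β)) :
    ∃ s : Finset (α × β), ∀ f : α → β → K, (tensor f).1 p = ∑ c ∈ s, f c.1 c.2 •
      (p.1.1.mkQ (single K c.1) ⊗ₜ[K] p.2.1.mkQ (single K c.2)) := by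
  obtain ⟨I, hI, -⟩ := exists_finset_sub_mem p.1
  obtain ⟨J, hJ, -⟩ := exists_finset_sub_mem p.2
  exact ⟨I ×ˢ J, fun f => tensor_apply_eq_sum f hI hJ⟩

theorem tensor_add (f g : α → β → K) :
    tensor (fun a b => f a b + g a b) = tensor f + tensor g := by
  refine Subtype.ext (funext fun p => ?_)
  obtain ⟨s, hs⟩ := exists_tensor_apply_eq_sum (K := K) p
  change _ = (tensor f).1 p + (tensor g).1 p
  rw [hs, hs, hs, ← Finset.sum_add_distrib]
  simp only [add_smul]

theorem tensor_smul (k : K) (f : α → β → K) :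
    tensor (fun a b => k * f a b) = k • tensor f := by
  refine Subtype.ext (funext fun p => ?_)
  obtain ⟨s, hs⟩ := exists_tensor_apply_eq_sum (K := K) p
  change _ = k • (tensor f).1 p
  rw [hs, hs, Finset.smul_sum]
  simp only [mul_smul]

/-- The open subspace of the formal sums without a given term. -/
noncomputable def evKer (a : α) : OpenSub K (FormalSum K α) :=
  ⟨(ev K a).ker, by
    let : TopologicalSpace K := ⊥
    have : DiscreteTopology K := ⟨rfl⟩
    exact (isOpen_discrete ({0} : Set K)).preimage (continuous_apply a)⟩

/-- A coefficient, as a linear form on the tensor product. -/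
noncomputable def evTensor (a : α) (b : β) : FormalSum K α ⊗[K] FormalSum K β →ₗ[K] K :=
  LinearMap.mul' K K ∘ₗ TensorProduct.map (ev K a) (ev K b)

theorem evTensor_tmul (a : α) (b : β) (x : FormalSum K α) (y : FormalSum K β) :
    evTensor a b (x ⊗ₜ y) = x a * y b := rfl

/-- The coefficient at `(a, b)` can be read off in the quotient by the kernels of the two
evaluations at `a` and at `b`. -/
theorem tensor_injective {f g : α → β → K} (h : tensor f = tensor g) (a : α) (b : β) :
    f a b = g a b := by
  let φ : (FormalSum K α ⧸ (evKer (K := K) a).1) ⊗[K] (FormalSum K β ⧸ (evKer (K := K) b).1) →ₗ[K] K :=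
    LinearMap.mul' K K ∘ₗ TensorProduct.map ((evKer (K := K) a).1.liftQ (ev K a) le_rfl)
      ((evKer (K := K) b).1.liftQ (ev K b) le_rfl)
  have key : ∀ f : α → β → K, φ ((tensor f).1 (evKer a, evKer b)) = f a b := by
    intro f
    obtain ⟨I, hI, -⟩ := exists_finset_sub_mem (evKer (K := K) a)
    obtain ⟨J, hJ, -⟩ := exists_finset_sub_mem (evKer (K := K) b)
    have haI : a ∈ I := by
      by_contra ha
      exact one_ne_zero ((single_self a).symm.trans (hI a ha : single K a a = 0))
    have hbJ : b ∈ J := by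
      by_contra hb
      exact one_ne_zero ((single_self b).symm.trans (hJ b hb : single K b b = 0))
    rw [tensor_apply_eq_sum f (p := (evKer a, evKer b)) hI hJ, map_sum,
      Finset.sum_eq_single_of_mem (a, b) (Finset.mk_mem_product haI hbJ)]
    · rw [map_smul]
      change f a b * (single K a a * single K b b) = _
      rw [single_self, single_self, mul_one, mul_one]
    · rintro ⟨c, d⟩ - hne
      rw [map_smul]
      change f c d * (single K c a * single K d b) = _
      by_cases hc : a = c
      · have hd : b ≠ d := by
          rintro rfl
          exact hne (by rw [hc])
        rw [single_of_ne hd, mul_zero, mul_zero]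
      · rw [single_of_ne hc, zero_mul, mul_zero]
  rw [← key f, ← key g, h]

/-- On a pure tensor, both factors become finite sums of basis vectors modulo the open subspaces,
and the product is expanded. -/
theorem ofTensor_eq_tensor (z : FormalSum K α ⊗[K] FormalSum K β) :
    CompletedTensor.ofTensor K (FormalSum K α) (FormalSum K β) z
      = tensor (fun a b => evTensor a b z) := by
  induction z using TensorProduct.induction_on with
  | zero =>
    rw [map_zero]
    have := tensor_smul (K := K) (α := α) (β := β) 0 0
    rw [zero_smul] at this
    rw [← this]
    congr 1
    funext a b
    simp
  | add x y hx hy =>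
    rw [map_add, hx, hy, ← tensor_add]
    simp only [map_add]
  | tmul x y =>
    refine Subtype.ext (funext fun p => ?_)
    obtain ⟨I, hI, hI'⟩ := exists_finset_sub_mem p.1
    obtain ⟨J, hJ, hJ'⟩ := exists_finset_sub_mem p.2
    rw [tensor_apply_eq_sum _ hI hJ]
    have hx : p.1.1.mkQ x = ∑ a ∈ I, x a • p.1.1.mkQ (single K a) := by
      have := (Submodule.Quotient.mk_eq_zero p.1.1).2 (hI' x)
      rw [← Submodule.mkQ_apply, map_sub, map_sum, sub_eq_zero] at this
      simpa only [map_smul] using this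
    have hy : p.2.1.mkQ y = ∑ b ∈ J, y b • p.2.1.mkQ (single K b) := by
      have := (Submodule.Quotient.mk_eq_zero p.2.1).2 (hJ' y)
      rw [← Submodule.mkQ_apply, map_sub, map_sum, sub_eq_zero] at this
      simpa only [map_smul] using this
    change p.1.1.mkQ x ⊗ₜ[K] p.2.1.mkQ y = _
    rw [hx, hy, TensorProduct.sum_tmul, Finset.sum_product]
    refine Finset.sum_congr rfl fun a _ => ?_
    rw [TensorProduct.tmul_sum]
    refine Finset.sum_congr rfl fun b _ => ?_
    rw [TensorProduct.smul_tmul_smul, evTensor_tmul]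

/-- This is how the weights enter the comparison of comultiplications: `j` sends basis vectors to
multiples of basis vectors, and the terms of `g` outside the image of `i` vanish. -/
theorem map_tensor {α' : Type*} (j : FormalSum K α →L[K] FormalSum K α') {i : α → α'}
    (hi : Function.Injective i) {s : α → K} (hj : ∀ a, j (single K a) = s a • single K (i a))
    {f : α → α → K} {g : α' → α' → K} (h : ∀ a b, g (i a) (i b) = s a * s b * f a b)
    (h0 : ∀ c d, g c d ≠ 0 → c ∈ Set.range i ∧ d ∈ Set.range i) :
    CompletedTensor.map j j (tensor f) = tensor g := by
  refine Subtype.ext (funext fun p => ?_)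
  obtain ⟨I, hI, -⟩ := exists_finset_sub_mem (p.1.comap j)
  obtain ⟨J, hJ, -⟩ := exists_finset_sub_mem (p.2.comap j)
  change TensorProduct.map _ _ ((tensor f).1 (p.1.comap j, p.2.comap j)) = _
  rw [tensor_apply_eq_sum f (p := (p.1.comap j, p.2.comap j)) hI hJ, map_sum, tensor_apply]
  have hi2 : Function.Injective (Prod.map i i) := hi.prodMap hi
  rw [finsum_eq_sum_of_support_subset (s := (I ×ˢ J).map ⟨_, hi2⟩), Finset.sum_map]
  · refine Finset.sum_congr rfl fun c _ => ?_
    rw [map_smul, TensorProduct.map_tmul]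
    change f c.1 c.2 • (p.1.1.mkQ (j (single K c.1)) ⊗ₜ[K] p.2.1.mkQ (j (single K c.2))) = _
    rw [hj, hj, map_smul, map_smul, TensorProduct.smul_tmul_smul, smul_smul]
    change _ = g (i c.1) (i c.2) • (p.1.1.mkQ (single K (i c.1)) ⊗ₜ[K] p.2.1.mkQ (single K (i c.2)))
    rw [h, mul_comm]
  · rintro ⟨c, d⟩ hcd
    have hg : g c d ≠ 0 := fun h => hcd (by simp [h])
    obtain ⟨⟨a, rfl⟩, ⟨b, rfl⟩⟩ := h0 c d hg
    rw [h] at hg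
    rw [Finset.coe_map]
    refine ⟨(a, b), ?_, rfl⟩
    rw [Finset.coe_product]
    constructor
    · by_contra ha
      refine hcd ?_
      have hmem : j (single K a) ∈ p.1.1 := hI a ha
      rw [hj] at hmem
      -- The weight can be cancelled, being a factor of the nonzero coefficient of `g`.
      have := (Submodule.smul_mem_iff _ (left_ne_zero_of_mul (left_ne_zero_of_mul hg))).1 hmem
      have : p.1.1.mkQ (single K (i a)) = 0 := (Submodule.Quotient.mk_eq_zero _).2 this
      simp [this]
    · by_contra hb
      refine hcd ?_
      have hmem : j (single K b) ∈ p.2.1 := hJ b hb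
      rw [hj] at hmem
      have := (Submodule.smul_mem_iff _ (right_ne_zero_of_mul (left_ne_zero_of_mul hg))).1 hmem
      have : p.2.1.mkQ (single K (i b)) = 0 := (Submodule.Quotient.mk_eq_zero _).2 this
      simp [this]

end Profinite.FormalSum

/-! ### The comultiplication of the convolution algebra -/

namespace CombBialgebra

variable {P : Type w} [CommMonoid P] [CombBialgebra P] {K : Type u} [Field K]

open FormalSum

variable (K P) in
/-- The comultiplication that is dual to the product of monomials. -/
noncomputable def comulHat : FormalSum K P →ₗ[K] CompletedTensor K (FormalSum K P) (FormalSum K P) where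
  toFun x := tensor fun a b => x (a * b)
  map_add' _ _ := tensor_add _ _
  map_smul' k _ := tensor_smul k _

theorem comulHat_apply (x : FormalSum K P) : comulHat P K x = tensor fun a b => x (a * b) := rfl

variable (K P) in
theorem continuous_comulHat : Continuous (comulHat P K) := by
  refine CompletedTensor.continuous_iff.2 fun p => ?_
  obtain ⟨s, hs⟩ := exists_tensor_apply_eq_sum (K := K) p
  simp only [comulHat_apply, hs]
  let _ : TopologicalSpace K := ⊥
  let _ : TopologicalSpace ((FormalSum K P ⧸ p.1.1) ⊗[K] (FormalSum K P ⧸ p.2.1)) := ⊥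
  have : DiscreteTopology K := ⟨rfl⟩
  have : DiscreteTopology ((FormalSum K P ⧸ p.1.1) ⊗[K] (FormalSum K P ⧸ p.2.1)) := ⟨rfl⟩
  refine continuous_finsetSum _ fun c _ => ?_
  exact (continuous_of_discreteTopology (f := fun k : K => k •
    (p.1.1.mkQ (single K c.1) ⊗ₜ[K] p.2.1.mkQ (single K c.2)))).comp
    (FormalSum.continuous_apply (c.1 * c.2))

/-- Comparing the coefficients at `(a, b)` gives exactly the Leibniz rule for `x`. -/
theorem comulHat_eq_iff (x : FormalSum K P) :
    comulHat P K x = CompletedTensor.ofTensor K _ _ (x ⊗ₜ 1 + 1 ⊗ₜ x) ↔ IsPrim (x : P → K) := by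
  rw [ofTensor_eq_tensor, comulHat_apply]
  constructor
  · intro h a b
    have := tensor_injective h a b
    rwa [map_add, evTensor_tmul, evTensor_tmul] at this
  · intro h
    congr 1
    funext a b
    rw [map_add, evTensor_tmul, evTensor_tmul, h]
    rfl

theorem evTensor_tmul_one_mul (x : FormalSum K P) (z : FormalSum K P ⊗[K] FormalSum K P) (a b : P) :
    evTensor a b ((x ⊗ₜ 1) * z) = conv x (fun c => evTensor c b z) a := by
  induction z using TensorProduct.induction_on with
  | zero => simp [conv]
  | add y z hy hz => simp only [mul_add, map_add, hy, hz, conv, Multiset.sum_map_add]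
  | tmul y z =>
    simp only [Algebra.TensorProduct.tmul_mul_tmul, one_mul, evTensor_tmul, mul_apply, conv,
      ← mul_assoc, Multiset.sum_map_mul_right]

theorem evTensor_one_tmul_mul (x : FormalSum K P) (z : FormalSum K P ⊗[K] FormalSum K P) (a b : P) :
    evTensor a b ((1 ⊗ₜ x) * z) = conv x (fun c => evTensor a c z) b := by
  induction z using TensorProduct.induction_on with
  | zero => simp [conv]
  | add y z hy hz => simp only [mul_add, map_add, hy, hz, conv, Multiset.sum_map_add]
  | tmul y z =>
    simp only [Algebra.TensorProduct.tmul_mul_tmul, one_mul, evTensor_tmul, mul_apply, conv,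
      mul_left_comm _ (y a), Multiset.sum_map_mul_left]

variable {V : Type v} [AddCommGroup V] [Module K V] [TopologicalSpace V]
variable (κ : V ≃L[K] FormalSum K (Conn P))

/-- Induction over products of vectors. Multiplication by `v ⊗ 1 + 1 ⊗ v` acts on coefficients by
convolution in the first and in the second variable, and `IsPrim.conv_mul` says that this is how a
further primitive factor acts on the value at a product. -/
theorem tensorHom_apply_mul (t : TensorAlgebra K V) (a b : P) : tensorHom κ t (a * b)
    = evTensor a b (TensorProduct.map (tensorHom κ).toLinearMap (tensorHom κ).toLinearMap
        (CompletedEnveloping.tensorComul K V t)) := by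
  let Λ₂ : TensorAlgebra K V →ₐ[K] FormalSum K P ⊗[K] FormalSum K P :=
    (Algebra.TensorProduct.map (tensorHom κ) (tensorHom κ)).comp
      (CompletedEnveloping.tensorComul K V)
  have hΛ : ∀ v, Λ₂ (TensorAlgebra.ι K v) = incl κ v ⊗ₜ 1 + 1 ⊗ₜ incl κ v := fun v => by
    simp [Λ₂, CompletedEnveloping.tensorComul, tensorHom_ι]
  have key : ∀ (l : List V) (a b : P), tensorHom κ (l.map (TensorAlgebra.ι K)).prod (a * b)
      = evTensor a b (Λ₂ (l.map (TensorAlgebra.ι K)).prod) := by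
    intro l
    induction l with
    | nil =>
      intro a b
      rw [List.map_nil, List.prod_nil, map_one, map_one, Algebra.TensorProduct.one_def,
        evTensor_tmul]
      by_cases ha : a = 1
      · rw [ha, one_mul, one_apply_one, one_mul]
      · rw [one_apply_of_ne ha, zero_mul, one_apply_of_ne fun h => ha (mul_eq_one.1 h).1]
    | cons v l ih =>
      intro a b
      rw [List.map_cons, List.prod_cons, map_mul, map_mul, hΛ, tensorHom_ι, add_mul, map_add,
        evTensor_tmul_one_mul, evTensor_one_tmul_mul]
      refine ((isPrim_incl κ v).conv_mul _ a b).trans ?_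
      simp only [ih]
  have h : ev K (a * b) ∘ₗ (tensorHom κ).toLinearMap = evTensor a b ∘ₗ Λ₂.toLinearMap :=
    tensorAlgebra_linearMap_ext fun l => key l a b
  exact LinearMap.congr_fun h t

theorem comulHat_tensorHom (t : TensorAlgebra K V) : comulHat P K (tensorHom κ t)
    = CompletedTensor.ofTensor K _ _ (TensorProduct.map (tensorHom κ).toLinearMap
        (tensorHom κ).toLinearMap (CompletedEnveloping.tensorComul K V t)) := by
  rw [ofTensor_eq_tensor, comulHat_apply]
  simp only [← tensorHom_apply_mul]

theorem tensorHom_apply_one (t : TensorAlgebra K V) :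
    tensorHom κ t 1 = TensorAlgebra.algebraMapInv t := by
  let ε : FormalSum K P →ₐ[K] K := AlgHom.ofLinearMap (ev K 1) one_apply_one mul_apply_one
  have : ε.comp (tensorHom κ) = TensorAlgebra.algebraMapInv := by
    refine TensorAlgebra.hom_ext (LinearMap.ext fun v => ?_)
    simp only [LinearMap.comp_apply, AlgHom.toLinearMap_apply, AlgHom.comp_apply, tensorHom_ι,
      TensorAlgebra.algebraMapInv, TensorAlgebra.lift_ι_apply, LinearMap.zero_apply]
    exact (isPrim_incl κ v).apply_one
  exact DFunLike.congr_fun this t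

end CombBialgebra

namespace CK

/-! ### Graphs with legs, and their subquotients -/

theorem eqvGen_le {A : Type*} {r : A → A → Prop} {s : Setoid A} (h : ∀ a b, r a b → s a b) {a b : A}
    (hab : Relation.EqvGen.setoid r a b) : s a b := by
  induction hab with
  | rel x y hxy => exact h x y hxy
  | refl x => exact s.refl x
  | symm x y _ ih => exact s.symm ih
  | trans x y z _ _ ih₁ ih₂ => exact s.trans ih₁ ih₂

theorem eqvGen_map {A B : Type*} {r : A → A → Prop} {s : B → B → Prop} (f : A → B)
    (h : ∀ a b, r a b → Relation.EqvGen.setoid s (f a) (f b)) {a b : A}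
    (hab : Relation.EqvGen.setoid r a b) : Relation.EqvGen.setoid s (f a) (f b) :=
  eqvGen_le (s := (Relation.EqvGen.setoid s).comap f) h hab

theorem eqvGen_sum {A B : Type} {r : A → A → Prop} {s : B → B → Prop} {t : A ⊕ B → A ⊕ B → Prop}
    (ht : ∀ a b, t a b ↔ Sum.LiftRel r s a b) (a b : A ⊕ B) : Relation.EqvGen.setoid t a b ↔
      Graph.sumSetoid (Relation.EqvGen.setoid r) (Relation.EqvGen.setoid s) a b := by
  constructor
  · refine eqvGen_le fun a b h => ?_
    cases (ht a b).1 h with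
    | inl h' => exact .inl (.rel _ _ h')
    | inr h' => exact .inr (.rel _ _ h')
  · rintro (h | h)
    · exact eqvGen_map Sum.inl (fun a b h => .rel _ _ ((ht _ _).2 (.inl h))) h
    · exact eqvGen_map Sum.inr (fun a b h => .rel _ _ ((ht _ _).2 (.inr h))) h

/-- A finite graph with legs: the legs are the half-edges that `edge` fixes. -/
structure LegGraph where
  /-- the half-edges -/
  H : Type
  finite : Finite H
  /-- the other half of an edge -/
  edge : H → H
  edge_edge : ∀ h, edge (edge h) = h
  /-- lying on the same vertex -/
  vert : Setoid H

namespace LegGraph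

attribute [instance] LegGraph.finite

/-- A set of edges, given by their half-edges. -/
@[ext] structure Sub (G : LegGraph) where
  /-- the half-edges -/
  S : Set G.H
  edge_mem : ∀ h ∈ S, G.edge h ∈ S
  edge_ne : ∀ h ∈ S, G.edge h ≠ h

variable {G : LegGraph}

theorem Sub.edge_notMem (γ : G.Sub) {h : G.H} (hh : h ∉ γ.S) : G.edge h ∉ γ.S :=
  fun h' => hh (G.edge_edge h ▸ γ.edge_mem _ h')

instance : PartialOrder G.Sub :=
  PartialOrder.lift Sub.S fun _ _ h => Sub.ext h

instance : BoundedOrder G.Sub where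
  top := ⟨{h | G.edge h ≠ h}, fun h hh e => hh (by
    rwa [G.edge_edge, eq_comm] at e), fun _ h => h⟩
  le_top γ := γ.edge_ne
  bot := ⟨∅, fun _ h => h.elim, fun _ h => h.elim⟩
  bot_le _ := Set.empty_subset _

theorem Sub.notMem_bot {h : G.H} : h ∉ (⊥ : G.Sub).S := fun h => h

instance : Finite G.Sub := Finite.of_injective Sub.S fun _ _ h => Sub.ext h

noncomputable instance : Fintype G.Sub := Fintype.ofFinite _

/-- Lying on vertices that become equal when the edges of `δ` are contracted. -/
def cvert (δ : G.Sub) : Setoid G.H :=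
  Relation.EqvGen.setoid fun a b => G.vert a b ∨ (a ∈ δ.S ∧ b = G.edge a)

theorem cvert_of_vert (δ : G.Sub) {a b : G.H} (h : G.vert a b) : cvert δ a b := .rel _ _ (.inl h)

theorem cvert_edge (δ : G.Sub) {a : G.H} (h : a ∈ δ.S) : cvert δ a (G.edge a) :=
  .rel _ _ (.inr ⟨h, rfl⟩)

theorem cvert_bot {a b : G.H} : cvert (⊥ : G.Sub) a b ↔ G.vert a b := by
  refine ⟨eqvGen_le fun a b h => ?_, cvert_of_vert _⟩
  rcases h with h | h
  · exact h
  · exact absurd h.1 Sub.notMem_bot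

open Classical in
/-- The graph `γ / δ`: the edges are those of `γ` that do not belong to `δ`, the edges of `δ` are
contracted, the other edges are cut, and the vertices without edges are dropped. -/
noncomputable def quot (δ γ : G.Sub) : LegGraph where
  H := {h : G.H // h ∉ δ.S ∧ ∃ k ∈ γ.S, k ∉ δ.S ∧ cvert δ h k}
  finite := inferInstance
  edge h := if hγ : h.1 ∈ γ.S then ⟨G.edge h.1, δ.edge_notMem h.2.1, G.edge h.1, γ.edge_mem _ hγ,
    δ.edge_notMem h.2.1, (cvert δ).refl _⟩ else h
  edge_edge h := by
    by_cases hγ : h.1 ∈ γ.S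
    · simp [hγ, γ.edge_mem _ hγ, G.edge_edge]
    · simp [hγ]
  vert := (cvert δ).comap Subtype.val

theorem quot_edge_of_mem {δ γ : G.Sub} {h : (quot δ γ).H} (hγ : h.1 ∈ γ.S) :
    ((quot δ γ).edge h).1 = G.edge h.1 := by simp [quot, hγ]

theorem quot_edge_of_notMem {δ γ : G.Sub} {h : (quot δ γ).H} (hγ : h.1 ∉ γ.S) :
    (quot δ γ).edge h = h := dif_neg hγ

theorem quot_edge_ne_iff {δ γ : G.Sub} (h : (quot δ γ).H) :
    (quot δ γ).edge h ≠ h ↔ h.1 ∈ γ.S := by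
  by_cases hγ : h.1 ∈ γ.S
  · refine iff_of_true (fun e => γ.edge_ne _ hγ ?_) hγ
    rw [← quot_edge_of_mem hγ, e]
  · exact iff_of_false (not_not.2 (quot_edge_of_notMem hγ)) hγ

/-- An isomorphism of graphs with legs. -/
structure Iso (G G' : LegGraph) where
  toEquiv : G.H ≃ G'.H
  map_edge : ∀ h, toEquiv (G.edge h) = G'.edge (toEquiv h)
  map_vert : ∀ a b, G.vert a b ↔ G'.vert (toEquiv a) (toEquiv b)

/-- An embedding of a graph as a part of the graph that arises by the contraction of `δ₀`, which
contains all the vertices of the edges in it. -/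
structure Emb (G' G : LegGraph) (δ₀ : G.Sub) where
  i : G'.H → G.H
  inj : Function.Injective i
  vert_iff : ∀ a b, G'.vert a b ↔ cvert δ₀ (i a) (i b)
  map_edge : ∀ a, G'.edge a ≠ a → i (G'.edge a) = G.edge (i a)
  notMem : ∀ a, i a ∉ δ₀.S
  mem_range : ∀ h k, h ∉ δ₀.S → G'.edge k ≠ k → cvert δ₀ h (i k) → h ∈ Set.range i

namespace Emb

variable {G' : LegGraph} {δ₀ : G.Sub} (e : Emb G' G δ₀)

/-- The edges of `δ₀` together with the images of a set of edges. -/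
def sub (ρ : G'.Sub) : G.Sub where
  S := δ₀.S ∪ e.i '' ρ.S
  edge_mem := by
    rintro h (hh | ⟨a, ha, rfl⟩)
    · exact Or.inl (δ₀.edge_mem h hh)
    · exact Or.inr ⟨_, ρ.edge_mem a ha, e.map_edge a (ρ.edge_ne a ha)⟩
  edge_ne := by
    rintro h (hh | ⟨a, ha, rfl⟩) heq
    · exact δ₀.edge_ne h hh heq
    · rw [← e.map_edge a (ρ.edge_ne a ha)] at heq
      exact ρ.edge_ne a ha (e.inj heq)

theorem mem_sub (ρ : G'.Sub) (a : G'.H) : e.i a ∈ (e.sub ρ).S ↔ a ∈ ρ.S := by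
  refine ⟨?_, fun h => Or.inr ⟨a, h, rfl⟩⟩
  rintro (h | ⟨b, hb, hba⟩)
  · exact absurd h (e.notMem a)
  · rwa [← e.inj hba]

theorem sub_le_sub {ρ ρ' : G'.Sub} : e.sub ρ ≤ e.sub ρ' ↔ ρ ≤ ρ' := by
  refine ⟨fun h a ha => ?_, fun h => ?_⟩
  · exact (e.mem_sub ρ' a).1 (h ((e.mem_sub ρ a).2 ha))
  · exact Set.union_subset_union_right _ (Set.image_mono h)

theorem sub_injective : Function.Injective e.sub := fun _ _ h =>
  le_antisymm (e.sub_le_sub.1 h.le) (e.sub_le_sub.1 h.ge)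

theorem sub_bot : e.sub ⊥ = δ₀ := by
  refine Sub.ext ?_
  change δ₀.S ∪ e.i '' ∅ = _
  simp

/-- Outside `δ₀` the set `γ` consists of half-edges in the image, so it can be pulled back. With
`sub_le_sub` this identifies intervals of edge sets, over which coproducts are summed. -/
theorem exists_sub_eq {ρ₁ ρ₂ : G'.Sub} {γ : G.Sub} (h₁ : e.sub ρ₁ ≤ γ) (h₂ : γ ≤ e.sub ρ₂) :
    ∃ ρ, ρ₁ ≤ ρ ∧ ρ ≤ ρ₂ ∧ e.sub ρ = γ := by
  have hint : ∀ a, e.i a ∈ γ.S → a ∈ ρ₂.S := fun a ha => (e.mem_sub ρ₂ a).1 (h₂ ha)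
  let ρ : G'.Sub := ⟨e.i ⁻¹' γ.S, fun a ha => by
    change e.i _ ∈ γ.S
    rw [e.map_edge a (ρ₂.edge_ne a (hint a ha))]
    exact γ.edge_mem _ ha, fun a ha => ρ₂.edge_ne a (hint a ha)⟩
  refine ⟨ρ, fun a ha => h₁ ((e.mem_sub ρ₁ a).2 ha), hint, Sub.ext (Set.Subset.antisymm ?_ ?_)⟩
  · rintro h (hh | ⟨a, ha, rfl⟩)
    · exact h₁ (Or.inl hh)
    · exact ha
  · intro h hh
    rcases h₂ hh with h' | ⟨a, -, rfl⟩
    · exact Or.inl h'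
    · exact Or.inr ⟨a, hh, rfl⟩

theorem cvert_mono {γ δ : G.Sub} (h : γ ≤ δ) {a b : G.H} (hab : cvert γ a b) : cvert δ a b := by
  refine eqvGen_le (s := cvert δ) (fun a b hab => ?_) hab
  rcases hab with hab | ⟨ha, rfl⟩
  · exact cvert_of_vert _ hab
  · exact cvert_edge _ (h ha)

theorem cvert_sub_of {ρ : G'.Sub} {a b : G'.H} (h : cvert ρ a b) :
    cvert (e.sub ρ) (e.i a) (e.i b) := by
  have hle : δ₀ ≤ e.sub ρ := fun _ h => Or.inl h
  refine eqvGen_map e.i (fun a b h => ?_) h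
  rcases h with h | ⟨ha, rfl⟩
  · exact cvert_mono hle ((e.vert_iff a b).1 h)
  · rw [e.map_edge a (ρ.edge_ne a ha)]
    exact cvert_edge _ (Or.inr ⟨a, ha, rfl⟩)

/-- A path in the contracted graph is trivial outside the embedded graph. -/
theorem cvert_sub_cases {ρ : G'.Sub} {h k : G.H} (hhk : cvert (e.sub ρ) h k) :
    cvert δ₀ h k ∨ ∃ a b, G'.edge a ≠ a ∧ G'.edge b ≠ b ∧ cvert δ₀ h (e.i a) ∧ cvert ρ a b ∧
      cvert δ₀ (e.i b) k := by
  induction hhk with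
  | rel x y h =>
    rcases h with h | ⟨h | ⟨a, ha, rfl⟩, rfl⟩
    · exact Or.inl (cvert_of_vert _ h)
    · exact Or.inl (cvert_edge _ h)
    · refine Or.inr ⟨a, G'.edge a, ρ.edge_ne a ha, ρ.edge_ne _ (ρ.edge_mem a ha),
        (cvert δ₀).refl _, cvert_edge _ ha, ?_⟩
      rw [e.map_edge a (ρ.edge_ne a ha)]
  | refl x => exact Or.inl ((cvert δ₀).refl x)
  | symm x y _ ih =>
    rcases ih with h | ⟨a, b, ha, hb, h1, h2, h3⟩
    · exact Or.inl ((cvert δ₀).symm h)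
    · exact Or.inr ⟨b, a, hb, ha, (cvert δ₀).symm h3, (cvert ρ).symm h2, (cvert δ₀).symm h1⟩
  | trans x y z _ _ ih₁ ih₂ =>
    rcases ih₁ with h | ⟨a, b, ha, hb, h1, h2, h3⟩
    · rcases ih₂ with h' | ⟨a', b', ha', hb', h1', h2', h3'⟩
      · exact Or.inl ((cvert δ₀).trans h h')
      · exact Or.inr ⟨a', b', ha', hb', (cvert δ₀).trans h h1', h2', h3'⟩
    · rcases ih₂ with h' | ⟨a', b', ha', hb', h1', h2', h3'⟩
      · exact Or.inr ⟨a, b, ha, hb, h1, h2, (cvert δ₀).trans h3 h'⟩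
      · have : G'.vert b a' := (e.vert_iff _ _).2 ((cvert δ₀).trans h3 h1')
        exact Or.inr ⟨a, b', ha, hb', h1,
          (cvert ρ).trans h2 ((cvert ρ).trans (cvert_of_vert _ this) h2'), h3'⟩

/-- Contraction in stages: contracting `δ₀` first and then `ρ` identifies the same vertices as
contracting both together. -/
theorem cvert_sub_iff {ρ : G'.Sub} {a b : G'.H} :
    cvert (e.sub ρ) (e.i a) (e.i b) ↔ cvert ρ a b := by
  refine ⟨fun h => ?_, e.cvert_sub_of⟩
  rcases e.cvert_sub_cases h with h | ⟨c, d, -, -, h1, h2, h3⟩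
  · exact cvert_of_vert _ ((e.vert_iff _ _).2 h)
  · exact (cvert ρ).trans (cvert_of_vert _ ((e.vert_iff _ _).2 h1))
      ((cvert ρ).trans h2 (cvert_of_vert _ ((e.vert_iff _ _).2 h3)))

/-- The map of subquotients that an embedding induces. -/
def quotFun (ρ ρ' : G'.Sub) (a : (quot ρ ρ').H) : (quot (e.sub ρ) (e.sub ρ')).H :=
  ⟨e.i a.1, fun h => a.2.1 ((e.mem_sub _ _).1 h), by
    obtain ⟨k, hk, hk', hc⟩ := a.2.2
    exact ⟨e.i k, (e.mem_sub _ _).2 hk, fun h => hk' ((e.mem_sub _ _).1 h), e.cvert_sub_of hc⟩⟩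

/-- Surjectivity is where dropping the vertices without edges matters: a remaining half-edge is
joined to an edge of the embedded graph, and by `cvert_sub_cases` it is then already joined by `δ₀`
to a vertex with such an edge, hence lies in the image. -/
theorem quotFun_bijective (ρ ρ' : G'.Sub) : Function.Bijective (e.quotFun ρ ρ') := by
  refine ⟨fun a b h => Subtype.ext (e.inj (congrArg Subtype.val h)), ?_⟩
  rintro ⟨h, hh, k, hk, hk', hc⟩
  obtain ⟨k, hkρ, rfl⟩ : ∃ a ∈ ρ'.S, e.i a = k := by
    rcases hk with hk | hk
    · exact absurd (Or.inl hk) hk'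
    · exact hk
  have hδ : h ∉ δ₀.S := fun h' => hh (Or.inl h')
  obtain ⟨a, rfl⟩ : h ∈ Set.range e.i := by
    rcases e.cvert_sub_cases hc with h1 | ⟨a, b, ha, -, h1, -, -⟩
    · exact e.mem_range _ k hδ (ρ'.edge_ne k hkρ) h1
    · exact e.mem_range _ a hδ ha h1
  exact ⟨⟨a, fun h => hh ((e.mem_sub _ _).2 h), k, hkρ, fun h => hk' ((e.mem_sub _ _).2 h),
    e.cvert_sub_iff.1 hc⟩, rfl⟩

/-- The subquotients of an embedded graph. -/
noncomputable def quotIso (ρ ρ' : G'.Sub) : Iso (quot ρ ρ') (quot (e.sub ρ) (e.sub ρ')) where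
  toEquiv := Equiv.ofBijective _ (e.quotFun_bijective ρ ρ')
  map_edge a := by
    change e.quotFun ρ ρ' _ = (quot _ _).edge (e.quotFun ρ ρ' a)
    by_cases ha : a.1 ∈ ρ'.S
    · refine Subtype.ext ?_
      have ha' : (e.quotFun ρ ρ' a).1 ∈ (e.sub ρ').S := (e.mem_sub _ _).2 ha
      rw [quot_edge_of_mem ha']
      change e.i ((quot ρ ρ').edge a).1 = G.edge (e.i a.1)
      rw [quot_edge_of_mem ha, e.map_edge _ (ρ'.edge_ne _ ha)]
    · have ha' : (e.quotFun ρ ρ' a).1 ∉ (e.sub ρ').S := fun h => ha ((e.mem_sub _ _).1 h)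
      rw [quot_edge_of_notMem ha, quot_edge_of_notMem ha']
  map_vert a b := e.cvert_sub_iff.symm

end Emb

/-- A subquotient is embedded in the graph. -/
noncomputable def quotEmb (δ γ : G.Sub) : Emb (quot δ γ) G δ where
  i := Subtype.val
  inj := Subtype.val_injective
  vert_iff _ _ := Iff.rfl
  map_edge a ha := quot_edge_of_mem ((quot_edge_ne_iff a).1 ha)
  notMem a := a.2.1
  mem_range h k hh hk hc := ⟨⟨h, hh, k.1, (quot_edge_ne_iff k).1 hk, k.2.1, hc⟩, rfl⟩

theorem quotEmb_sub_top {δ γ : G.Sub} (h : δ ≤ γ) : (quotEmb δ γ).sub ⊤ = γ := by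
  refine Sub.ext (Set.Subset.antisymm ?_ ?_)
  · rintro x (hx | ⟨a, ha, rfl⟩)
    · exact h hx
    · exact (quot_edge_ne_iff a).1 ha
  · intro x hx
    by_cases hδ : x ∈ δ.S
    · exact Or.inl hδ
    · exact Or.inr ⟨⟨x, hδ, x, hx, hδ, (cvert δ).refl x⟩, (quot_edge_ne_iff _).2 hx, rfl⟩

end LegGraph

end CK

namespace CK

/-! ### Graphs and graphs with legs -/

namespace Graph

/-- A bijection of half-edges that preserves the structure is an isomorphism. -/
noncomputable def Iso.ofBijective {Γ Γ' : Graph} (f : Γ.H → Γ'.H) (hf : Function.Bijective f)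
    (map_edge : ∀ h, f (Γ.edge h) = Γ'.edge (f h))
    (map_vert : ∀ h₁ h₂, Γ.vert h₁ h₂ ↔ Γ'.vert (f h₁) (f h₂))
    (map_ext : ∀ h, h ∈ Γ.ext ↔ f h ∈ Γ'.ext) : Iso Γ Γ' :=
  ⟨Equiv.ofBijective f hf, map_edge, map_vert, map_ext⟩

theorem Iso.isInternal_iff {Γ Γ' : Graph} (f : Iso Γ Γ') (h : Γ.H) :
    Γ.IsInternal h ↔ Γ'.IsInternal (f.toEquiv h) := by
  rw [IsInternal, IsInternal, f.map_ext, f.map_ext, f.map_edge]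

theorem Iso.conn {Γ Γ' : Graph} (f : Iso Γ Γ') {a b : Γ.H} (h : Γ.conn a b) :
    Γ'.conn (f.toEquiv a) (f.toEquiv b) := by
  refine eqvGen_map f.toEquiv (fun a b h => .rel _ _ ?_) h
  rcases h with h | rfl
  · exact Or.inl ((f.map_vert _ _).1 h)
  · exact Or.inr (f.map_edge _)

theorem Iso.isPlus {Γ Γ' : Graph} (f : Iso Γ Γ') (h : Γ.IsPlus) : Γ'.IsPlus := by
  intro a
  obtain ⟨k, hk, hk'⟩ := h (f.toEquiv.symm a)
  have := f.conn hk
  rw [Equiv.apply_symm_apply] at this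
  exact ⟨_, this, (f.isInternal_iff k).1 hk'⟩

variable (Γ : Graph)

theorem isInternal_edge {h : Γ.H} (hh : Γ.IsInternal h) : Γ.IsInternal (Γ.edge h) :=
  ⟨hh.2, by rw [Γ.edge_edge]; exact hh.1⟩

theorem conn_vert {a b : Γ.H} (h : Γ.vert a b) : Γ.conn a b := .rel _ _ (.inl h)

theorem union_conn (Γ' : Graph) (a b : (Γ.union Γ').H) :
    (Γ.union Γ').conn a b ↔ sumSetoid Γ.conn Γ'.conn a b := by
  refine eqvGen_sum (fun a b => ?_) a b
  constructor
  · rintro (h | rfl)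
    · cases h with
      | inl h => exact .inl (.inl h)
      | inr h => exact .inr (.inl h)
    · rcases a with a | a
      · exact .inl (.inr rfl)
      · exact .inr (.inr rfl)
  · rintro (⟨h | rfl⟩ | ⟨h | rfl⟩)
    · exact Or.inl (.inl h)
    · exact Or.inr rfl
    · exact Or.inl (.inr h)
    · exact Or.inr rfl

theorem union_isPlus_iff (Γ' : Graph) : (Γ.union Γ').IsPlus ↔ Γ.IsPlus ∧ Γ'.IsPlus := by
  constructor
  · refine fun h => ⟨fun a => ?_, fun a => ?_⟩
    · obtain ⟨k | k, hk, hk'⟩ := h (.inl a)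
      · exact ⟨k, Sum.liftRel_inl_inl.1 ((union_conn _ _ _ _).1 hk), hk'⟩
      · exact absurd ((union_conn _ _ _ _).1 hk) Sum.not_liftRel_inl_inr
    · obtain ⟨k | k, hk, hk'⟩ := h (.inr a)
      · exact absurd ((union_conn _ _ _ _).1 hk) Sum.not_liftRel_inr_inl
      · exact ⟨k, Sum.liftRel_inr_inr.1 ((union_conn _ _ _ _).1 hk), hk'⟩
  · rintro ⟨h, h'⟩ (a | a)
    · obtain ⟨k, hk, hk'⟩ := h a
      exact ⟨.inl k, (union_conn _ _ _ _).2 (.inl hk), hk'⟩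
    · obtain ⟨k, hk, hk'⟩ := h' a
      exact ⟨.inr k, (union_conn _ _ _ _).2 (.inr hk), hk'⟩

variable {Γ}

/-- If the vertex of `h` met no internal edge, all its edges would end in external vertices. This
star would be the whole component, which would have no internal edge. -/
theorem IsPlus.exists_vert (hΓ : Γ.IsPlus) {h : Γ.H} (hh : h ∉ Γ.ext) :
    ∃ k, Γ.IsInternal k ∧ Γ.vert h k := by
  by_contra! hno
  have hext : ∀ a, Γ.vert h a → Γ.edge a ∈ Γ.ext := by
    intro a ha
    by_contra he
    refine hno a ⟨fun hea => ?_, he⟩ ha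
    have := Γ.univalent a hea h (Γ.vert.symm ha)
    exact hh (this ▸ hea)
  -- The half-edges of the star, in the centre or at the tips, form a set that is closed under
  -- connectedness.
  have key : ∀ a b, Γ.conn a b → (Γ.vert h a ∨ Γ.vert h (Γ.edge a) ↔
      Γ.vert h b ∨ Γ.vert h (Γ.edge b)) := by
    intro a b hab
    induction hab with
    | refl => rfl
    | symm _ _ _ ih => exact ih.symm
    | trans _ _ _ _ _ ih₁ ih₂ => exact ih₁.trans ih₂
    | rel a b hab =>
      rcases hab with hab | rfl
      · have : ∀ a b, Γ.vert a b → (Γ.vert h a ∨ Γ.vert h (Γ.edge a)) →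
            (Γ.vert h b ∨ Γ.vert h (Γ.edge b)) := by
          rintro a b hab (h1 | h1)
          · exact Or.inl (Γ.vert.trans h1 hab)
          · have := hext _ h1
            rw [Γ.edge_edge] at this
            rw [Γ.univalent a this b hab]
            exact Or.inr h1
        exact ⟨this a b hab, this b a (Γ.vert.symm hab)⟩
      · rw [Γ.edge_edge, or_comm]
  obtain ⟨k, hk, hk'⟩ := hΓ h
  rcases (key h k hk).1 (Or.inl (Γ.vert.refl h)) with h1 | h1
  · exact hno k hk' h1
  · exact hno _ (Γ.isInternal_edge hk') h1

/-- An edge with two external ends is a component of its own, and it has no internal edge. -/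
theorem IsPlus.edge_notMem_ext (hΓ : Γ.IsPlus) {h : Γ.H} (hh : h ∈ Γ.ext) : Γ.edge h ∉ Γ.ext := by
  intro he
  have key : ∀ a b, Γ.conn a b → (a = h ∨ a = Γ.edge h ↔ b = h ∨ b = Γ.edge h) := by
    intro a b hab
    induction hab with
    | refl => rfl
    | symm _ _ _ ih => exact ih.symm
    | trans _ _ _ _ _ ih₁ ih₂ => exact ih₁.trans ih₂
    | rel a b hab =>
      rcases hab with hab | rfl
      · have : ∀ a b, Γ.vert a b → (a = h ∨ a = Γ.edge h) → b = h ∨ b = Γ.edge h := by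
          rintro a b hab (rfl | rfl)
          · exact Or.inl (Γ.univalent _ hh _ hab)
          · exact Or.inr (Γ.univalent _ he _ hab)
        exact ⟨this a b hab, this b a (Γ.vert.symm hab)⟩
      · constructor
        · rintro (rfl | rfl)
          · exact Or.inr rfl
          · exact Or.inl (Γ.edge_edge _)
        · rintro (h1 | h1)
          · right; rw [← h1, Γ.edge_edge]
          · left; rw [← Γ.edge_edge a, h1, Γ.edge_edge]
  obtain ⟨k, hk, hk'⟩ := hΓ h
  rcases (key h k hk).1 (Or.inl rfl) with rfl | rfl
  · exact hk'.1 hh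
  · exact hk'.1 he

variable (Γ)

open Classical in
/-- The graph whose edges are the internal edges of a graph, all the other half-edges being legs. -/
noncomputable def toLeg : LegGraph where
  H := Γ.H
  finite := inferInstance
  edge h := if Γ.IsInternal h then Γ.edge h else h
  edge_edge h := by
    by_cases hh : Γ.IsInternal h
    · simp [hh, Γ.isInternal_edge hh, Γ.edge_edge]
    · simp [hh]
  vert := Γ.vert

theorem toLeg_edge_of_internal {h : Γ.H} (hh : Γ.IsInternal h) : Γ.toLeg.edge h = Γ.edge h :=
  if_pos hh

theorem toLeg_edge_of_not {h : Γ.H} (hh : ¬ Γ.IsInternal h) : Γ.toLeg.edge h = h :=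
  if_neg hh

theorem toLeg_edge_ne_iff {h : Γ.H} : Γ.toLeg.edge h ≠ h ↔ Γ.IsInternal h := by
  by_cases hh : Γ.IsInternal h
  · refine iff_of_true ?_ hh
    rw [Γ.toLeg_edge_of_internal hh]
    exact Γ.edge_ne h
  · exact iff_of_false (not_not.2 (Γ.toLeg_edge_of_not hh)) hh

end Graph

namespace LegGraph

variable (G : LegGraph)

open Classical in
/-- The graph in which every leg is completed to an external edge. -/
noncomputable def complete : Graph where
  H := G.H ⊕ {h : G.H // G.edge h = h}
  finite := inferInstance
  edge := Sum.elim (fun h => if hh : G.edge h = h then .inr ⟨h, hh⟩ else .inl (G.edge h))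
    fun h => .inl h.1
  edge_edge := by
    rintro (h | ⟨h, hh⟩)
    · by_cases hh : G.edge h = h
      · simp [hh]
      · have : G.edge (G.edge h) ≠ G.edge h := fun e => hh (by rwa [G.edge_edge, eq_comm] at e)
        simp only [Sum.elim_inl, dif_neg hh, dif_neg this]
        exact congrArg Sum.inl (G.edge_edge h)
    · simp [hh]
  edge_ne := by
    rintro (h | ⟨h, hh⟩)
    · by_cases hh : G.edge h = h
      · simp [hh]
      · simp [hh]
    · simp
  vert := Graph.sumSetoid G.vert ⊥
  ext := Set.range Sum.inr
  univalent := by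
    rintro _ ⟨h, rfl⟩ _ (h' | h')
    rename_i k
    have h'' : h = k := h'
    rw [h'']

variable {G}

theorem complete_edge_inl {h : G.H} (hh : G.edge h ≠ h) :
    G.complete.edge (.inl h) = .inl (G.edge h) := dif_neg hh

theorem complete_edge_leg {h : G.H} (hh : G.edge h = h) :
    G.complete.edge (.inl h) = .inr ⟨h, hh⟩ := dif_pos hh

theorem inl_notMem_ext (h : G.H) : (Sum.inl h : G.complete.H) ∉ G.complete.ext := by
  rintro ⟨_, h⟩
  cases h

theorem inr_mem_ext (h : {h : G.H // G.edge h = h}) :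
    (Sum.inr h : G.complete.H) ∈ G.complete.ext := ⟨h, rfl⟩

theorem isInternal_inl {h : G.H} : G.complete.IsInternal (.inl h) ↔ G.edge h ≠ h := by
  by_cases hh : G.edge h = h
  · refine iff_of_false (fun h' => h'.2 ?_) (not_not.2 hh)
    rw [complete_edge_leg hh]
    exact inr_mem_ext _
  · refine iff_of_true ⟨inl_notMem_ext h, ?_⟩ hh
    rw [complete_edge_inl hh]
    exact inl_notMem_ext _

theorem not_isInternal_inr (h : {h : G.H // G.edge h = h}) : ¬ G.complete.IsInternal (.inr h) :=
  fun h' => h'.1 (inr_mem_ext h)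

theorem complete_vert_inl {a b : G.H} : G.complete.vert (.inl a) (.inl b) ↔ G.vert a b :=
  Sum.liftRel_inl_inl

/-- The completions of isomorphic graphs are isomorphic. -/
def Iso.complete {G G' : LegGraph} (f : Iso G G') : Graph.Iso G.complete G'.complete where
  toEquiv := Equiv.sumCongr f.toEquiv (f.toEquiv.subtypeEquiv fun h => by
    rw [← f.map_edge, f.toEquiv.apply_eq_iff_eq])
  map_edge := by
    rintro (h | h)
    · by_cases hh : G.edge h = h
      · have hh' : G'.edge (f.toEquiv h) = f.toEquiv h := by rw [← f.map_edge, hh]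
        rw [complete_edge_leg hh]
        exact (complete_edge_leg hh').symm
      · have hh' : G'.edge (f.toEquiv h) ≠ f.toEquiv h := by
          rwa [← f.map_edge, f.toEquiv.apply_eq_iff_eq.ne]
        rw [complete_edge_inl hh]
        refine Eq.trans ?_ (complete_edge_inl hh').symm
        exact congrArg Sum.inl (f.map_edge h)
    · rfl
  map_vert := by
    rintro (h | h) (h' | h')
    · exact Sum.liftRel_inl_inl.trans ((f.map_vert h h').trans Sum.liftRel_inl_inl.symm)
    · exact iff_of_false Sum.not_liftRel_inl_inr Sum.not_liftRel_inl_inr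
    · exact iff_of_false Sum.not_liftRel_inr_inl Sum.not_liftRel_inr_inl
    · refine Sum.liftRel_inr_inr.trans (Iff.trans ?_ Sum.liftRel_inr_inr.symm)
      exact ((f.toEquiv.subtypeEquiv _).apply_eq_iff_eq (x := h) (y := h')).symm
  map_ext := by
    rintro (h | h)
    · exact iff_of_false (inl_notMem_ext _) (inl_notMem_ext _)
    · exact iff_of_true (inr_mem_ext _) (inr_mem_ext _)

theorem isPlus_complete (hG : ∀ h : G.H, ∃ k, G.edge k ≠ k ∧ G.vert h k) : G.complete.IsPlus := by
  have key : ∀ h : G.H, ∃ k, G.complete.conn (.inl h) k ∧ G.complete.IsInternal k := by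
    intro h
    obtain ⟨k, hk, hk'⟩ := hG h
    exact ⟨.inl k, Graph.conn_vert _ (complete_vert_inl.2 hk'), isInternal_inl.2 hk⟩
  rintro (h | h)
  · exact key h
  · obtain ⟨k, hk, hk'⟩ := key h.1
    exact ⟨k, G.complete.conn.trans (G.complete.conn_edge _) hk, hk'⟩

theorem isPlus_complete_quot (δ γ : G.Sub) : (quot δ γ).complete.IsPlus := by
  refine isPlus_complete fun h => ?_
  obtain ⟨k, hk, hk', hc⟩ := h.2.2
  exact ⟨⟨k, hk', k, hk, hk', (cvert δ).refl k⟩, (quot_edge_ne_iff _).2 hk, hc⟩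

/-- A graph is embedded in the graph with the legs that its completion gives. -/
noncomputable def completeEmb : Emb G G.complete.toLeg ⊥ where
  i := Sum.inl
  inj := Sum.inl_injective
  vert_iff _ _ := complete_vert_inl.symm.trans (cvert_bot (G := G.complete.toLeg)).symm
  map_edge a ha := by
    refine Eq.trans ?_ (Graph.toLeg_edge_of_internal _ (isInternal_inl.2 ha)).symm
    exact (complete_edge_inl ha).symm
  notMem _ := Sub.notMem_bot
  mem_range h k _ _ hc := by
    have hc : G.complete.vert h (.inl k) := (cvert_bot (G := G.complete.toLeg)).1 hc
    rcases h with h | h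
    · exact ⟨h, rfl⟩
    · exact absurd hc Sum.not_liftRel_inr_inl

theorem completeEmb_sub_top : (completeEmb (G := G)).sub ⊤ = ⊤ := by
  refine le_antisymm le_top ?_
  rintro (h | h) hh
  · exact Or.inr ⟨h, isInternal_inl.1 ((Graph.toLeg_edge_ne_iff _).1 hh), rfl⟩
  · exact absurd ((Graph.toLeg_edge_ne_iff _).1 hh) (not_isInternal_inr h)

end LegGraph

namespace Graph

open LegGraph

/-- An isomorphism, as an embedding of the graphs with legs. -/
noncomputable def Iso.emb {Γ Γ' : Graph} (f : Iso Γ Γ') : Emb Γ.toLeg Γ'.toLeg ⊥ where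
  i := f.toEquiv
  inj := f.toEquiv.injective
  vert_iff a b := (f.map_vert a b).trans (cvert_bot (G := Γ'.toLeg)).symm
  map_edge a ha := by
    have ha : Γ.IsInternal a := (toLeg_edge_ne_iff _).1 ha
    exact (congrArg f.toEquiv (Γ.toLeg_edge_of_internal ha)).trans ((f.map_edge a).trans
      (Γ'.toLeg_edge_of_internal ((f.isInternal_iff _).1 ha)).symm)
  notMem _ := Sub.notMem_bot
  mem_range h _ _ _ _ := ⟨f.toEquiv.symm h, f.toEquiv.apply_symm_apply h⟩

theorem Iso.emb_sub_top {Γ Γ' : Graph} (f : Iso Γ Γ') : f.emb.sub ⊤ = ⊤ := by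
  refine le_antisymm le_top ?_
  intro h hh
  refine Or.inr ⟨f.toEquiv.symm h, ?_, f.toEquiv.apply_symm_apply h⟩
  have := (toLeg_edge_ne_iff _).1 hh
  refine (toLeg_edge_ne_iff _).2 ((f.isInternal_iff _).2 ?_)
  exact (f.toEquiv.apply_symm_apply (h : Γ'.H)).symm ▸ this

/-- A half-edge of the reduced graph, as a half-edge of the graph. -/
def quotVal {Γ : Graph} (q : (quot (⊥ : Γ.toLeg.Sub) ⊤).H) : Γ.H := q.1

theorem quotVal_injective {Γ : Graph} :
    Function.Injective (quotVal : (quot (⊥ : Γ.toLeg.Sub) ⊤).H → Γ.H) := fun _ _ h => Subtype.ext h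

theorem quotVal_notMem_ext {Γ : Graph} (q : (quot (⊥ : Γ.toLeg.Sub) ⊤).H) :
    quotVal q ∉ Γ.ext := by
  intro he
  obtain ⟨k, hk, -, hc⟩ := q.2.2
  have hc : Γ.vert (quotVal q) k := cvert_bot.1 hc
  have hk : Γ.IsInternal k := (toLeg_edge_ne_iff Γ).1 hk
  have := Γ.univalent _ he k hc
  exact hk.1 (this ▸ he)

theorem quot_edge_ne_iff_internal {Γ : Graph} (q : (quot (⊥ : Γ.toLeg.Sub) ⊤).H) :
    (quot (⊥ : Γ.toLeg.Sub) ⊤).edge q ≠ q ↔ Γ.IsInternal (quotVal q) :=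
  (quot_edge_ne_iff q).trans (toLeg_edge_ne_iff Γ)

theorem quot_leg_iff {Γ : Graph} (q : (quot (⊥ : Γ.toLeg.Sub) ⊤).H) :
    (quot (⊥ : Γ.toLeg.Sub) ⊤).edge q = q ↔ Γ.edge (quotVal q) ∈ Γ.ext := by
  rw [← not_iff_not, ← ne_eq, quot_edge_ne_iff_internal]
  exact ⟨fun h => h.2, fun h => ⟨quotVal_notMem_ext q, h⟩⟩

/-- A half-edge of the completed reduced graph, as a half-edge of the graph. -/
def completeQuotVal {Γ : Graph} : (quot (⊥ : Γ.toLeg.Sub) ⊤).complete.H → Γ.H :=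
  Sum.elim quotVal fun q => Γ.edge (quotVal q.1)

theorem completeQuotVal_injective {Γ : Graph} :
    Function.Injective (completeQuotVal (Γ := Γ)) := by
  rintro (q | q) (q' | q') h
  · exact congrArg Sum.inl (quotVal_injective h)
  · have h : quotVal q = Γ.edge (quotVal q'.1) := h
    exact absurd (h ▸ (quot_leg_iff _).1 q'.2) (quotVal_notMem_ext q)
  · have h : Γ.edge (quotVal q.1) = quotVal q' := h
    exact absurd (h ▸ (quot_leg_iff _).1 q.2) (quotVal_notMem_ext q')
  · have h : Γ.edge (quotVal q.1) = Γ.edge (quotVal q'.1) := h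
    have := congrArg Γ.edge h
    rw [Γ.edge_edge, Γ.edge_edge] at this
    exact congrArg Sum.inr (Subtype.ext (quotVal_injective this))

/-- A half-edge that is not external lies on a vertex with an internal edge, which the reduction
keeps. An external one is the outer half of a leg at such a vertex. Both facts fail for graphs with
components without internal edges. -/
theorem IsPlus.completeQuotVal_surjective {Γ : Graph} (hΓ : Γ.IsPlus) :
    Function.Surjective (completeQuotVal (Γ := Γ)) := by
  have hq : ∀ h : Γ.H, h ∉ Γ.ext → ∃ q : (quot (⊥ : Γ.toLeg.Sub) ⊤).H, quotVal q = h := by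
    intro h hh
    obtain ⟨k, hk, hk'⟩ := hΓ.exists_vert hh
    exact ⟨⟨h, Sub.notMem_bot, k, (toLeg_edge_ne_iff Γ).2 hk, Sub.notMem_bot,
      cvert_of_vert _ hk'⟩, rfl⟩
  intro h
  by_cases hh : h ∈ Γ.ext
  · obtain ⟨q, hq⟩ := hq _ (hΓ.edge_notMem_ext hh)
    refine ⟨.inr ⟨q, (quot_leg_iff q).2 ?_⟩, ?_⟩
    · rw [hq, Γ.edge_edge]; exact hh
    · change Γ.edge (quotVal q) = h
      rw [hq, Γ.edge_edge]
  · obtain ⟨q, hq⟩ := hq h hh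
    exact ⟨.inl q, hq⟩

theorem completeQuotVal_edge {Γ : Graph} (q : (quot (⊥ : Γ.toLeg.Sub) ⊤).complete.H) :
    completeQuotVal ((quot ⊥ ⊤).complete.edge q) = Γ.edge (completeQuotVal q) := by
  rcases q with q | q
  · by_cases hq : (quot (⊥ : Γ.toLeg.Sub) ⊤).edge q = q
    · rw [complete_edge_leg hq]
      rfl
    · rw [complete_edge_inl hq]
      exact (quot_edge_of_mem ((quot_edge_ne_iff q).1 hq)).trans
        (Γ.toLeg_edge_of_internal ((quot_edge_ne_iff_internal q).1 hq))
  · exact (Γ.edge_edge _).symm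

theorem completeQuotVal_vert {Γ : Graph} (q q' : (quot (⊥ : Γ.toLeg.Sub) ⊤).complete.H) :
    (quot ⊥ ⊤).complete.vert q q' ↔ Γ.vert (completeQuotVal q) (completeQuotVal q') := by
  rcases q with q | q <;> rcases q' with q' | q'
  · exact complete_vert_inl.trans cvert_bot
  · refine iff_of_false Sum.not_liftRel_inl_inr fun h => ?_
    have he := (quot_leg_iff _).1 q'.2
    have : quotVal q = _ := Γ.univalent _ he _ (Γ.vert.symm h)
    exact quotVal_notMem_ext q (this ▸ he)
  · refine iff_of_false Sum.not_liftRel_inr_inl fun h => ?_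
    have he := (quot_leg_iff _).1 q.2
    have : quotVal q' = _ := Γ.univalent _ he _ h
    exact quotVal_notMem_ext q' (this ▸ he)
  · refine Sum.liftRel_inr_inr.trans ⟨?_, fun h => ?_⟩
    · intro h
      have h : q = q' := h
      rw [h]
    · have : completeQuotVal (.inr q') = completeQuotVal (.inr q) :=
        Γ.univalent _ ((quot_leg_iff _).1 q.2) _ h
      exact (Sum.inr_injective (completeQuotVal_injective this)).symm

/-- A graph all of whose components have internal edges is determined by its internal edges and the
legs on their vertices. -/
noncomputable def IsPlus.iso {Γ : Graph} (hΓ : Γ.IsPlus) :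
    Iso (quot (⊥ : Γ.toLeg.Sub) ⊤).complete Γ := by
  refine Iso.ofBijective completeQuotVal ⟨completeQuotVal_injective, hΓ.completeQuotVal_surjective⟩
    completeQuotVal_edge completeQuotVal_vert ?_
  rintro (q | q)
  · exact iff_of_false (inl_notMem_ext q) (quotVal_notMem_ext q)
  · exact iff_of_true (inr_mem_ext q) ((quot_leg_iff _).1 q.2)

end Graph

end CK

namespace CK

/-! ### Disjoint unions of graphs with legs -/

namespace LegGraph

/-- The disjoint union. -/
def union (G G' : LegGraph) : LegGraph where
  H := G.H ⊕ G'.H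
  finite := inferInstance
  edge := Sum.map G.edge G'.edge
  edge_edge := by rintro (h | h) <;> simp [G.edge_edge, G'.edge_edge]
  vert := Graph.sumSetoid G.vert G'.vert

variable {G G' : LegGraph}

/-- The union of sets of edges of two graphs. -/
def Sub.union (δ : G.Sub) (δ' : G'.Sub) : (G.union G').Sub where
  S := Sum.elim δ.S δ'.S
  edge_mem := by
    rintro (h | h) hh
    · exact δ.edge_mem h hh
    · exact δ'.edge_mem h hh
  edge_ne := by
    rintro (h | h) hh e
    · exact δ.edge_ne h hh (Sum.inl_injective e)
    · exact δ'.edge_ne h hh (Sum.inr_injective e)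

theorem Sub.union_le_union {δ γ : G.Sub} {δ' γ' : G'.Sub} :
    δ.union δ' ≤ γ.union γ' ↔ δ ≤ γ ∧ δ' ≤ γ' := by
  constructor
  · exact fun h => ⟨fun a ha => h (a := .inl a) ha, fun a ha => h (a := .inr a) ha⟩
  · rintro ⟨h, h'⟩ (a | a) ha
    · exact h ha
    · exact h' ha

theorem Sub.exists_union (ρ : (G.union G').Sub) :
    ∃ (δ : G.Sub) (δ' : G'.Sub), δ.union δ' = ρ := by
  refine ⟨⟨{h | Sum.inl h ∈ ρ.S}, fun h hh => ρ.edge_mem _ hh,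
      fun h hh e => ρ.edge_ne _ hh (congrArg Sum.inl e)⟩,
    ⟨{h | Sum.inr h ∈ ρ.S}, fun h hh => ρ.edge_mem _ hh,
      fun h hh e => ρ.edge_ne _ hh (congrArg Sum.inr e)⟩, Sub.ext ?_⟩
  ext (h | h) <;> rfl

theorem Sub.union_bot : (⊥ : G.Sub).union (⊥ : G'.Sub) = ⊥ := by
  refine le_bot_iff.1 ?_
  rintro (h | h) hh
  · exact hh
  · exact hh

theorem Sub.union_top : (⊤ : G.Sub).union (⊤ : G'.Sub) = ⊤ := by
  refine top_le_iff.1 ?_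
  rintro (h | h) hh
  · exact fun e => hh (congrArg Sum.inl e)
  · exact fun e => hh (congrArg Sum.inr e)

theorem cvert_union (δ : G.Sub) (δ' : G'.Sub) (a b : G.H ⊕ G'.H) :
    cvert (δ.union δ') a b ↔ Graph.sumSetoid (cvert δ) (cvert δ') a b := by
  refine eqvGen_sum (fun a b => ?_) a b
  constructor
  · rintro (h | ⟨ha, rfl⟩)
    · cases h with
      | inl h => exact .inl (.inl h)
      | inr h => exact .inr (.inl h)
    · rcases a with a | a
      · exact .inl (.inr ⟨ha, rfl⟩)
      · exact .inr (.inr ⟨ha, rfl⟩)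
  · rintro (⟨h | ⟨ha, rfl⟩⟩ | ⟨h | ⟨ha, rfl⟩⟩)
    · exact Or.inl (.inl h)
    · exact Or.inr ⟨ha, rfl⟩
    · exact Or.inl (.inr h)
    · exact Or.inr ⟨ha, rfl⟩

theorem cvert_union_inl {δ : G.Sub} {δ' : G'.Sub} {a b : G.H} :
    cvert (δ.union δ') (Sum.inl a : G.H ⊕ G'.H) (Sum.inl b : G.H ⊕ G'.H) ↔ cvert δ a b :=
  (cvert_union δ δ' _ _).trans Sum.liftRel_inl_inl

theorem cvert_union_inr {δ : G.Sub} {δ' : G'.Sub} {a b : G'.H} :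
    cvert (δ.union δ') (Sum.inr a : G.H ⊕ G'.H) (Sum.inr b : G.H ⊕ G'.H) ↔ cvert δ' a b :=
  (cvert_union δ δ' _ _).trans Sum.liftRel_inr_inr

/-- The map of half-edges from the union of the subquotients to the subquotient of the union. -/
def quotUnionFun (δ γ : G.Sub) (δ' γ' : G'.Sub) :
    (quot δ γ).H ⊕ (quot δ' γ').H → (quot (δ.union δ') (γ.union γ')).H :=
  Sum.elim
    (fun q => ⟨Sum.inl q.1, q.2.1, by
      obtain ⟨k, hk, hk', hc⟩ := q.2.2
      exact ⟨Sum.inl k, hk, hk', cvert_union_inl.2 hc⟩⟩)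
    (fun q => ⟨Sum.inr q.1, q.2.1, by
      obtain ⟨k, hk, hk', hc⟩ := q.2.2
      exact ⟨Sum.inr k, hk, hk', cvert_union_inr.2 hc⟩⟩)

theorem quotUnionFun_bijective (δ γ : G.Sub) (δ' γ' : G'.Sub) :
    Function.Bijective (quotUnionFun δ γ δ' γ') := by
  constructor
  · rintro (q | q) (q' | q') h
    · exact congrArg Sum.inl (Subtype.ext (Sum.inl_injective (congrArg Subtype.val h)))
    · exact absurd (congrArg Subtype.val h) Sum.inl_ne_inr
    · exact absurd (congrArg Subtype.val h) Sum.inr_ne_inl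
    · exact congrArg Sum.inr (Subtype.ext (Sum.inr_injective (congrArg Subtype.val h)))
  · rintro ⟨h | h, hh, k | k, hk, hk', hc⟩
    · exact ⟨.inl ⟨h, hh, k, hk, hk', cvert_union_inl.1 hc⟩, rfl⟩
    · exact absurd ((cvert_union _ _ _ _).1 hc) Sum.not_liftRel_inl_inr
    · exact absurd ((cvert_union _ _ _ _).1 hc) Sum.not_liftRel_inr_inl
    · exact ⟨.inr ⟨h, hh, k, hk, hk', cvert_union_inr.1 hc⟩, rfl⟩

/-- The subquotients of a union. -/
noncomputable def quotUnionIso (δ γ : G.Sub) (δ' γ' : G'.Sub) :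
    Iso ((quot δ γ).union (quot δ' γ')) (quot (δ.union δ') (γ.union γ')) where
  toEquiv := Equiv.ofBijective _ (quotUnionFun_bijective δ γ δ' γ')
  map_edge h := by
    change quotUnionFun δ γ δ' γ' _ = (quot _ _).edge (quotUnionFun δ γ δ' γ' h)
    rcases h with q | q
    · change quotUnionFun δ γ δ' γ' (.inl ((quot δ γ).edge q)) = _
      by_cases hq : q.1 ∈ γ.S
      · refine Subtype.ext (Eq.trans ?_ (quot_edge_of_mem (δ := δ.union δ') (γ := γ.union γ')
          (h := quotUnionFun δ γ δ' γ' (.inl q)) hq).symm)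
        exact congrArg Sum.inl (quot_edge_of_mem hq)
      · rw [quot_edge_of_notMem hq]
        exact (quot_edge_of_notMem (δ := δ.union δ') (γ := γ.union γ')
          (h := quotUnionFun δ γ δ' γ' (.inl q)) hq).symm
    · change quotUnionFun δ γ δ' γ' (.inr ((quot δ' γ').edge q)) = _
      by_cases hq : q.1 ∈ γ'.S
      · refine Subtype.ext (Eq.trans ?_ (quot_edge_of_mem (δ := δ.union δ') (γ := γ.union γ')
          (h := quotUnionFun δ γ δ' γ' (.inr q)) hq).symm)
        exact congrArg Sum.inr (quot_edge_of_mem hq)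
      · rw [quot_edge_of_notMem hq]
        exact (quot_edge_of_notMem (δ := δ.union δ') (γ := γ.union γ')
          (h := quotUnionFun δ γ δ' γ' (.inr q)) hq).symm
  map_vert a b := by
    rcases a with a | a <;> rcases b with b | b
    · exact Sum.liftRel_inl_inl.trans cvert_union_inl.symm
    · exact iff_of_false Sum.not_liftRel_inl_inr
        fun h => Sum.not_liftRel_inl_inr ((cvert_union _ _ _ _).1 h)
    · exact iff_of_false Sum.not_liftRel_inr_inl
        fun h => Sum.not_liftRel_inr_inl ((cvert_union _ _ _ _).1 h)
    · exact Sum.liftRel_inr_inr.trans cvert_union_inr.symm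

/-- The map of half-edges from the union of the completions to the completion of the union. -/
def completeUnionFun (G G' : LegGraph) : (G.complete.union G'.complete).H → (G.union G').complete.H :=
  Sum.elim
    (Sum.elim (fun h => .inl (.inl h)) fun h => .inr ⟨.inl h.1, congrArg Sum.inl h.2⟩)
    (Sum.elim (fun h => .inl (.inr h)) fun h => .inr ⟨.inr h.1, congrArg Sum.inr h.2⟩)

theorem completeUnionFun_bijective (G G' : LegGraph) : Function.Bijective (completeUnionFun G G') := by
  constructor
  · have hl : ∀ (h : G.H) (h' : G'.H), (Sum.inl h : (G.union G').H) ≠ Sum.inr h' :=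
      fun _ _ => Sum.inl_ne_inr
    rintro ((h | h) | (h | h)) ((h' | h') | (h' | h')) e
    · exact congrArg _ (congrArg _ (Sum.inl_injective (Sum.inl_injective e)))
    · exact absurd e Sum.inl_ne_inr
    · exact absurd (Sum.inl_injective e) (hl _ _)
    · exact absurd e Sum.inl_ne_inr
    · exact absurd e Sum.inr_ne_inl
    · exact congrArg _ (congrArg _ (Subtype.ext (Sum.inl_injective
        (congrArg Subtype.val (Sum.inr_injective e)))))
    · exact absurd e Sum.inr_ne_inl
    · exact absurd (congrArg Subtype.val (Sum.inr_injective e)) (hl _ _)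
    · exact absurd (Sum.inl_injective e).symm (hl _ _)
    · exact absurd e Sum.inl_ne_inr
    · exact congrArg _ (congrArg _ (Sum.inr_injective (Sum.inl_injective e)))
    · exact absurd e Sum.inl_ne_inr
    · exact absurd e Sum.inr_ne_inl
    · exact absurd (congrArg Subtype.val (Sum.inr_injective e)).symm (hl _ _)
    · exact absurd e Sum.inr_ne_inl
    · exact congrArg _ (congrArg _ (Subtype.ext (Sum.inr_injective
        (congrArg Subtype.val (Sum.inr_injective e)))))
  · rintro ((h | h) | ⟨h | h, hh⟩)
    · exact ⟨.inl (.inl h), rfl⟩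
    · exact ⟨.inr (.inl h), rfl⟩
    · exact ⟨.inl (.inr ⟨h, Sum.inl_injective hh⟩), rfl⟩
    · exact ⟨.inr (.inr ⟨h, Sum.inr_injective hh⟩), rfl⟩

/-- The completion of a union. -/
noncomputable def completeUnionIso (G G' : LegGraph) :
    Graph.Iso (G.complete.union G'.complete) (G.union G').complete := by
  refine Graph.Iso.ofBijective (completeUnionFun G G') (completeUnionFun_bijective G G') ?_ ?_ ?_
  · rintro ((h | h) | (h | h))
    · change completeUnionFun G G' (.inl (G.complete.edge (.inl h))) = _
      by_cases hh : G.edge h = h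
      · rw [complete_edge_leg hh]
        exact (complete_edge_leg (G := G.union G') (h := .inl h) (congrArg Sum.inl hh)).symm
      · rw [complete_edge_inl hh]
        exact (complete_edge_inl (G := G.union G') (h := .inl h)
          fun e => hh (Sum.inl_injective e)).symm
    · rfl
    · change completeUnionFun G G' (.inr (G'.complete.edge (.inl h))) = _
      by_cases hh : G'.edge h = h
      · rw [complete_edge_leg hh]
        exact (complete_edge_leg (G := G.union G') (h := .inr h) (congrArg Sum.inr hh)).symm
      · rw [complete_edge_inl hh]
        exact (complete_edge_inl (G := G.union G') (h := .inr h)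
          fun e => hh (Sum.inr_injective e)).symm
    · rfl
  · rintro ((h | h) | (h | h)) ((h' | h') | (h' | h'))
    · exact Sum.liftRel_inl_inl.trans (Sum.liftRel_inl_inl.trans
        (Sum.liftRel_inl_inl.trans Sum.liftRel_inl_inl).symm)
    · exact iff_of_false (fun h => Sum.not_liftRel_inl_inr (Sum.liftRel_inl_inl.1 h))
        Sum.not_liftRel_inl_inr
    · exact iff_of_false Sum.not_liftRel_inl_inr
        fun h => Sum.not_liftRel_inl_inr (Sum.liftRel_inl_inl.1 h)
    · exact iff_of_false Sum.not_liftRel_inl_inr Sum.not_liftRel_inl_inr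
    · exact iff_of_false (fun h => Sum.not_liftRel_inr_inl (Sum.liftRel_inl_inl.1 h))
        Sum.not_liftRel_inr_inl
    · refine Sum.liftRel_inl_inl.trans (Sum.liftRel_inr_inr.trans
        (Iff.trans ?_ Sum.liftRel_inr_inr.symm))
      exact ⟨fun (e : h = h') => by subst e; exact (⊥ : Setoid _).refl _, fun e => Subtype.ext
        (Sum.inl_injective (congrArg Subtype.val e))⟩
    · exact iff_of_false Sum.not_liftRel_inl_inr Sum.not_liftRel_inr_inl
    · refine iff_of_false Sum.not_liftRel_inl_inr fun e => ?_
      have := Sum.liftRel_inr_inr.1 e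
      exact Sum.inl_ne_inr (congrArg Subtype.val this)
    · exact iff_of_false Sum.not_liftRel_inr_inl
        fun h => Sum.not_liftRel_inr_inl (Sum.liftRel_inl_inl.1 h)
    · exact iff_of_false Sum.not_liftRel_inr_inl Sum.not_liftRel_inl_inr
    · exact Sum.liftRel_inr_inr.trans (Sum.liftRel_inl_inl.trans
        (Sum.liftRel_inl_inl.trans Sum.liftRel_inr_inr).symm)
    · exact iff_of_false (fun h => Sum.not_liftRel_inl_inr (Sum.liftRel_inr_inr.1 h))
        Sum.not_liftRel_inl_inr
    · exact iff_of_false Sum.not_liftRel_inr_inl Sum.not_liftRel_inr_inl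
    · refine iff_of_false Sum.not_liftRel_inr_inl fun e => ?_
      have := Sum.liftRel_inr_inr.1 e
      exact Sum.inr_ne_inl (congrArg Subtype.val this)
    · exact iff_of_false (fun h => Sum.not_liftRel_inr_inl (Sum.liftRel_inr_inr.1 h))
        Sum.not_liftRel_inr_inl
    · refine Sum.liftRel_inr_inr.trans (Sum.liftRel_inr_inr.trans
        (Iff.trans ?_ Sum.liftRel_inr_inr.symm))
      exact ⟨fun (e : h = h') => by subst e; exact (⊥ : Setoid _).refl _, fun e => Subtype.ext
        (Sum.inr_injective (congrArg Subtype.val e))⟩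
  · rintro ((h | h) | (h | h))
    · exact iff_of_false (inl_notMem_ext h) (inl_notMem_ext (G := G.union G') _)
    · exact iff_of_true (inr_mem_ext h) (inr_mem_ext (G := G.union G') _)
    · exact iff_of_false (inl_notMem_ext h) (inl_notMem_ext (G := G.union G') _)
    · exact iff_of_true (inr_mem_ext h) (inr_mem_ext (G := G.union G') _)

/-- The graph with legs of a union. -/
noncomputable def toLegUnionEmb (Γ Γ' : Graph) :
    Emb (Γ.toLeg.union Γ'.toLeg) (Γ.union Γ').toLeg ⊥ where
  i := id
  inj := Function.injective_id
  vert_iff _ _ := (cvert_bot (G := (Γ.union Γ').toLeg)).symm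
  map_edge := by
    rintro (a | a) ha
    · have ha : Γ.IsInternal a := (Γ.toLeg_edge_ne_iff).1 fun e => ha (congrArg Sum.inl e)
      exact (congrArg Sum.inl (Γ.toLeg_edge_of_internal ha)).trans
        ((Γ.union Γ').toLeg_edge_of_internal (h := .inl a) ha).symm
    · have ha : Γ'.IsInternal a := (Γ'.toLeg_edge_ne_iff).1 fun e => ha (congrArg Sum.inr e)
      exact (congrArg Sum.inr (Γ'.toLeg_edge_of_internal ha)).trans
        ((Γ.union Γ').toLeg_edge_of_internal (h := .inr a) ha).symm
  notMem _ := Sub.notMem_bot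
  mem_range h _ _ _ _ := ⟨h, rfl⟩

theorem toLegUnionEmb_sub_top (Γ Γ' : Graph) : (toLegUnionEmb Γ Γ').sub ⊤ = ⊤ := by
  refine top_le_iff.1 ?_
  rintro (h | h) hh
  · have hh : Γ.IsInternal h := ((Γ.union Γ').toLeg_edge_ne_iff (h := .inl h)).1 hh
    exact Or.inr ⟨.inl h, fun e => (Γ.toLeg_edge_ne_iff).2 hh (Sum.inl_injective e), rfl⟩
  · have hh : Γ'.IsInternal h := ((Γ.union Γ').toLeg_edge_ne_iff (h := .inr h)).1 hh
    exact Or.inr ⟨.inr h, fun e => (Γ'.toLeg_edge_ne_iff).2 hh (Sum.inr_injective e), rfl⟩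

end LegGraph

end CK

namespace CK

/-! ### The bialgebra of the graphs all of whose components have internal edges -/

namespace GraphClass

theorem mk_eq_mk {Γ Γ' : Graph} : mk Γ = mk Γ' ↔ Nonempty (Graph.Iso Γ Γ') :=
  Quotient.eq (r := Graph.isoSetoid)

theorem mk_rep (c : GraphClass) : mk c.rep = c := Quotient.out_eq c

theorem mk_mul (Γ Γ' : Graph) : mk Γ * mk Γ' = mk (Γ.union Γ') := rfl

theorem mk_eq_one {Γ : Graph} : mk Γ = 1 ↔ IsEmpty Γ.H := by
  constructor
  · intro h
    obtain ⟨f⟩ := mk_eq_mk.1 (show mk Γ = mk Graph.empty from h)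
    exact ⟨fun a => (f.toEquiv a : Empty).elim⟩
  · intro h
    have h0 : IsEmpty Graph.empty.H := inferInstanceAs (IsEmpty Empty)
    refine (mk_eq_mk (Γ := Γ) (Γ' := Graph.empty)).2 ⟨⟨Equiv.equivOfIsEmpty _ _, ?_, ?_, ?_⟩⟩
    all_goals exact fun a => h.elim a

/-- The number of internal half-edges. -/
noncomputable def internalCard : GraphClass → ℕ :=
  Quotient.lift (fun Γ : Graph => Nat.card {h // Γ.IsInternal h}) (by
    rintro Γ Γ' ⟨f⟩
    exact Nat.card_congr (f.toEquiv.subtypeEquiv f.isInternal_iff))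

theorem internalCard_mul (c d : GraphClass) :
    internalCard (c * d) = internalCard c + internalCard d := by
  obtain ⟨Γ, rfl⟩ := Quotient.exists_rep c
  obtain ⟨Γ', rfl⟩ := Quotient.exists_rep d
  change Nat.card {h : Γ.H ⊕ Γ'.H // (Γ.union Γ').IsInternal h} = Nat.card _ + Nat.card _
  rw [← Nat.card_sum]
  exact Nat.card_congr Equiv.subtypeSum

end GraphClass

/-- The isomorphism classes of the graphs all of whose components have internal edges. -/
def plusClasses : Submonoid GraphClass where
  carrier := {c | ∃ Γ : Graph, GraphClass.mk Γ = c ∧ Γ.IsPlus}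
  one_mem' := ⟨Graph.empty, rfl, fun a => a.elim⟩
  mul_mem' := by
    rintro _ _ ⟨Γ, rfl, h⟩ ⟨Γ', rfl, h'⟩
    exact ⟨Γ.union Γ', rfl, (Γ.union_isPlus_iff Γ').2 ⟨h, h'⟩⟩

/-- The isomorphism classes of the graphs all of whose components have internal edges. -/
abbrev PlusClass : Type 1 := plusClasses

theorem mk_mem_plusClasses {Γ : Graph} : GraphClass.mk Γ ∈ plusClasses ↔ Γ.IsPlus := by
  refine ⟨?_, fun h => ⟨Γ, rfl, h⟩⟩
  rintro ⟨Γ', h, h'⟩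
  obtain ⟨f⟩ := GraphClass.mk_eq_mk.1 h
  exact f.isPlus h'

theorem mul_mem_plusClasses {c d : GraphClass} :
    c * d ∈ plusClasses ↔ c ∈ plusClasses ∧ d ∈ plusClasses := by
  refine ⟨fun h => ?_, fun h => mul_mem h.1 h.2⟩
  obtain ⟨Γ, rfl⟩ := Quotient.exists_rep c
  obtain ⟨Γ', rfl⟩ := Quotient.exists_rep d
  have h := (Γ.union_isPlus_iff Γ').1 (mk_mem_plusClasses.1 h)
  exact ⟨mk_mem_plusClasses.2 h.1, mk_mem_plusClasses.2 h.2⟩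

/-- The class of a graph all of whose components have internal edges. -/
def PlusClass.mk (Γ : Graph) (h : Γ.IsPlus) : PlusClass := ⟨GraphClass.mk Γ, mk_mem_plusClasses.2 h⟩

theorem PlusClass.exists_mk (c : PlusClass) : ∃ (Γ : Graph) (h : Γ.IsPlus), PlusClass.mk Γ h = c := by
  obtain ⟨c, Γ, rfl, h⟩ := c
  exact ⟨Γ, h, rfl⟩

namespace LegGraph

variable {G : LegGraph}

/-- The class of the graph `γ / δ`. -/
noncomputable def subquot (δ γ : G.Sub) : PlusClass :=
  PlusClass.mk (quot δ γ).complete (isPlus_complete_quot δ γ)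

theorem subquot_eq_of_iso {G' : LegGraph} {δ γ : G.Sub} {δ' γ' : G'.Sub}
    (f : Iso (quot δ γ) (quot δ' γ')) : subquot δ γ = subquot δ' γ' :=
  Subtype.ext (GraphClass.mk_eq_mk.2 ⟨f.complete⟩)

theorem Emb.subquot_sub {G' : LegGraph} {δ₀ : G.Sub} (e : Emb G' G δ₀) (ρ ρ' : G'.Sub) :
    subquot (e.sub ρ) (e.sub ρ') = subquot ρ ρ' := (subquot_eq_of_iso (e.quotIso ρ ρ')).symm

/-- Vertices without edges are dropped from a subquotient, so one without edges is empty and not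
merely a set of vertices with legs. -/
theorem subquot_eq_one {δ γ : G.Sub} : subquot δ γ = 1 ↔ γ ≤ δ := by
  refine Subtype.ext_iff.trans (GraphClass.mk_eq_one.trans ⟨fun h a ha => ?_, fun h => ⟨?_⟩⟩)
  · by_contra haδ
    exact h.elim (Sum.inl ⟨a, haδ, a, ha, haδ, (cvert δ).refl a⟩)
  · rintro (⟨_, _, k, hk, hk', _⟩ | ⟨⟨_, _, k, hk, hk', _⟩, _⟩)
    · exact hk' (h hk)
    · exact hk' (h hk)

theorem subquot_union {G' : LegGraph} (δ γ : G.Sub) (δ' γ' : G'.Sub) :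
    subquot (δ.union δ') (γ.union γ') = subquot δ γ * subquot δ' γ' :=
  Subtype.ext (GraphClass.mk_eq_mk.2 ⟨((completeUnionIso _ _).trans
    (quotUnionIso δ γ δ' γ').complete).symm⟩)

theorem internalCard_subquot (δ γ : G.Sub) :
    GraphClass.internalCard (subquot δ γ).1 = (γ.S \ δ.S).ncard := by
  refine Nat.card_congr (Equiv.ofBijective
    (fun h : {h // (quot δ γ).complete.IsInternal h} => (⟨Sum.elim Subtype.val (fun q => q.1.1) h.1, by
      obtain ⟨h | h, hh⟩ := h
      · exact ⟨(quot_edge_ne_iff h).1 (isInternal_inl.1 hh), h.2.1⟩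
      · exact absurd hh (not_isInternal_inr h)⟩ : ↥(γ.S \ δ.S))) ⟨?_, ?_⟩)
  · rintro ⟨h | h, hh⟩ ⟨h' | h', hh'⟩ e
    · have e := congrArg Subtype.val e
      have e : h.1 = h'.1 := e
      exact Subtype.ext (congrArg Sum.inl (Subtype.ext e))
    · exact absurd hh' (not_isInternal_inr h')
    · exact absurd hh (not_isInternal_inr h)
    · exact absurd hh (not_isInternal_inr h)
  · rintro ⟨h, hγ, hδ⟩
    exact ⟨⟨.inl ⟨h, hδ, h, hγ, hδ, (cvert δ).refl h⟩,
      isInternal_inl.2 ((quot_edge_ne_iff _).2 hγ)⟩, rfl⟩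

open Classical in
/-- The sets of edges between two given ones. -/
noncomputable def between (δ γ : G.Sub) : Finset G.Sub :=
  Finset.univ.filter fun ρ => δ ≤ ρ ∧ ρ ≤ γ

theorem mem_between {δ γ ρ : G.Sub} : ρ ∈ between δ γ ↔ δ ≤ ρ ∧ ρ ≤ γ := by simp [between]

/-- The coproduct of the graph `γ / δ`. -/
noncomputable def copSub (δ γ : G.Sub) : Multiset (PlusClass × PlusClass) :=
  (between δ γ).val.map fun ρ => (subquot δ ρ, subquot ρ γ)

/-- An embedding matches the intervals of edge sets and their subquotients. Applied to various
embeddings, this gives invariance under isomorphism, the coproduct of a subquotient, and the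
comparison with disjoint unions. -/
theorem Emb.copSub_sub {G' : LegGraph} {δ₀ : G.Sub} (e : Emb G' G δ₀) (ρ ρ' : G'.Sub) :
    copSub (e.sub ρ) (e.sub ρ') = copSub ρ ρ' := by
  have h : between (e.sub ρ) (e.sub ρ') = (between ρ ρ').map ⟨e.sub, e.sub_injective⟩ := by
    ext σ
    rw [Finset.mem_map, mem_between]
    constructor
    · rintro ⟨h1, h2⟩
      obtain ⟨τ, h3, h4, rfl⟩ := e.exists_sub_eq h1 h2
      exact ⟨τ, mem_between.2 ⟨h3, h4⟩, rfl⟩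
    · rintro ⟨τ, hτ, rfl⟩
      exact ⟨e.sub_le_sub.2 (mem_between.1 hτ).1, e.sub_le_sub.2 (mem_between.1 hτ).2⟩
  rw [copSub, h, Finset.map_val, Multiset.map_map]
  refine Multiset.map_congr rfl fun σ _ => ?_
  exact Prod.ext (e.subquot_sub _ _) (e.subquot_sub _ _)

theorem copSub_union {G' : LegGraph} (δ γ : G.Sub) (δ' γ' : G'.Sub) :
    copSub (δ.union δ') (γ.union γ') = (copSub δ γ ×ˢ copSub δ' γ').map
      fun p => (p.1.1 * p.2.1, p.1.2 * p.2.2) := by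
  have hinj : Function.Injective fun p : G.Sub × G'.Sub => p.1.union p.2 := by
    intro p q h
    have h : p.1.union p.2 = q.1.union q.2 := h
    have h1 := Sub.union_le_union.1 h.le
    have h2 := Sub.union_le_union.1 h.ge
    exact Prod.ext (le_antisymm h1.1 h2.1) (le_antisymm h1.2 h2.2)
  have h : between (δ.union δ') (γ.union γ') = (between δ γ ×ˢ between δ' γ').map ⟨_, hinj⟩ := by
    ext σ
    rw [Finset.mem_map, mem_between]
    constructor
    · rintro ⟨h1, h2⟩
      obtain ⟨ρ, ρ', rfl⟩ := σ.exists_union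
      have h1 := Sub.union_le_union.1 h1
      have h2 := Sub.union_le_union.1 h2
      exact ⟨(ρ, ρ'), Finset.mem_product.2
        ⟨mem_between.2 ⟨h1.1, h2.1⟩, mem_between.2 ⟨h1.2, h2.2⟩⟩, rfl⟩
    · rintro ⟨⟨ρ, ρ'⟩, hρ, rfl⟩
      obtain ⟨h1, h2⟩ := Finset.mem_product.1 hρ
      have h1 := mem_between.1 h1
      have h2 := mem_between.1 h2
      exact ⟨Sub.union_le_union.2 ⟨h1.1, h2.1⟩, Sub.union_le_union.2 ⟨h1.2, h2.2⟩⟩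
  rw [copSub, h, Finset.map_val, Multiset.map_map, copSub, copSub, Finset.product_val]
  change Multiset.map _ (Multiset.product _ _) = Multiset.map _ (Multiset.product _ _)
  simp only [Multiset.product, Multiset.map_bind, Multiset.bind_map, Multiset.map_map]
  refine Multiset.bind_congr fun ρ _ => Multiset.map_congr rfl fun ρ' _ => ?_
  exact Prod.ext (subquot_union _ _ _ _) (subquot_union _ _ _ _)

end LegGraph

open LegGraph

/-- The coproduct on the classes of graphs all of whose components have internal edges. -/
noncomputable def plusCop (c : PlusClass) : Multiset (PlusClass × PlusClass) :=
  copSub (⊥ : c.1.rep.toLeg.Sub) ⊤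

theorem plusCop_mk (Γ : Graph) (h : Γ.IsPlus) :
    plusCop (PlusClass.mk Γ h) = copSub (⊥ : Γ.toLeg.Sub) ⊤ := by
  obtain ⟨f⟩ := GraphClass.mk_eq_mk.1 (GraphClass.mk_rep (PlusClass.mk Γ h).1)
  have := f.emb.copSub_sub ⊥ ⊤
  rw [f.emb.sub_bot, f.emb_sub_top] at this
  exact this.symm

theorem PlusClass.mk_eq_subquot (Γ : Graph) (h : Γ.IsPlus) :
    PlusClass.mk Γ h = subquot (⊥ : Γ.toLeg.Sub) ⊤ :=
  Subtype.ext (GraphClass.mk_eq_mk.2 ⟨h.iso.symm⟩)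

/-- The graph with legs `quot δ γ` is embedded both in `G` and in the graph with legs of its own
completion; the two resulting formulas are compared. -/
theorem plusCop_subquot {G : LegGraph} {δ γ : G.Sub} (h : δ ≤ γ) :
    plusCop (subquot δ γ) = copSub δ γ := by
  have h1 := (completeEmb (G := quot δ γ)).copSub_sub ⊥ ⊤
  rw [completeEmb_sub_top, Emb.sub_bot] at h1
  have h2 := (quotEmb δ γ).copSub_sub ⊥ ⊤
  rw [quotEmb_sub_top h, Emb.sub_bot] at h2
  exact (plusCop_mk _ _).trans (h1.trans h2.symm)

/-- Both sides are the sum over the chains `σ ≤ ρ` of edge sets, with the terms `σ`, `ρ / σ` and `Γ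
/ ρ`, taken in the two orders of summation. -/
theorem plusCop_coassoc (c : PlusClass) :
    ((plusCop c).bind fun p => (plusCop p.1).map fun q => (q.1, q.2, p.2))
      = (plusCop c).bind fun p => (plusCop p.2).map fun q => (p.1, q.1, q.2) := by
  obtain ⟨Γ, h, rfl⟩ := c.exists_mk
  rw [plusCop_mk, copSub, Multiset.bind_map, Multiset.bind_map]
  have h1 : ∀ ρ ∈ between (⊥ : Γ.toLeg.Sub) ⊤,
      ((plusCop (subquot ⊥ ρ)).map fun q => (q.1, q.2, subquot ρ ⊤))
        = ∑ σ ∈ between ⊥ ρ, {(subquot ⊥ σ, subquot σ ρ, subquot ρ ⊤)} := by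
    intro ρ hρ
    rw [plusCop_subquot (mem_between.1 hρ).1, copSub, Multiset.map_map, Finset.sum,
      ← Multiset.sum_map_singleton (Multiset.map _ _), Multiset.map_map]
    rfl
  have h2 : ∀ σ ∈ between (⊥ : Γ.toLeg.Sub) ⊤,
      ((plusCop (subquot σ ⊤)).map fun q => (subquot ⊥ σ, q.1, q.2))
        = ∑ ρ ∈ between σ ⊤, {(subquot ⊥ σ, subquot σ ρ, subquot ρ ⊤)} := by
    intro ρ hρ
    rw [plusCop_subquot (mem_between.1 hρ).2, copSub, Multiset.map_map, Finset.sum,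
      ← Multiset.sum_map_singleton (Multiset.map _ _), Multiset.map_map]
    rfl
  rw [Multiset.bind_congr h1, Multiset.bind_congr h2]
  change ∑ ρ ∈ between (⊥ : Γ.toLeg.Sub) ⊤, _ = ∑ σ ∈ between (⊥ : Γ.toLeg.Sub) ⊤, _
  refine Finset.sum_comm' fun ρ σ => ?_
  simp only [mem_between, bot_le, le_top, true_and, and_true]

theorem plusCop_mul (a b : PlusClass) : plusCop (a * b)
    = (plusCop a ×ˢ plusCop b).map fun p => (p.1.1 * p.2.1, p.1.2 * p.2.2) := by
  obtain ⟨Γ, h, rfl⟩ := a.exists_mk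
  obtain ⟨Γ', h', rfl⟩ := b.exists_mk
  have h1 := (toLegUnionEmb Γ Γ').copSub_sub ⊥ ⊤
  rw [toLegUnionEmb_sub_top, Emb.sub_bot, ← Sub.union_bot, ← Sub.union_top, copSub_union] at h1
  rw [plusCop_mk, plusCop_mk, ← h1]
  exact plusCop_mk (Γ.union Γ') ((Γ.union_isPlus_iff Γ').2 ⟨h, h'⟩)

theorem plusCop_eq_cons_left (c : PlusClass) :
    ∃ s, plusCop c = (1, c) ::ₘ s ∧ ∀ p ∈ s, p.1 ≠ 1 := by
  classical
  obtain ⟨Γ, h, rfl⟩ := c.exists_mk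
  have hm : (⊥ : Γ.toLeg.Sub) ∈ between (⊥ : Γ.toLeg.Sub) ⊤ := mem_between.2 ⟨le_rfl, bot_le⟩
  refine ⟨((between (⊥ : Γ.toLeg.Sub) ⊤).erase ⊥).val.map fun ρ => (subquot ⊥ ρ, subquot ρ ⊤),
    ?_, ?_⟩
  · rw [plusCop_mk, copSub, ← Finset.insert_erase hm,
      Finset.insert_val_of_notMem (Finset.notMem_erase _ _), Multiset.map_cons,
      subquot_eq_one.2 le_rfl, ← PlusClass.mk_eq_subquot Γ h, Finset.erase_insert_eq_erase,
      Finset.erase_idem]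
  · intro p hp
    obtain ⟨ρ, hρ, rfl⟩ := Multiset.mem_map.1 hp
    exact fun e => (Finset.mem_erase.1 hρ).1 (le_bot_iff.1 (subquot_eq_one.1 e))

theorem plusCop_eq_cons_right (c : PlusClass) :
    ∃ s, plusCop c = (c, 1) ::ₘ s ∧ ∀ p ∈ s, p.2 ≠ 1 := by
  classical
  obtain ⟨Γ, h, rfl⟩ := c.exists_mk
  have hm : (⊤ : Γ.toLeg.Sub) ∈ between (⊥ : Γ.toLeg.Sub) ⊤ := mem_between.2 ⟨le_top, le_rfl⟩
  refine ⟨((between (⊥ : Γ.toLeg.Sub) ⊤).erase ⊤).val.map fun ρ => (subquot ⊥ ρ, subquot ρ ⊤),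
    ?_, ?_⟩
  · rw [plusCop_mk, copSub, ← Finset.insert_erase hm,
      Finset.insert_val_of_notMem (Finset.notMem_erase _ _), Multiset.map_cons,
      subquot_eq_one.2 le_rfl, ← PlusClass.mk_eq_subquot Γ h, Finset.erase_insert_eq_erase,
      Finset.erase_idem]
  · intro p hp
    obtain ⟨ρ, hρ, rfl⟩ := Multiset.mem_map.1 hp
    exact fun e => (Finset.mem_erase.1 hρ).1 (top_le_iff.1 (subquot_eq_one.1 e))

theorem internalCard_plusCop (c : PlusClass) (p : PlusClass × PlusClass) (hp : p ∈ plusCop c) :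
    GraphClass.internalCard p.1.1 + GraphClass.internalCard p.2.1
      = GraphClass.internalCard c.1 := by
  obtain ⟨Γ, h, rfl⟩ := c.exists_mk
  rw [plusCop_mk] at hp
  obtain ⟨ρ, hρ, rfl⟩ := Multiset.mem_map.1 hp
  rw [PlusClass.mk_eq_subquot, internalCard_subquot, internalCard_subquot, internalCard_subquot]
  have hb : (⊥ : Γ.toLeg.Sub).S = ∅ := rfl
  rw [hb, Set.sdiff_empty, Set.sdiff_empty, add_comm]
  exact Set.ncard_sdiff_add_ncard_of_subset (mem_between.1 hρ).2

noncomputable instance : CombBialgebra PlusClass where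
  cop := plusCop
  deg c := GraphClass.internalCard c.1
  coassoc := plusCop_coassoc
  cop_mul := plusCop_mul
  counit_left := plusCop_eq_cons_left
  counit_right := plusCop_eq_cons_right
  deg_cop := internalCard_plusCop
  deg_mul a b := GraphClass.internalCard_mul a.1 b.1
  eq_one_of_deg := by
    intro c hc
    obtain ⟨Γ, h, rfl⟩ := c.exists_mk
    refine Subtype.ext (GraphClass.mk_eq_one.2 ⟨fun a => ?_⟩)
    obtain ⟨k, -, hk⟩ := h a
    have : IsEmpty {h // Γ.IsInternal h} := (Finite.card_eq_zero_iff).1 hc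
    exact this.elim ⟨k, hk⟩

end CK

namespace CK

/-! ### Connected components -/

namespace Graph

variable (Γ : Graph)

instance : Finite Γ.Components := inferInstanceAs (Finite (Quotient Γ.conn))

noncomputable instance : Fintype Γ.Components := Fintype.ofFinite _

theorem component_conn {i : Γ.Components} (a b : (Γ.component i).H) : (Γ.component i).conn a b := by
  have key : ∀ a b, Γ.conn a b → ∀ (ha : Quotient.mk Γ.conn a = i) (hb : Quotient.mk Γ.conn b = i),
      (Γ.component i).conn ⟨a, ha⟩ ⟨b, hb⟩ := by
    intro a b hab
    induction hab with
    | rel a b h =>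
      intro ha hb
      refine .rel _ _ (h.imp id fun h => Subtype.ext h)
    | refl a => exact fun _ _ => (Γ.component i).conn.refl _
    | symm a b _ ih => exact fun ha hb => (Γ.component i).conn.symm (ih hb ha)
    | trans a b c hab _ ih₁ ih₂ =>
      intro ha hc
      have hb : Quotient.mk Γ.conn b = i := (Quotient.sound hab).symm.trans ha
      exact (Γ.component i).conn.trans (ih₁ ha hb) (ih₂ hb hc)
  exact key a.1 b.1 (Quotient.exact (a.2.trans b.2.symm)) a.2 b.2

theorem component_connected (i : Γ.Components) : (Γ.component i).Connected := by
  obtain ⟨a, ha⟩ := Quotient.exists_rep i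
  exact ⟨⟨⟨a, ha⟩⟩, Γ.component_conn⟩

variable {Γ} in
theorem Connected.isPlus_iff (hΓ : Γ.Connected) : Γ.IsPlus ↔ ∃ h, Γ.IsInternal h := by
  constructor
  · intro h
    obtain ⟨a⟩ := hΓ.1
    obtain ⟨k, -, hk⟩ := h a
    exact ⟨k, hk⟩
  · rintro ⟨k, hk⟩ a
    exact ⟨k, hΓ.2 a k, hk⟩

theorem isPlus_iff_component : Γ.IsPlus ↔ ∀ i, (Γ.component i).IsPlus := by
  constructor
  · rintro h i ⟨a, ha⟩
    obtain ⟨k, hk, hk'⟩ := h a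
    exact ⟨⟨k, (Quotient.sound hk).symm.trans ha⟩, Γ.component_conn _ _, hk'⟩
  · intro h a
    obtain ⟨k, -, hk⟩ := h (Quotient.mk _ a) ⟨a, rfl⟩
    exact ⟨k.1, Quotient.exact k.2.symm, hk⟩

/-- The union of a set of components. -/
def restrict (s : Set Γ.Components) : Graph where
  H := {h : Γ.H // Quotient.mk Γ.conn h ∈ s}
  finite := inferInstance
  edge h := ⟨Γ.edge h.1, Quotient.sound (Γ.conn_edge h.1) ▸ h.2⟩
  edge_edge h := Subtype.ext (Γ.edge_edge h.1)
  edge_ne h := fun e => Γ.edge_ne h.1 (congrArg Subtype.val e)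
  vert := Γ.vert.comap Subtype.val
  ext := {h | h.1 ∈ Γ.ext}
  univalent h hh h' e := Subtype.ext (Γ.univalent h.1 hh h'.1 e)

/-- The whole graph is the union of all components. -/
noncomputable def restrictUnivIso : Iso (Γ.restrict Set.univ) Γ :=
  Iso.ofBijective Subtype.val ⟨Subtype.val_injective, fun h => ⟨⟨h, trivial⟩, rfl⟩⟩
    (fun _ => rfl) (fun _ _ => Iff.rfl) fun _ => Iff.rfl

/-- One component can be split off. -/
noncomputable def restrictInsertIso {s : Set Γ.Components} {i : Γ.Components} (hi : i ∉ s) :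
    Iso ((Γ.component i).union (Γ.restrict s)) (Γ.restrict (insert i s)) := by
  refine Iso.ofBijective
    (Sum.elim (fun h => ⟨h.1, Or.inl h.2⟩) fun h => ⟨h.1, Or.inr h.2⟩) ⟨?_, ?_⟩ ?_ ?_ ?_
  · rintro (h | h) (h' | h') e
    · have e := congrArg Subtype.val e
      have e : h.1 = h'.1 := e
      exact congrArg Sum.inl (Subtype.ext e)
    · refine absurd ?_ hi
      have e : h.1 = h'.1 := Subtype.ext_iff.1 e
      rw [← h.2, e]
      exact h'.2
    · refine absurd ?_ hi
      have e : h.1 = h'.1 := Subtype.ext_iff.1 e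
      rw [← h'.2, ← e]
      exact h.2
    · have e := congrArg Subtype.val e
      have e : h.1 = h'.1 := e
      exact congrArg Sum.inr (Subtype.ext e)
  · rintro ⟨h, hh | hh⟩
    · exact ⟨.inl ⟨h, hh⟩, rfl⟩
    · exact ⟨.inr ⟨h, hh⟩, rfl⟩
  · rintro (h | h) <;> rfl
  · have hne : ∀ (h : (Γ.component i).H) (h' : (Γ.restrict s).H), ¬ Γ.vert h.1 h'.1 := by
      intro h h' e
      refine hi ?_
      rw [← h.2, Quotient.sound (Γ.conn_vert e)]
      exact h'.2
    rintro (h | h) (h' | h')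
    · exact Sum.liftRel_inl_inl
    · exact iff_of_false Sum.not_liftRel_inl_inr (hne h h')
    · exact iff_of_false Sum.not_liftRel_inr_inl fun e => hne h' h (Γ.vert.symm e)
    · exact Sum.liftRel_inr_inr
  · rintro (h | h) <;> exact Iff.rfl

theorem mk_restrict (s : Finset Γ.Components) :
    GraphClass.mk (Γ.restrict s) = ∏ i ∈ s, GraphClass.mk (Γ.component i) := by
  classical
  induction s using Finset.induction_on with
  | empty =>
    rw [Finset.prod_empty]
    exact GraphClass.mk_eq_one.2 ⟨fun a => by simpa using a.2⟩
  | insert i s hi ih =>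
    rw [Finset.prod_insert hi, ← ih, GraphClass.mk_mul, Finset.coe_insert]
    exact (GraphClass.mk_eq_mk.2 ⟨Γ.restrictInsertIso (by simpa using hi)⟩).symm

theorem mk_eq_prod_component : GraphClass.mk Γ = ∏ i, GraphClass.mk (Γ.component i) := by
  rw [← Γ.mk_restrict, Finset.coe_univ]
  exact (GraphClass.mk_eq_mk.2 ⟨Γ.restrictUnivIso⟩).symm

theorem mk_eq_component_mul (i : Γ.Components) :
    GraphClass.mk Γ = GraphClass.mk (Γ.component i) * GraphClass.mk (Γ.restrict {i}ᶜ) := by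
  have h1 := GraphClass.mk_eq_mk.2 ⟨Γ.restrictInsertIso (s := {i}ᶜ) (i := i) (by simp)⟩
  rw [GraphClass.mk_mul, h1, Set.insert_eq, Set.union_compl_self]
  exact (GraphClass.mk_eq_mk.2 ⟨Γ.restrictUnivIso⟩).symm

/-- A component can be split off as a factor, so in an indecomposable graph the rest is empty.
Conversely no path leads from one part of a disjoint union to the other. -/
theorem isConn_mk_iff (h : Γ.IsPlus) : IsConn PlusClass (PlusClass.mk Γ h) ↔ Γ.IsConnPlus := by
  constructor
  · rintro ⟨h1, h2⟩
    have hne : Nonempty Γ.H := by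
      by_contra hne
      exact h1 (Subtype.ext (GraphClass.mk_eq_one.2 (not_nonempty_iff.1 hne)))
    obtain ⟨a⟩ := hne
    have hm := Γ.mk_eq_component_mul (Quotient.mk _ a)
    have hp := mk_mem_plusClasses.2 h
    rw [hm, mul_mem_plusClasses] at hp
    have hc : Γ.Connected := by
      refine ⟨⟨a⟩, ?_⟩
      rcases h2 ⟨_, hp.1⟩ ⟨_, hp.2⟩ (Subtype.ext hm) with h3 | h3
      · exact ((GraphClass.mk_eq_one.1 (congrArg Subtype.val h3)).false ⟨a, rfl⟩).elim
      · have he := GraphClass.mk_eq_one.1 (congrArg Subtype.val h3)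
        have : ∀ b, Γ.conn b a := by
          intro b
          by_contra hb
          exact he.elim ⟨b, fun e => hb (Quotient.exact e)⟩
        exact fun b c => Γ.conn.trans (this b) (Γ.conn.symm (this c))
    exact ⟨hc, hc.isPlus_iff.1 h⟩
  · rintro ⟨⟨⟨a⟩, h1⟩, -⟩
    refine ⟨fun e => (GraphClass.mk_eq_one.1 (congrArg Subtype.val e)).elim a, fun c d e => ?_⟩
    obtain ⟨A, hA, rfl⟩ := c.exists_mk
    obtain ⟨B, hB, rfl⟩ := d.exists_mk
    obtain ⟨f⟩ := GraphClass.mk_eq_mk.1 ((congrArg Subtype.val e).symm :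
      GraphClass.mk (A.union B) = GraphClass.mk Γ)
    by_contra! hne
    have hA' : Nonempty A.H := by
      by_contra hA'
      exact hne.1 (Subtype.ext (GraphClass.mk_eq_one.2 (not_nonempty_iff.1 hA')))
    have hB' : Nonempty B.H := by
      by_contra hB'
      exact hne.2 (Subtype.ext (GraphClass.mk_eq_one.2 (not_nonempty_iff.1 hB')))
    obtain ⟨x⟩ := hA'
    obtain ⟨y⟩ := hB'
    have := f.symm.conn (h1 (f.toEquiv (.inl x)) (f.toEquiv (.inr y)))
    have : (A.union B).conn (.inl x) (.inr y) := by
      have e1 : f.symm.toEquiv (f.toEquiv (.inl x)) = .inl x := f.toEquiv.symm_apply_apply _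
      have e2 : f.symm.toEquiv (f.toEquiv (.inr y)) = .inr y := f.toEquiv.symm_apply_apply _
      rwa [e1, e2] at this
    exact Sum.not_liftRel_inl_inr ((A.union_conn B _ _).1 this)

/-! ### Subgraphs and sets of edges -/

open LegGraph

variable {Γ}

/-- A subgraph, as a set of edges of the graph with legs. -/
def Subgraph.toSub (γ : Γ.Subgraph) : Γ.toLeg.Sub where
  S := γ.S
  edge_mem h hh := (Γ.toLeg_edge_of_internal (γ.internal h hh)).symm ▸ γ.edge_mem h hh
  edge_ne h hh := Γ.toLeg_edge_ne_iff.2 (γ.internal h hh)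

theorem Subgraph.toSub_bijective : Function.Bijective (Subgraph.toSub (Γ := Γ)) := by
  constructor
  · rintro ⟨S, _, _⟩ ⟨S', _, _⟩ h
    have h : S = S' := congrArg Sub.S h
    subst h
    rfl
  · intro ρ
    have hi : ∀ h ∈ ρ.S, Γ.IsInternal h := fun h hh => Γ.toLeg_edge_ne_iff.1 (ρ.edge_ne h hh)
    exact ⟨⟨ρ.S, fun h hh => Γ.toLeg_edge_of_internal (hi h hh) ▸ ρ.edge_mem h hh, hi⟩, rfl⟩

theorem Subgraph.nontrivial_iff (γ : Γ.Subgraph) :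
    γ.Nontrivial ↔ γ.toSub ≠ ⊥ ∧ γ.toSub ≠ ⊤ := by
  refine and_congr ?_ ?_
  · rw [← not_iff_not, not_not, Set.not_nonempty_iff_eq_empty]
    exact ⟨fun h => Sub.ext h, fun h => congrArg Sub.S h⟩
  · rw [← not_iff_not, not_not, ← top_le_iff]
    push Not
    exact ⟨fun h a ha => h a (Γ.toLeg_edge_ne_iff.1 ha),
      fun h a ha => h (a := a) (Γ.toLeg_edge_ne_iff.2 ha)⟩

theorem Subgraph.contractVert_iff (γ : Γ.Subgraph) {a b : Γ.H} :
    γ.contractVert a b ↔ cvert γ.toSub a b := by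
  constructor
  · refine eqvGen_le (s := cvert γ.toSub) fun a b h => ?_
    rcases h with h | ⟨ha, rfl⟩
    · exact cvert_of_vert _ h
    · have := cvert_edge γ.toSub (a := a) ha
      rwa [Γ.toLeg_edge_of_internal (γ.internal a ha)] at this
  · refine eqvGen_le (s := γ.contractVert) fun a b h => ?_
    rcases h with h | ⟨ha, rfl⟩
    · exact .rel _ _ (.inl h)
    · exact .rel _ _ (.inr ⟨ha, Γ.toLeg_edge_of_internal (γ.internal a ha)⟩)

theorem Subgraph.toGraph_edge_of_mem (γ : Γ.Subgraph) {h : Γ.H} (hs : h ∈ γ.support)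
    (hh : h ∈ γ.S) : γ.toGraph.edge (.inl ⟨h, hs⟩)
      = .inl ⟨Γ.edge h, γ.mem_support (γ.edge_mem h hh)⟩ := dif_pos hh

theorem Subgraph.toGraph_edge_of_notMem (γ : Γ.Subgraph) {h : Γ.H} (hs : h ∈ γ.support)
    (hh : h ∉ γ.S) : γ.toGraph.edge (.inl ⟨h, hs⟩) = .inr ⟨h, hs, hh⟩ := dif_neg hh

/-- The graph of a subgraph. -/
noncomputable def Subgraph.toGraphIso (γ : Γ.Subgraph) :
    Iso (quot ⊥ γ.toSub).complete γ.toGraph := by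
  have hs : ∀ q : (quot ⊥ γ.toSub).H, q.1 ∈ γ.support := by
    rintro ⟨h, -, k, hk, -, hc⟩
    exact ⟨k, hk, cvert_bot.1 hc⟩
  have hl : ∀ q : (quot ⊥ γ.toSub).H, (quot ⊥ γ.toSub).edge q = q ↔ q.1 ∉ γ.S := by
    intro q
    rw [← not_iff_not, not_not]
    exact quot_edge_ne_iff q
  have hq : ∀ h ∈ γ.support, ∃ q : (quot ⊥ γ.toSub).H, q.1 = h := by
    rintro h ⟨k, hk, hc⟩
    exact ⟨⟨h, Sub.notMem_bot, k, hk, Sub.notMem_bot, cvert_of_vert _ hc⟩, rfl⟩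
  refine Iso.ofBijective (Sum.elim (fun q => .inl ⟨q.1, hs q⟩)
    fun q => .inr ⟨q.1.1, hs q.1, (hl q.1).1 q.2⟩) ⟨?_, ?_⟩ ?_ ?_ ?_
  · rintro (q | q) (q' | q') e
    · have e := congrArg Subtype.val (Sum.inl_injective e)
      have e : q.1 = q'.1 := e
      exact congrArg Sum.inl (Subtype.ext e)
    · exact absurd e Sum.inl_ne_inr
    · exact absurd e Sum.inr_ne_inl
    · have e := congrArg Subtype.val (Sum.inr_injective e)
      have e : q.1.1 = q'.1.1 := e
      exact congrArg Sum.inr (Subtype.ext (Subtype.ext e))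
  · rintro (⟨h, hh⟩ | ⟨h, hh, hS⟩)
    · obtain ⟨q, rfl⟩ := hq h hh
      exact ⟨.inl q, rfl⟩
    · obtain ⟨q, rfl⟩ := hq h hh
      exact ⟨.inr ⟨q, (hl q).2 hS⟩, rfl⟩
  · rintro (q | q)
    · by_cases hh : q.1 ∈ γ.S
      · have h1 : (quot ⊥ γ.toSub).edge q ≠ q := fun e => (hl q).1 e hh
        rw [complete_edge_inl h1]
        refine Eq.trans ?_ (γ.toGraph_edge_of_mem (hs q) hh).symm
        refine congrArg Sum.inl (Subtype.ext ?_)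
        exact (quot_edge_of_mem hh).trans (Γ.toLeg_edge_of_internal (γ.internal _ hh))
      · rw [complete_edge_leg ((hl q).2 hh)]
        exact (γ.toGraph_edge_of_notMem (hs q) hh).symm
    · rfl
  · rintro (q | q) (q' | q')
    · refine complete_vert_inl.trans (cvert_bot.trans ?_)
      exact (Sum.liftRel_inl_inl (r := Γ.vert.comap Subtype.val)
        (a := ⟨q.1, hs q⟩) (c := ⟨q'.1, hs q'⟩)).symm
    · exact iff_of_false Sum.not_liftRel_inl_inr Sum.not_liftRel_inl_inr
    · exact iff_of_false Sum.not_liftRel_inr_inl Sum.not_liftRel_inr_inl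
    · refine Sum.liftRel_inr_inr.trans (Iff.trans ?_ Sum.liftRel_inr_inr.symm)
      refine ⟨fun (e : q = q') => by subst e; exact (⊥ : Setoid _).refl _, fun e => ?_⟩
      have e := congrArg Subtype.val e
      have e : q.1.1 = q'.1.1 := e
      exact Subtype.ext (Subtype.ext e)
  · rintro (q | q)
    · refine iff_of_false (inl_notMem_ext q) ?_
      rintro ⟨_, h⟩
      cases h
    · exact iff_of_true (inr_mem_ext q) ⟨_, rfl⟩

/-- Contraction keeps a graph connected, and nontriviality provides an internal edge that is not
contracted. -/
theorem Subgraph.Nontrivial.isPlus_contract (hΓ : Γ.Connected) {γ : Γ.Subgraph}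
    (hγ : γ.Nontrivial) : γ.contract.IsPlus := by
  obtain ⟨-, k, hk, hkS⟩ := hγ
  intro a
  refine ⟨⟨k, hkS⟩, ?_, hk⟩
  -- These are the half-edges whose vertex, after contraction, carries a surviving half-edge in the
  -- component of `a`. The set is closed under the connectedness of `Γ`, where contracted edges may
  -- be used too.
  let X : Set Γ.H := {h | ∃ b : γ.contract.H, γ.contractVert h b.1 ∧ γ.contract.conn b a}
  have hvert : ∀ x y, Γ.vert x y → x ∈ X → y ∈ X := by
    rintro x y h ⟨b, hb, hb'⟩
    exact ⟨b, γ.contractVert.trans (.rel _ _ (.inl (Γ.vert.symm h))) hb, hb'⟩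
  have hedge : ∀ x, x ∈ X → Γ.edge x ∈ X := by
    rintro x ⟨b, hb, hb'⟩
    by_cases hx : x ∈ γ.S
    · exact ⟨b, γ.contractVert.trans (γ.contractVert.symm (.rel _ _ (.inr ⟨hx, rfl⟩))) hb, hb'⟩
    · refine ⟨γ.contract.edge ⟨x, hx⟩, γ.contractVert.refl _, ?_⟩
      refine γ.contract.conn.trans (γ.contract.conn.symm (γ.contract.conn_edge ⟨x, hx⟩)) ?_
      exact γ.contract.conn.trans (γ.contract.conn_vert hb) hb'
  have key : ∀ x y, Γ.conn x y → (x ∈ X ↔ y ∈ X) := by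
    intro x y hxy
    induction hxy with
    | refl => rfl
    | symm _ _ _ ih => exact ih.symm
    | trans _ _ _ _ _ ih₁ ih₂ => exact ih₁.trans ih₂
    | rel x y h =>
      rcases h with h | rfl
      · exact ⟨hvert x y h, hvert y x (Γ.vert.symm h)⟩
      · refine ⟨hedge x, fun h => ?_⟩
        have := hedge _ h
        rwa [Γ.edge_edge] at this
  obtain ⟨b, hb, hb'⟩ := (key a.1 k (hΓ.2 _ _)).1 ⟨a, γ.contractVert.refl _, γ.contract.conn.refl _⟩
  refine γ.contract.conn.symm (γ.contract.conn.trans (γ.contract.conn_vert ?_) hb')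
  exact hb

/-- The contraction of a subgraph, as a part of the graph. -/
noncomputable def Subgraph.contractEmb (γ : Γ.Subgraph) : Emb γ.contract.toLeg Γ.toLeg γ.toSub where
  i := Subtype.val
  inj := Subtype.val_injective
  vert_iff _ _ := γ.contractVert_iff
  map_edge a ha := by
    have ha : γ.contract.IsInternal a := γ.contract.toLeg_edge_ne_iff.1 ha
    exact (congrArg Subtype.val (γ.contract.toLeg_edge_of_internal ha)).trans
      (Γ.toLeg_edge_of_internal (h := a.1) ha).symm
  notMem a := a.2
  mem_range h _ hh _ _ := ⟨⟨h, hh⟩, rfl⟩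

theorem Subgraph.contractEmb_sub_top (γ : Γ.Subgraph) : γ.contractEmb.sub ⊤ = ⊤ := by
  refine top_le_iff.1 fun h hh => ?_
  by_cases hS : h ∈ γ.S
  · exact Or.inl hS
  · have hh : Γ.IsInternal h := Γ.toLeg_edge_ne_iff.1 hh
    exact Or.inr ⟨⟨h, hS⟩, γ.contract.toLeg_edge_ne_iff.2 hh, rfl⟩

theorem Subgraph.mk_toGraph (γ : Γ.Subgraph) :
    GraphClass.mk γ.toGraph = (subquot ⊥ γ.toSub).1 :=
  GraphClass.mk_eq_mk.2 ⟨γ.toGraphIso.symm⟩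

/-- Nontriviality is essential: after contraction of all internal edges, external edges may remain
in `γ.contract`, whereas the subquotient is empty. -/
theorem Subgraph.Nontrivial.mk_contract (hΓ : Γ.Connected) {γ : Γ.Subgraph}
    (hγ : γ.Nontrivial) : GraphClass.mk γ.contract = (subquot γ.toSub ⊤).1 := by
  have h1 := PlusClass.mk_eq_subquot γ.contract (hγ.isPlus_contract hΓ)
  have h2 := γ.contractEmb.subquot_sub ⊥ ⊤
  rw [γ.contractEmb_sub_top, Emb.sub_bot] at h2
  exact congrArg Subtype.val (h1.trans h2.symm)

end Graph

end CK

namespace CK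

/-! ### The coproduct of the Connes-Kreimer bialgebra -/

open LegGraph

section Nabla

variable (K : Type u) [Field K]

theorem gen_mul (c d : GraphClass) : (gen (c * d) : HAlg K) = gen c * gen d := by
  rw [gen, gen, gen, MonoidAlgebra.single_mul_single, one_mul]

/-- The coproduct of the class of a graph all of whose components have internal edges. -/
noncomputable def copTensor : PlusClass →* HAlg K ⊗[K] HAlg K where
  toFun c := ((cop c).map fun p => gen p.1.1 ⊗ₜ[K] gen p.2.1).sum
  map_one' := by
    rw [cop_one, Multiset.map_singleton, Multiset.sum_singleton]
    rfl
  map_mul' a b := by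
    rw [cop_mul, Multiset.map_map]
    change Multiset.sum (Multiset.map _ (Multiset.product _ _)) = _
    rw [Multiset.product, Multiset.map_bind, Multiset.sum_bind, ← Multiset.sum_map_mul_right]
    refine congrArg _ (Multiset.map_congr rfl fun p _ => ?_)
    rw [Multiset.map_map, ← Multiset.sum_map_mul_left]
    refine congrArg _ (Multiset.map_congr rfl fun q _ => ?_)
    rw [Algebra.TensorProduct.tmul_mul_tmul, ← gen_mul, ← gen_mul]
    rfl

theorem copTensor_apply (c : PlusClass) :
    copTensor K c = ((cop c).map fun p => gen p.1.1 ⊗ₜ[K] gen p.2.1).sum := rfl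

/-- The summands `1 ⊗ Γ` and `Γ ⊗ 1` are the terms of the empty and of the full set of internal
edges. These are different sets because there is an internal edge, and all others are the nontrivial
subgraphs. -/
theorem nablaConn_of_isPlus {Γ : Graph} (hΓ : Γ.Connected) (h : Γ.IsPlus) :
    nablaConn K Γ = copTensor K (PlusClass.mk Γ h) := by
  classical
  have hne : (⊥ : Γ.toLeg.Sub) ≠ ⊤ := by
    obtain ⟨k, hk⟩ := hΓ.isPlus_iff.1 h
    intro e
    have : k ∈ (⊥ : Γ.toLeg.Sub).S := e ▸ Γ.toLeg_edge_ne_iff.2 hk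
    exact this
  let f : Γ.toLeg.Sub → HAlg K ⊗[K] HAlg K := fun ρ =>
    gen (subquot ⊥ ρ).1 ⊗ₜ[K] gen (subquot ρ ⊤).1
  have h1 : copTensor K (PlusClass.mk Γ h) = ∑ ρ, f ρ := by
    refine (congrArg (fun m => (Multiset.map _ m).sum) (plusCop_mk Γ h)).trans ?_
    rw [copSub, Multiset.map_map, Finset.sum]
    refine congrArg (fun m => (Multiset.map f m).sum) ?_
    refine congrArg Finset.val (Finset.eq_univ_of_forall fun ρ => ?_)
    exact mem_between.2 ⟨bot_le, le_top⟩
  let e : {γ : Γ.Subgraph // γ.Nontrivial} ≃ {ρ : Γ.toLeg.Sub // ρ ≠ ⊥ ∧ ρ ≠ ⊤} :=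
    (Equiv.ofBijective _ Graph.Subgraph.toSub_bijective).subtypeEquiv fun γ => γ.nontrivial_iff
  have h2 : ∑ᶠ γ : {γ : Γ.Subgraph // γ.Nontrivial},
      (gen (GraphClass.mk γ.1.toGraph) ⊗ₜ[K] gen (GraphClass.mk γ.1.contract) :
        HAlg K ⊗[K] HAlg K) = ∑ ρ ∈ Finset.univ.filter (fun ρ => ρ ≠ ⊥ ∧ ρ ≠ ⊤), f ρ := by
    rw [finsum_eq_of_bijective (g := fun ρ : {ρ : Γ.toLeg.Sub // ρ ≠ ⊥ ∧ ρ ≠ ⊤} => f ρ.1)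
      e e.bijective, finsum_eq_sum_of_fintype]
    · exact (Finset.sum_subtype _ (by simp) f).symm
    · intro γ
      rw [γ.1.mk_toGraph, γ.2.mk_contract hΓ]
      rfl
  have h3 : (Finset.univ.filter (fun ρ : Γ.toLeg.Sub => ρ ≠ ⊥ ∧ ρ ≠ ⊤))
      = (Finset.univ.erase ⊥).erase ⊤ := by
    ext ρ
    simp [and_comm]
  have hb : f ⊥ = 1 ⊗ₜ gen (GraphClass.mk Γ) := by
    change gen (subquot ⊥ ⊥).1 ⊗ₜ[K] gen (subquot ⊥ ⊤).1 = _
    rw [subquot_eq_one.2 le_rfl, ← PlusClass.mk_eq_subquot Γ h]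
    rfl
  have ht : f ⊤ = gen (GraphClass.mk Γ) ⊗ₜ 1 := by
    change gen (subquot ⊥ ⊤).1 ⊗ₜ[K] gen (subquot ⊤ ⊤).1 = _
    rw [subquot_eq_one.2 le_rfl, ← PlusClass.mk_eq_subquot Γ h]
    rfl
  rw [nablaConn, h1, h2, h3, ← hb, ← ht, add_assoc,
    Finset.add_sum_erase _ f (Finset.mem_erase.2 ⟨hne.symm, Finset.mem_univ _⟩),
    Finset.add_sum_erase _ f (Finset.mem_univ _)]

theorem nablaConn_of_not_isPlus {Γ : Graph} (hΓ : Γ.Connected) (h : ¬ Γ.IsPlus) :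
    nablaConn K Γ = 1 ⊗ₜ gen (GraphClass.mk Γ) + gen (GraphClass.mk Γ) ⊗ₜ 1 := by
  have : IsEmpty {γ : Γ.Subgraph // γ.Nontrivial} :=
    ⟨fun γ => h (hΓ.isPlus_iff.2 (γ.2.2.imp fun _ h => h.1))⟩
  rw [nablaConn, finsum_of_isEmpty, add_zero]

theorem nabla_gen (c : GraphClass) :
    nabla K (gen c) = ∏ i : c.rep.Components, nablaConn K (c.rep.component i) := by
  rw [← finprod_eq_prod_of_fintype]
  simp [nabla, gen]

theorem nabla_gen_plus (c : PlusClass) : nabla K (gen c.1) = copTensor K c := by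
  have hc : c.1.rep.IsPlus := mk_mem_plusClasses.1 ((GraphClass.mk_rep c.1).symm ▸ c.2)
  have hi := c.1.rep.isPlus_iff_component.1 hc
  have h1 : c = ∏ i, PlusClass.mk (c.1.rep.component i) (hi i) := by
    refine Subtype.ext ?_
    rw [Submonoid.coe_finsetProd]
    exact (GraphClass.mk_rep c.1).symm.trans c.1.rep.mk_eq_prod_component
  rw [nabla_gen]
  conv_rhs => rw [h1]
  rw [map_prod]
  exact Finset.prod_congr rfl fun i _ => nablaConn_of_isPlus K (c.1.rep.component_connected i) (hi i)

variable {K}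

theorem toDual_gen (x : HHat K) (c : GraphClass) : toDual x (gen c) = autScalar c * x c := by
  simp [toDual, gen]

/-- If a disjoint union has internal edges in all components, so has each of its parts; hence `x`
has no term divisible by `c`. -/
theorem toDual_gen_mul_of_notMem {x : HHat K} (hx : x ∈ HPlus K) {c : GraphClass}
    (hc : c ∉ plusClasses) (a : HAlg K) : toDual x (gen c * a) = 0 := by
  have h : toDual x ∘ₗ LinearMap.mulLeft K (gen c) = 0 := by
    refine MonoidAlgebra.lhom_ext' fun d => LinearMap.ext_ring ?_
    change toDual x (gen c * gen d) = 0
    rw [← gen_mul, toDual_gen]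
    by_cases h0 : x (c * d) = 0
    · rw [h0, mul_zero]
    · obtain ⟨Γ, hΓ⟩ := Quotient.exists_rep (c * d)
      have hΓ : GraphClass.mk Γ = c * d := hΓ
      have := mk_mem_plusClasses.2 (hx Γ (hΓ.symm ▸ h0))
      rw [hΓ] at this
      exact absurd (mul_mem_plusClasses.1 this).1 hc
  exact LinearMap.congr_fun h a

/-- Some component has no internal edge. It has no nontrivial subgraphs, so it is primitive and
divides one tensor factor of every term of the coproduct; there `x` or `y` vanishes. -/
theorem starProd_apply_of_notMem {x y : HHat K} (hx : x ∈ HPlus K) (hy : y ∈ HPlus K)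
    {c : GraphClass} (hc : c ∉ plusClasses) : starProd x y c = 0 := by
  classical
  have hr : ¬ c.rep.IsPlus := fun h => hc (GraphClass.mk_rep c ▸ mk_mem_plusClasses.2 h)
  rw [Graph.isPlus_iff_component] at hr
  push Not at hr
  obtain ⟨i, hi⟩ := hr
  have hg : GraphClass.mk (c.rep.component i) ∉ plusClasses := fun h => hi (mk_mem_plusClasses.1 h)
  have key : ∀ t : HAlg K ⊗[K] HAlg K, LinearMap.mul' K K (TensorProduct.map (toDual x) (toDual y)
      (nablaConn K (c.rep.component i) * t)) = 0 := by
    intro t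
    rw [nablaConn_of_not_isPlus K (c.rep.component_connected i) hi]
    induction t using TensorProduct.induction_on with
    | zero => simp
    | add s t hs ht => rw [mul_add, map_add, map_add, hs, ht, add_zero]
    | tmul a b =>
      rw [add_mul, Algebra.TensorProduct.tmul_mul_tmul, Algebra.TensorProduct.tmul_mul_tmul,
        map_add, map_add, TensorProduct.map_tmul, TensorProduct.map_tmul,
        toDual_gen_mul_of_notMem hx hg, toDual_gen_mul_of_notMem hy hg]
      simp
  have h1 : nabla K (gen c) = nablaConn K (c.rep.component i)
      * ∏ j ∈ Finset.univ.erase i, nablaConn K (c.rep.component j) := by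
    rw [nabla_gen]
    exact (Finset.mul_prod_erase _ (fun j => nablaConn K (c.rep.component j))
      (Finset.mem_univ i)).symm
  rw [starProd, h1, key, mul_zero]

theorem starProd_apply_plus (x y : HHat K) (c : PlusClass) :
    starProd x y c.1 = (autScalar c.1)⁻¹ * ((cop c).map fun p =>
      (autScalar p.1.1 * x p.1.1) * (autScalar p.2.1 * y p.2.1)).sum := by
  rw [starProd, nabla_gen_plus, copTensor_apply, map_multiset_sum, map_multiset_sum,
    Multiset.map_map, Multiset.map_map]
  refine congrArg _ (congrArg _ (Multiset.map_congr rfl fun p _ => ?_))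
  simp [toDual_gen]

theorem starProd_mem {x y : HHat K} (hx : x ∈ HPlus K) (hy : y ∈ HPlus K) :
    starProd x y ∈ HPlus K := by
  intro Γ h
  by_contra hΓ
  exact h (starProd_apply_of_notMem hx hy fun h => hΓ (mk_mem_plusClasses.1 h))

theorem apply_of_notMem {x : HHat K} (hx : x ∈ HPlus K) {c : GraphClass} (hc : c ∉ plusClasses) :
    x c = 0 := by
  by_contra h
  obtain ⟨Γ, rfl⟩ := Quotient.exists_rep c
  exact hc (mk_mem_plusClasses.2 (hx Γ h))

theorem oneHat_mem : oneHat ∈ HPlus K := by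
  intro Γ h
  by_contra hΓ
  refine h (if_neg fun e => hΓ ?_)
  exact mk_mem_plusClasses.1 (e ▸ one_mem plusClasses)

variable [CharZero K]

theorem autScalar_ne_zero (c : GraphClass) : (autScalar c : K) ≠ 0 := by
  have : Finite (Graph.Iso c.rep c.rep) := by
    refine Finite.of_injective (fun f => f.toEquiv) fun f g h => ?_
    cases f
    cases g
    cases h
    rfl
  have : Nonempty (Graph.Iso c.rep c.rep) := ⟨Graph.Iso.refl _⟩
  exact Nat.cast_ne_zero.2 Nat.card_pos.ne'

theorem autScalar_one : (autScalar (1 : GraphClass) : K) = 1 := by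
  have he : IsEmpty (1 : GraphClass).rep.H :=
    GraphClass.mk_eq_one.1 (GraphClass.mk_rep (1 : GraphClass))
  have : Unique (Graph.Iso (1 : GraphClass).rep (1 : GraphClass).rep) := by
    refine ⟨⟨Graph.Iso.refl _⟩, fun f => ?_⟩
    obtain ⟨f, _, _, _⟩ := f
    obtain rfl : f = Equiv.refl _ := Equiv.ext fun a => he.elim a
    rfl
  rw [autScalar, Graph.autCard, Nat.card_unique, Nat.cast_one]

end Nabla

end CK

/-! ### Extension by zero and rescaling of coefficients -/

namespace Profinite.FormalSum

variable {K : Type u} [Field K] {α : Type v} {β : Type w}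

/-- The extension of a formal sum by zero. -/
noncomputable def extendZero (i : α → β) (y : FormalSum K α) : FormalSum K β :=
  Function.extend (γ := K) i y (0 : β → K)

theorem extendZero_apply {i : α → β} (hi : Function.Injective i) (y : FormalSum K α) (a : α) :
    extendZero i y (i a) = y a := Function.Injective.extend_apply (γ := K) hi y (0 : β → K) a

theorem extendZero_of_notMem {i : α → β} (y : FormalSum K α) {b : β} (hb : b ∉ Set.range i) :
    extendZero i y b = 0 := Function.extend_apply' (γ := K) y (0 : β → K) b hb

/-- The formal sums with support in the image of an injective map, with weighted coefficients. -/
noncomputable def weightedEquiv (i : α → β) (hi : Function.Injective i) (s : β → K)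
    (hs : ∀ b, s b ≠ 0) (W : Submodule K (FormalSum K β))
    (hW : ∀ x : FormalSum K β, x ∈ W ↔ ∀ b, x b ≠ 0 → b ∈ Set.range i) : W ≃L[K] FormalSum K α where
  toFun x a := s (i a) * x.1 (i a)
  map_add' x y := funext fun a => mul_add _ _ _
  map_smul' k x := funext fun a => mul_left_comm _ _ _
  invFun y := ⟨fun b => (s b)⁻¹ * extendZero i y b, (hW _).2 fun b hb => by
    by_contra h
    refine hb ?_
    rw [extendZero_of_notMem _ h]
    exact mul_zero _⟩
  left_inv x := by
    refine Subtype.ext (funext fun b => ?_)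
    by_cases h : b ∈ Set.range i
    · obtain ⟨a, rfl⟩ := h
      change (s (i a))⁻¹ * extendZero i (fun a => s (i a) * x.1 (i a)) (i a) = _
      refine (congrArg _ (extendZero_apply hi _ a)).trans ?_
      exact inv_mul_cancel_left₀ (hs _) _
    · change (s b)⁻¹ * extendZero i (fun a => s (i a) * x.1 (i a)) b = _
      refine (congrArg _ (extendZero_of_notMem _ h)).trans ((mul_zero _).trans ?_)
      by_contra h'
      exact h ((hW _).1 x.2 b (Ne.symm h'))
  right_inv y := funext fun a => by
    change s (i a) * ((s (i a))⁻¹ * extendZero i y (i a)) = y a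
    rw [extendZero_apply hi, mul_inv_cancel_left₀ (hs _)]
  continuous_toFun := by
    refine continuous_iff.2 fun a => ?_
    let _ : TopologicalSpace K := ⊥
    have : Continuous fun x : W => x.1 (i a) := (continuous_apply (i a)).comp continuous_subtype_val
    exact continuous_discrete_comp (fun k => s (i a) * k) this
  continuous_invFun := by
    refine continuous_induced_rng.2 (continuous_iff.2 fun b => ?_)
    let _ : TopologicalSpace K := ⊥
    by_cases h : b ∈ Set.range i
    · obtain ⟨a, rfl⟩ := h
      have h1 : Continuous fun y : FormalSum K α => (s (i a))⁻¹ * y a :=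
        continuous_discrete_comp (fun k => (s (i a))⁻¹ * k) (continuous_apply a)
      refine h1.congr fun y => ?_
      change _ = (s (i a))⁻¹ * extendZero i y (i a)
      rw [extendZero_apply hi]
    · have h1 : Continuous fun _ : FormalSum K α => (0 : K) := continuous_const
      refine h1.congr fun y => ?_
      change _ = (s b)⁻¹ * extendZero i y b
      rw [extendZero_of_notMem _ h]
      exact (mul_zero _).symm

theorem weightedEquiv_symm_single {i : α → β} {hi : Function.Injective i} {s : β → K}
    {hs : ∀ b, s b ≠ 0} {W : Submodule K (FormalSum K β)}
    {hW : ∀ x : FormalSum K β, x ∈ W ↔ ∀ b, x b ≠ 0 → b ∈ Set.range i} (a : α) :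
    ((weightedEquiv i hi s hs W hW).symm (single K a)).1 = (s (i a))⁻¹ • single K (i a) := by
  funext b
  change (s b)⁻¹ * extendZero i (single K a) b = (s (i a))⁻¹ * single K (i a) b
  by_cases hb : b ∈ Set.range i
  · obtain ⟨c, rfl⟩ := hb
    rw [extendZero_apply hi]
    by_cases hc : c = a
    · rw [hc, single_self, single_self]
    · rw [single_of_ne hc, single_of_ne (fun h => hc (hi h)), mul_zero, mul_zero]
  · have hne : b ≠ i a := fun h => hb ⟨a, h.symm⟩
    rw [extendZero_of_notMem _ hb, single_of_ne hne, mul_zero, mul_zero]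

end Profinite.FormalSum

/-! ### Transport of the convolution bialgebra to formal sums of graphs -/

namespace CK

open FormalSum

variable {K : Type u} [Field K] [CharZero K]

theorem mem_HPlus_iff {x : HHat K} :
    x ∈ HPlus K ↔ ∀ c, x c ≠ 0 → c ∈ Set.range (Subtype.val : PlusClass → GraphClass) := by
  rw [Subtype.range_coe]
  refine ⟨fun hx c hc => ?_, fun h Γ hΓ => mk_mem_plusClasses.1 (h _ hΓ)⟩
  by_contra h
  exact hc (apply_of_notMem hx h)

theorem mem_HcPlus_iff {x : HHat K} :
    x ∈ HcPlus K ↔ ∀ c, x c ≠ 0 → c ∈ Set.range fun c : Conn PlusClass => c.1.1 := by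
  constructor
  · intro hx c hc
    obtain ⟨Γ, rfl⟩ := Quotient.exists_rep c
    have h := hx Γ hc
    have hp := h.1.isPlus_iff.2 h.2
    exact ⟨⟨PlusClass.mk Γ hp, (Γ.isConn_mk_iff hp).2 h⟩, rfl⟩
  · intro h Γ hΓ
    obtain ⟨⟨c, hc⟩, hcΓ⟩ := h _ hΓ
    have hp : Γ.IsPlus := mk_mem_plusClasses.1 (hcΓ ▸ c.2)
    obtain rfl : c = PlusClass.mk Γ hp := Subtype.ext hcΓ
    exact (Γ.isConn_mk_iff hp).1 hc

theorem HcPlus_le_HPlus : HcPlus K ≤ HPlus K := fun _ hx => mem_HPlus_iff.2 fun c hc => by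
  obtain ⟨d, rfl⟩ := mem_HcPlus_iff.1 hx c hc
  exact ⟨d.1, rfl⟩

variable (K) in
/-- The formal sums of graphs all of whose components have internal edges, as functions on the
classes. -/
noncomputable def plusEquiv : HPlus K ≃L[K] FormalSum K PlusClass :=
  weightedEquiv Subtype.val Subtype.val_injective autScalar autScalar_ne_zero _
    fun _ => mem_HPlus_iff

variable (K) in
/-- The formal sums of connected graphs with internal edges, as functions on the classes. -/
noncomputable def connEquiv : HcPlus K ≃L[K] FormalSum K (Conn PlusClass) :=
  weightedEquiv (fun c => c.1.1) (Subtype.val_injective.comp Subtype.val_injective) autScalar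
    autScalar_ne_zero _ fun _ => mem_HcPlus_iff

theorem plusEquiv_apply (x : HPlus K) (c : PlusClass) :
    plusEquiv K x c = autScalar c.1 * x.1 c.1 := rfl

/-- The weight `|Aut|` is the one in the identification with the dual, so the rescaled coefficients
are the values of the dual form and `⋆` becomes plain convolution. -/
theorem plusEquiv_star (x y : HPlus K) :
    plusEquiv K ⟨starProd x.1 y.1, starProd_mem x.2 y.2⟩ = plusEquiv K x * plusEquiv K y := by
  funext c
  rw [plusEquiv_apply]
  refine (congrArg _ (starProd_apply_plus x.1 y.1 c)).trans ?_
  exact mul_inv_cancel_left₀ (autScalar_ne_zero _) _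

theorem plusEquiv_one : plusEquiv K ⟨oneHat, oneHat_mem⟩ = 1 := by
  funext c
  rw [plusEquiv_apply]
  by_cases hc : c = 1
  · subst hc
    rw [one_apply_one]
    change autScalar (1 : GraphClass) * oneHat (1 : GraphClass) = (1 : K)
    rw [autScalar_one, one_mul]
    exact single_self _
  · rw [one_apply_of_ne hc]
    have : (oneHat : HHat K) c.1 = 0 := single_of_ne fun h => hc (Subtype.ext h)
    exact (congrArg _ this).trans (mul_zero _)

theorem plusEquiv_symm_mul (f g : FormalSum K PlusClass) :
    ((plusEquiv K).symm (f * g)).1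
      = starProd ((plusEquiv K).symm f).1 ((plusEquiv K).symm g).1 := by
  have h := plusEquiv_star ((plusEquiv K).symm f) ((plusEquiv K).symm g)
  rw [ContinuousLinearEquiv.apply_symm_apply, ContinuousLinearEquiv.apply_symm_apply] at h
  rw [← h, ContinuousLinearEquiv.symm_apply_apply]

theorem plusEquiv_symm_one : ((plusEquiv K).symm 1).1 = oneHat := by
  rw [← plusEquiv_one, ContinuousLinearEquiv.symm_apply_apply]

theorem plusEquiv_symm_single (c : PlusClass) :
    ((plusEquiv K).symm (single K c)).1 = (autScalar c.1 : K)⁻¹ • single K c.1 :=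
  weightedEquiv_symm_single (i := Subtype.val) c

theorem isPrim_plusEquiv_iff (x : HPlus K) :
    IsPrim (plusEquiv K x : PlusClass → K) ↔ x.1 ∈ HcPlus K := by
  refine isPrim_iff.trans (Iff.trans ?_ mem_HcPlus_iff.symm)
  constructor
  · intro h c hc
    obtain ⟨d, rfl⟩ := mem_HPlus_iff.1 x.2 c hc
    exact ⟨⟨d, h d (mul_ne_zero (autScalar_ne_zero _) hc)⟩, rfl⟩
  · intro h c hc
    obtain ⟨d, hd⟩ := h c.1 (right_ne_zero_of_mul hc)
    obtain rfl : d.1 = c := Subtype.ext hd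
    exact d.2

theorem incl_connEquiv (x : HcPlus K) :
    incl (connEquiv K) x = plusEquiv K ⟨x.1, HcPlus_le_HPlus x.2⟩ := by
  funext c
  rw [plusEquiv_apply]
  by_cases hc : IsConn PlusClass c
  · exact incl_apply_conn (connEquiv K) x ⟨c, hc⟩
  · rw [incl_apply_of_not _ hc]
    have hx := (isPrim_plusEquiv_iff ⟨x.1, HcPlus_le_HPlus x.2⟩).2 x.2
    by_contra h
    exact hc (isPrim_iff.1 hx c (Ne.symm h))

theorem commutator_mem (x y : HcPlus K) : starProd x.1 y.1 - starProd y.1 x.1 ∈ HcPlus K := by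
  let x' : HPlus K := ⟨x.1, HcPlus_le_HPlus x.2⟩
  let y' : HPlus K := ⟨y.1, HcPlus_le_HPlus y.2⟩
  have h := IsPrim.commutator ((isPrim_plusEquiv_iff x').2 x.2) ((isPrim_plusEquiv_iff y').2 y.2)
  let s : HPlus K := ⟨starProd x.1 y.1, starProd_mem x'.2 y'.2⟩
  let t : HPlus K := ⟨starProd y.1 x.1, starProd_mem y'.2 x'.2⟩
  refine (isPrim_plusEquiv_iff (s - t)).1 ?_
  rw [map_sub, plusEquiv_star x' y', plusEquiv_star y' x']
  exact h

/-- The commutator of primitive elements is primitive, so the truncation in the definition of the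
bracket removes nothing. -/
theorem bracket_val (x y : HcPlus K) :
    (bracket x y).1 = starProd x.1 y.1 - starProd y.1 x.1 := by
  funext c
  by_cases h : ∀ Γ : Graph, GraphClass.mk Γ = c → Γ.IsConnPlus
  · exact if_pos h
  · refine (if_neg h).trans ?_
    by_contra h0
    exact h fun Γ hΓ => commutator_mem x y Γ (hΓ.symm ▸ Ne.symm h0)

theorem incl_bracket (x y : HcPlus K) : incl (connEquiv K) (bracket x y)
    = incl (connEquiv K) x * incl (connEquiv K) y
      - incl (connEquiv K) y * incl (connEquiv K) x := by
  rw [incl_connEquiv, incl_connEquiv, incl_connEquiv, ← plusEquiv_star, ← plusEquiv_star, ← map_sub]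
  exact congrArg _ (Subtype.ext (bracket_val x y))

theorem bracket_self (x : HcPlus K) : bracket x x = 0 :=
  Subtype.ext ((bracket_val x x).trans (sub_self _))

/-- The bracket embeds as a commutator in an associative ring. -/
theorem bracket_jacobi (x y z : HcPlus K) :
    bracket x (bracket y z) + bracket y (bracket z x) + bracket z (bracket x y) = 0 := by
  refine incl_injective (connEquiv K) ?_
  simp only [map_add, map_zero, incl_bracket]
  simp only [mul_sub, sub_mul, mul_assoc]
  abel

variable (K) in
/-- The comultiplication of the formal sums of graphs all of whose components have internal
edges. -/
noncomputable def comulPlus : HPlus K →ₗ[K] CompletedTensor K (HPlus K) (HPlus K) :=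
  CompletedTensor.map (plusEquiv K).symm.toContinuousLinearMap
    (plusEquiv K).symm.toContinuousLinearMap ∘ₗ comulHat PlusClass K
      ∘ₗ (plusEquiv K).toContinuousLinearMap.toLinearMap

theorem comulPlus_apply (x : HPlus K) : comulPlus K x
    = CompletedTensor.map (plusEquiv K).symm.toContinuousLinearMap
      (plusEquiv K).symm.toContinuousLinearMap (comulHat PlusClass K (plusEquiv K x)) := rfl

theorem continuous_comulPlus : Continuous (comulPlus K) :=
  (CompletedTensor.continuous_map _ _).comp
    ((continuous_comulHat PlusClass K).comp (plusEquiv K).continuous)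

/-- A coefficient of `coprod x` at a pair is nonzero only if `x` has the disjoint union as a term,
and then both parts have internal edges in all components; the rest is a matter of the weights. -/
theorem map_subtype_comulPlus (x : HPlus K) :
    CompletedTensor.map (HPlus K).subtypeL (HPlus K).subtypeL (comulPlus K x) = coprod x.1 := by
  rw [comulPlus_apply, CompletedTensor.map_map, comulHat_apply]
  refine map_tensor _ (i := Subtype.val) Subtype.val_injective (s := fun c => (autScalar c.1)⁻¹)
    plusEquiv_symm_single (fun a b => ?_) (fun c d h => ?_)
  · rw [← gen_mul, toDual_gen]
    rfl
  · rw [← gen_mul, toDual_gen] at h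
    have hx : x.1 (c * d) ≠ 0 := right_ne_zero_of_mul (right_ne_zero_of_mul h)
    have := mem_HPlus_iff.1 x.2 _ hx
    rw [Subtype.range_coe] at this ⊢
    rw [Subtype.range_coe]
    exact mul_mem_plusClasses.1 this

theorem comulPlus_eq_iff (x : HPlus K) :
    comulPlus K x = CompletedTensor.ofTensor K (HPlus K) (HPlus K)
      (x ⊗ₜ[K] ⟨oneHat, oneHat_mem⟩ + ⟨oneHat, oneHat_mem⟩ ⊗ₜ[K] x) ↔ x.1 ∈ HcPlus K := by
  rw [← isPrim_plusEquiv_iff, ← comulHat_eq_iff, comulPlus_apply]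
  have h1 : CompletedTensor.ofTensor K (HPlus K) (HPlus K)
      (x ⊗ₜ[K] ⟨oneHat, oneHat_mem⟩ + ⟨oneHat, oneHat_mem⟩ ⊗ₜ[K] x)
      = CompletedTensor.map (plusEquiv K).symm.toContinuousLinearMap
        (plusEquiv K).symm.toContinuousLinearMap (CompletedTensor.ofTensor K _ _
          (plusEquiv K x ⊗ₜ 1 + 1 ⊗ₜ plusEquiv K x)) := by
    rw [CompletedTensor.map_ofTensor, ← plusEquiv_one]
    refine congrArg _ ?_
    rw [map_add, TensorProduct.map_tmul, TensorProduct.map_tmul]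
    simp
  have hinj : Function.Injective (CompletedTensor.map (plusEquiv K).symm.toContinuousLinearMap
      (plusEquiv K).symm.toContinuousLinearMap) := by
    refine Function.LeftInverse.injective (g := CompletedTensor.map
      (plusEquiv K).toContinuousLinearMap (plusEquiv K).toContinuousLinearMap) fun z => ?_
    rw [CompletedTensor.map_map, ContinuousLinearEquiv.coe_comp_coe_symm, CompletedTensor.map_id]
  rw [h1]
  exact hinj.eq_iff

theorem continuous_starProd :
    Continuous fun p : HPlus K × HPlus K => starProd p.1.1 p.2.1 := by
  have h : Continuous fun p : HPlus K × HPlus K =>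
      ((plusEquiv K).symm (plusEquiv K p.1 * plusEquiv K p.2)).1 :=
    continuous_subtype_val.comp ((plusEquiv K).symm.continuous.comp
      (((plusEquiv K).continuous.comp continuous_fst).mul
        ((plusEquiv K).continuous.comp continuous_snd)))
  refine h.congr fun p => ?_
  rw [plusEquiv_symm_mul, ContinuousLinearEquiv.symm_apply_apply,
    ContinuousLinearEquiv.symm_apply_apply]

theorem starProd_assoc (x y z : HPlus K) :
    starProd (starProd x.1 y.1) z.1 = starProd x.1 (starProd y.1 z.1) := by
  have h := mul_assoc (plusEquiv K x) (plusEquiv K y) (plusEquiv K z)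
  rw [← plusEquiv_star, ← plusEquiv_star, ← plusEquiv_star, ← plusEquiv_star] at h
  exact congrArg Subtype.val ((plusEquiv K).injective h)

theorem oneHat_starProd (x : HPlus K) : starProd oneHat x.1 = x.1 := by
  have h := one_mul (plusEquiv K x)
  rw [← plusEquiv_one, ← plusEquiv_star] at h
  exact congrArg Subtype.val ((plusEquiv K).injective h)

theorem starProd_oneHat (x : HPlus K) : starProd x.1 oneHat = x.1 := by
  have h := mul_one (plusEquiv K x)
  rw [← plusEquiv_one, ← plusEquiv_star] at h
  exact congrArg Subtype.val ((plusEquiv K).injective h)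

end CK

/-! ### Uniqueness of the comultiplication and the counit -/

namespace Profinite.CompletedEnveloping

variable {K : Type u} [Field K] {V : Type v} [AddCommGroup V] [Module K V] [TopologicalSpace V]
variable {br : V → V → V}

/-- The tensor algebra has dense image and the completed tensor product is Hausdorff. -/
theorem IsComul.unique {D D' : CompletedEnveloping K br →ₗ[K]
    CompletedTensor K (CompletedEnveloping K br) (CompletedEnveloping K br)}
    (h : IsComul D) (h' : IsComul D') : D' = D := by
  refine LinearMap.ext fun u => congrFun ?_ u
  refine (denseRange_ofTensorAlgebra br).equalizer h'.1 h.1 (funext fun t => ?_)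
  exact (h'.2 t).trans (h.2 t).symm

theorem IsCounit.unique {E E' : CompletedEnveloping K br →ₗ[K] K}
    (h : IsCounit E) (h' : IsCounit E') : E' = E := by
  let _ : TopologicalSpace K := ⊥
  have : DiscreteTopology K := ⟨rfl⟩
  refine LinearMap.ext fun u => congrFun ?_ u
  refine (denseRange_ofTensorAlgebra br).equalizer h'.1 h.1 (funext fun t => ?_)
  exact (h'.2 t).trans (h.2 t).symm

end Profinite.CompletedEnveloping

/-! ### The isomorphism for graphs and its compatibility with the coalgebra structures -/

namespace CK

variable {K : Type u} [Field K] [CharZero K]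

variable (K) in
/-- The completed enveloping algebra of the Lie algebra of formal sums of connected graphs. -/
noncomputable def graphEnvelopingEquiv : CompletedEnveloping K (bracket (K := K)) ≃L[K] HPlus K :=
  (envelopingEquiv (connEquiv K) incl_bracket).trans (plusEquiv K).symm

theorem plusEquiv_graphEnvelopingEquiv (u : CompletedEnveloping K (bracket (K := K))) :
    plusEquiv K (graphEnvelopingEquiv K u) = envelopingEquiv (connEquiv K) incl_bracket u :=
  ContinuousLinearEquiv.apply_symm_apply _ _

theorem graphEnvelopingEquiv_mul (u v : CompletedEnveloping K (bracket (K := K))) :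
    (graphEnvelopingEquiv K (u * v)).1
      = starProd (graphEnvelopingEquiv K u).1 (graphEnvelopingEquiv K v).1 := by
  refine Eq.trans ?_ (plusEquiv_symm_mul _ _)
  exact congrArg (fun f => ((plusEquiv K).symm f).1) (envelopingEquiv_mul (connEquiv K) _ u v)

theorem graphEnvelopingEquiv_one : (graphEnvelopingEquiv K 1).1 = oneHat := by
  refine Eq.trans ?_ plusEquiv_symm_one
  exact congrArg (fun f => ((plusEquiv K).symm f).1) (envelopingEquiv_one (connEquiv K) _)

theorem graphEnvelopingEquiv_ofTensorAlgebra (t : TensorAlgebra K (HcPlus K)) :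
    graphEnvelopingEquiv K (CompletedEnveloping.ofTensorAlgebra K bracket t)
      = (plusEquiv K).symm (tensorHom (connEquiv K) t) :=
  congrArg (plusEquiv K).symm (envelopingEquiv_ofTensorAlgebra (connEquiv K) _ t)

theorem graphEnvelopingEquiv_ι (x : HcPlus K) :
    (graphEnvelopingEquiv K (CompletedEnveloping.ι K bracket x)).1 = x.1 := by
  have h := graphEnvelopingEquiv_ofTensorAlgebra (TensorAlgebra.ι K x)
  rw [tensorHom_ι, incl_connEquiv, ContinuousLinearEquiv.symm_apply_apply] at h
  exact congrArg Subtype.val h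

theorem graphEnvelopingEquiv_prod (l : List (HcPlus K)) :
    (graphEnvelopingEquiv K (l.map (CompletedEnveloping.ι K bracket)).prod).1
      = l.foldr (fun x y => starProd x.1 y) oneHat := by
  induction l with
  | nil => exact graphEnvelopingEquiv_one
  | cons x l ih =>
    rw [List.map_cons, List.prod_cons, graphEnvelopingEquiv_mul, graphEnvelopingEquiv_ι, ih,
      List.foldr_cons]

/-- Products of vectors span the tensor algebra, whose image is dense. -/
theorem eq_graphEnvelopingEquiv (Ψ : CompletedEnveloping K (bracket (K := K)) →L[K] HPlus K)
    (h : ∀ l : List (HcPlus K), (Ψ (l.map (CompletedEnveloping.ι K bracket)).prod).1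
      = l.foldr (fun x y => starProd x.1 y) oneHat)
    (u : CompletedEnveloping K (bracket (K := K))) : Ψ u = graphEnvelopingEquiv K u := by
  have h1 : Ψ.toLinearMap ∘ₗ (CompletedEnveloping.ofTensorAlgebra K bracket).toLinearMap
      = (graphEnvelopingEquiv K).toContinuousLinearMap.toLinearMap
        ∘ₗ (CompletedEnveloping.ofTensorAlgebra K bracket).toLinearMap := by
    refine tensorAlgebra_linearMap_ext fun l => Subtype.ext ?_
    have h2 : CompletedEnveloping.ofTensorAlgebra K bracket (l.map (TensorAlgebra.ι K)).prod
        = (l.map (CompletedEnveloping.ι K (bracket (K := K)))).prod := by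
      rw [map_list_prod, List.map_map]
      rfl
    change (Ψ (CompletedEnveloping.ofTensorAlgebra K bracket _)).1
      = (graphEnvelopingEquiv K (CompletedEnveloping.ofTensorAlgebra K bracket _)).1
    rw [h2, h, graphEnvelopingEquiv_prod]
  refine congrFun ?_ u
  exact (CompletedEnveloping.denseRange_ofTensorAlgebra bracket).equalizer Ψ.continuous
    (graphEnvelopingEquiv K).continuous (funext fun t => LinearMap.congr_fun h1 t)

variable (K) in
/-- The comultiplication of the completed enveloping algebra. -/
noncomputable def comulEnveloping : CompletedEnveloping K (bracket (K := K)) →ₗ[K]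
    CompletedTensor K (CompletedEnveloping K (bracket (K := K)))
      (CompletedEnveloping K (bracket (K := K))) :=
  CompletedTensor.map (graphEnvelopingEquiv K).symm.toContinuousLinearMap
    (graphEnvelopingEquiv K).symm.toContinuousLinearMap ∘ₗ comulPlus K
      ∘ₗ (graphEnvelopingEquiv K).toContinuousLinearMap.toLinearMap

theorem comulEnveloping_apply (u : CompletedEnveloping K (bracket (K := K))) : comulEnveloping K u
    = CompletedTensor.map (graphEnvelopingEquiv K).symm.toContinuousLinearMap
      (graphEnvelopingEquiv K).symm.toContinuousLinearMap
        (comulPlus K (graphEnvelopingEquiv K u)) := rfl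

theorem comulPlus_graphEnvelopingEquiv (u : CompletedEnveloping K (bracket (K := K))) :
    comulPlus K (graphEnvelopingEquiv K u)
      = CompletedTensor.map (graphEnvelopingEquiv K).toContinuousLinearMap
        (graphEnvelopingEquiv K).toContinuousLinearMap (comulEnveloping K u) := by
  rw [comulEnveloping_apply, CompletedTensor.map_map, ContinuousLinearEquiv.coe_comp_coe_symm,
    CompletedTensor.map_id]

/-- The comultiplication is transported along the isomorphism, hence continuous. What remains is its
value on tensors, which `comulHat_tensorHom` gives. -/
theorem isComul_comulEnveloping : CompletedEnveloping.IsComul (comulEnveloping K) := by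
  refine ⟨(CompletedTensor.continuous_map _ _).comp
    (continuous_comulPlus.comp (graphEnvelopingEquiv K).continuous), fun t => ?_⟩
  rw [comulEnveloping_apply, comulPlus_apply, plusEquiv_graphEnvelopingEquiv,
    envelopingEquiv_ofTensorAlgebra, comulHat_tensorHom, CompletedTensor.map_ofTensor,
    CompletedTensor.map_ofTensor]
  refine congrArg _ ?_
  rw [← LinearMap.comp_apply, ← TensorProduct.map_comp, ← LinearMap.comp_apply,
    ← TensorProduct.map_comp]
  have h : ((graphEnvelopingEquiv K).symm.toContinuousLinearMap.toLinearMap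
      ∘ₗ (plusEquiv K).symm.toContinuousLinearMap.toLinearMap)
        ∘ₗ (tensorHom (connEquiv K)).toLinearMap
      = (CompletedEnveloping.ofTensorAlgebra K bracket).toLinearMap := by
    refine LinearMap.ext fun t => ?_
    change (graphEnvelopingEquiv K).symm ((plusEquiv K).symm (tensorHom (connEquiv K) t)) = _
    rw [← graphEnvelopingEquiv_ofTensorAlgebra, ContinuousLinearEquiv.symm_apply_apply]
    rfl
  exact congrArg (fun f => TensorProduct.map f f _) h

variable (K) in
/-- The counit of the completed enveloping algebra. -/
noncomputable def counitEnveloping : CompletedEnveloping K (bracket (K := K)) →ₗ[K] K :=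
  FormalSum.ev K 1 ∘ₗ (HPlus K).subtype ∘ₗ (graphEnvelopingEquiv K).toContinuousLinearMap.toLinearMap

theorem counitEnveloping_apply (u : CompletedEnveloping K (bracket (K := K))) :
    counitEnveloping K u = (graphEnvelopingEquiv K u).1 (1 : GraphClass) := rfl

theorem isCounit_counitEnveloping : CompletedEnveloping.IsCounit (counitEnveloping K) := by
  constructor
  · let _ : TopologicalSpace K := ⊥
    exact (FormalSum.continuous_apply (1 : GraphClass)).comp
      (continuous_subtype_val.comp (graphEnvelopingEquiv K).continuous)
  · intro t
    rw [counitEnveloping_apply, ← tensorHom_apply_one (connEquiv K) t]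
    have h := plusEquiv_apply (graphEnvelopingEquiv K
      (CompletedEnveloping.ofTensorAlgebra K bracket t)) 1
    rw [plusEquiv_graphEnvelopingEquiv, envelopingEquiv_ofTensorAlgebra] at h
    rw [h]
    change _ = autScalar (1 : GraphClass) * _
    -- The empty graph has one automorphism, so the rescaling does not affect the counit.
    rw [autScalar_one, one_mul]
    rfl

end CK

theorem mainTheorem4 (K : Type u) [Field K] [CharZero K] :
    -- `Ĥ⁺` is an algebra under `⋆`, with a continuous product
    ∃ h1 : oneHat ∈ HPlus K,
    (∀ x ∈ HPlus K, ∀ y ∈ HPlus K, starProd x y ∈ HPlus K) ∧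
    (∀ x ∈ HPlus K, ∀ y ∈ HPlus K, ∀ z ∈ HPlus K,
      starProd (starProd x y) z = starProd x (starProd y z)) ∧
    (∀ x ∈ HPlus K, starProd oneHat x = x ∧ starProd x oneHat = x) ∧
    Continuous (fun p : HPlus K × HPlus K => starProd p.1.1 p.2.1) ∧
    -- the comultiplication `Δ` restricts to `ΔP : Ĥ⁺ → Ĥ⁺ ⊗̂ Ĥ⁺`
    ∃ ΔP : HPlus K →ₗ[K] CompletedTensor K (HPlus K) (HPlus K),
    Continuous ΔP ∧
    (∀ x : HPlus K,
      CompletedTensor.map (HPlus K).subtypeL (HPlus K).subtypeL (ΔP x) = coprod x.1) ∧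
    -- the space of primitive elements of `Ĥ⁺` is `Ĥ_c⁺`
    HcPlus K ≤ HPlus K ∧
    (∀ x : HPlus K,
      ΔP x = CompletedTensor.ofTensor K (HPlus K) (HPlus K)
        (x ⊗ₜ[K] ⟨oneHat, h1⟩ + ⟨oneHat, h1⟩ ⊗ₜ[K] x) ↔ x.1 ∈ HcPlus K) ∧
    -- `Ĥ_c⁺` is a Lie algebra under the commutator of `⋆`
    (∀ x y : HcPlus K, (bracket x y).1 = starProd x.1 y.1 - starProd y.1 x.1) ∧
    (∀ x : HcPlus K, bracket x x = 0) ∧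
    (∀ x y z : HcPlus K,
      bracket x (bracket y z) + bracket y (bracket z x) + bracket z (bracket x y) = 0) ∧
    -- the comultiplication `D` and the counit `E` of the completed enveloping algebra of `Ĥ_c⁺`
    ∃ D, CompletedEnveloping.IsComul (K := K) (br := bracket (K := K)) D ∧
    (∀ D', CompletedEnveloping.IsComul D' → D' = D) ∧
    ∃ E, CompletedEnveloping.IsCounit (K := K) (br := bracket (K := K)) E ∧
    (∀ E', CompletedEnveloping.IsCounit E' → E' = E) ∧
    -- the isomorphism `Φ`, linear and a homeomorphism
    ∃ Φ : CompletedEnveloping K (bracket (K := K)) ≃L[K] HPlus K,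
    -- it sends `Γ₁ ⊗ ⋯ ⊗ Γₙ` to `Γ₁ ⋆ ⋯ ⋆ Γₙ`, and is the only continuous linear map to do so
    (∀ l : List (HcPlus K), (Φ (l.map (CompletedEnveloping.ι K bracket)).prod).1
      = l.foldr (fun x y => starProd x.1 y) oneHat) ∧
    (∀ Ψ : CompletedEnveloping K (bracket (K := K)) →L[K] HPlus K,
      (∀ l : List (HcPlus K), (Ψ (l.map (CompletedEnveloping.ι K bracket)).prod).1
        = l.foldr (fun x y => starProd x.1 y) oneHat) → ∀ u, Ψ u = Φ u) ∧
    -- it is an isomorphism of algebras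
    (Φ 1).1 = oneHat ∧
    (∀ u v, (Φ (u * v)).1 = starProd (Φ u).1 (Φ v).1) ∧
    -- it is an isomorphism of coalgebras
    (∀ u, ΔP (Φ u) = CompletedTensor.map Φ.toContinuousLinearMap Φ.toContinuousLinearMap (D u)) ∧
    (∀ u, (Φ u).1 (1 : GraphClass) = E u) := by
  refine ⟨oneHat_mem, fun x hx y hy => starProd_mem hx hy,
    fun x hx y hy z hz => starProd_assoc ⟨x, hx⟩ ⟨y, hy⟩ ⟨z, hz⟩,
    fun x hx => ⟨oneHat_starProd ⟨x, hx⟩, starProd_oneHat ⟨x, hx⟩⟩, continuous_starProd,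
    comulPlus K, continuous_comulPlus, map_subtype_comulPlus, HcPlus_le_HPlus, comulPlus_eq_iff,
    bracket_val, bracket_self, bracket_jacobi,
    comulEnveloping K, isComul_comulEnveloping, fun D' h => isComul_comulEnveloping.unique h,
    counitEnveloping K, isCounit_counitEnveloping,
    fun E' h => isCounit_counitEnveloping.unique h,
    graphEnvelopingEquiv K, graphEnvelopingEquiv_prod, eq_graphEnvelopingEquiv,
    graphEnvelopingEquiv_one, graphEnvelopingEquiv_mul, comulPlus_graphEnvelopingEquiv,
    fun u => (counitEnveloping_apply u).symm⟩
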